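/- Let $M$ be a smooth supermanifold over $k=\mathbb R$, or a complex analytic supermanifold over $k=\mathbb C$, or a formal supermanifold over a field $k$ of characteristic zero (locally a point with algebra of functions $k[[x_1,\dots,x_p]]\otimes\Lambda(\xi_1,\dots,\xi_q)$); ordinary manifolds are the case without odd coordinates. Let $\mathcal O_M$ be its structure sheaf, $\mathcal F$ a locally free sheaf of $\mathcal O_M$-supermodules of finite rank, and $\nabla_0$ a flat connection on $\mathcal F$: an odd $k$-linear operator $\nabla_0:\mathcal F\to\Omega^1_M\otimes\mathcal F$ with $\nabla_0(\varphi f)=d\varphi\otimes f+(-1)^{\tilde\varphi}\varphi\,\nabla_0 f$, where $\tilde\varphi$ is the parity of $\varphi$ and the de Rham differential $d$ is odd, whose extension to $\Omega^*_M\otimes\mathcal F$ satisfies $\nabla_0^2=0$. Let $\mathcal A:\mathcal F\to\Omega^1_M\otimes\mathcal F$ be an odd $\mathcal O_M$-linear operator, $\mathcal A(\varphi f)=(-1)^{\tilde\varphi}\varphi\,\mathcal A(f)$. Proposition 3.2. $\nabla_0+\lambda\mathcal A$ is a pencil of flat connections, that is, $(\nabla_0+\lambda\mathcal A)^2=0$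 for all $\lambda\in k$, if and only if the following two conditions are satisfied: (i) Every point of $M$ has an open neighbourhood $U$ on which $\mathcal A=\nabla_0\mathcal B$ for some section $\mathcal B$ of $\mathcal End\,\mathcal F$ over $U$. (ii) For every open $U\subseteq M$, every section $\mathcal B$ of $\mathcal End\,\mathcal F$ over $U$ with $\mathcal A=\nabla_0\mathcal B$ on $U$ satisfies $\nabla_0\mathcal B\wedge\nabla_0\mathcal B=0$. Here $\nabla_0$ also denotes the connection induced on $\mathcal End\,\mathcal F$, and $\wedge$ combines the product of forms with the composition of endomorphisms. -/

import Mathlib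

open TopologicalSpace
open scoped TensorProduct ContDiff

universe t u v w

section

/-! ## Signs -/

/-- The sign `(-1) ^ i` of a parity `i ∈ ℤ/2`. -/
def superSign (i : ZMod 2) : ℤ := if i = 0 then 1 else -1

/-! ## Superspaces and their module sheaves -/

/-- A space `M` with a sheaf of supercommutative `k`-algebras.  The `ℤ/2`-grading is recorded by its
parity involution `σ : a ↦ (-1)^{|a|} a`: since `2` is invertible in `k`, a `ℤ/2`-grading is
the same as an involution, the elements of parity `i` being those with `σ a = (-1)^i a`. -/
structure SuperSpace (k : Type t) [Field k] (M : Type u) [TopologicalSpace M] where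
  /-- sections over an open set -/
  obj : Opens M → Type v
  [ring : ∀ U, Ring (obj U)]
  [algebra : ∀ U, Algebra k (obj U)]
  /-- restriction of sections -/
  res : ∀ {U V : Opens M}, V ≤ U → obj U →ₐ[k] obj V
  res_self : ∀ {U : Opens M} (a : obj U), res (le_refl U) a = a
  res_res : ∀ {U V W : Opens M} (hV : V ≤ U) (hW : W ≤ V) (a : obj U),
    res hW (res hV a) = res (hW.trans hV) a
  /-- the parity involution -/
  σ : ∀ {U : Opens M}, obj U →ₐ[k] obj U
  σ_σ : ∀ {U : Opens M} (a : obj U), σ (σ a) = a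
  res_σ : ∀ {U V : Opens M} (hV : V ≤ U) (a : obj U), res hV (σ a) = σ (res hV a)
  supercomm : ∀ {U : Opens M} (i j : ZMod 2) (a b : obj U),
    σ a = superSign i • a → σ b = superSign j • b → a * b = superSign (i * j) • (b * a)
  /-- the sheaf condition -/
  glue : ∀ {ι : Type u} (U : ι → Opens M) (s : ∀ i, obj (U i)),
    (∀ i j, res (inf_le_left : U i ⊓ U j ≤ U i) (s i) = res inf_le_right (s j)) →
    ∃! a : obj (⨆ i, U i), ∀ i, res (le_iSup U i) a = s i

attribute [instance] SuperSpace.ring SuperSpace.algebra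

variable {k : Type t} [Field k] {M : Type u} [TopologicalSpace M]

/-- The `i`-th power of the parity involution of the structure sheaf. -/
def SuperSpace.tw (X : SuperSpace.{t, u, v} k M) {U : Opens M} (i : ZMod 2) (a : X.obj U) :
    X.obj U :=
  if i = 0 then a else X.σ a

/-- A sheaf of (left) supermodules over the structure sheaf, the grading being again recorded
by the parity involution `σ : f ↦ (-1)^{|f|} f`. -/
structure SuperModule (X : SuperSpace.{t, u, v} k M) where
  /-- sections over an open set -/
  obj : Opens M → Type w
  [addCommGroup : ∀ U, AddCommGroup (obj U)]
  [moduleBase : ∀ U, Module k (obj U)]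
  [module : ∀ U, Module (X.obj U) (obj U)]
  [tower : ∀ U, IsScalarTower k (X.obj U) (obj U)]
  /-- restriction of sections -/
  res : ∀ {U V : Opens M}, V ≤ U → obj U →ₗ[k] obj V
  res_smul : ∀ {U V : Opens M} (hV : V ≤ U) (a : X.obj U) (f : obj U),
    res hV (a • f) = X.res hV a • res hV f
  res_self : ∀ {U : Opens M} (f : obj U), res (le_refl U) f = f
  res_res : ∀ {U V W : Opens M} (hV : V ≤ U) (hW : W ≤ V) (f : obj U),
    res hW (res hV f) = res (hW.trans hV) f
  /-- the parity involution -/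
  σ : ∀ {U : Opens M}, obj U →ₗ[k] obj U
  σ_σ : ∀ {U : Opens M} (f : obj U), σ (σ f) = f
  σ_smul : ∀ {U : Opens M} (a : X.obj U) (f : obj U), σ (a • f) = X.σ a • σ f
  res_σ : ∀ {U V : Opens M} (hV : V ≤ U) (f : obj U), res hV (σ f) = σ (res hV f)
  /-- the sheaf condition -/
  glue : ∀ {ι : Type u} (U : ι → Opens M) (s : ∀ i, obj (U i)),
    (∀ i j, res (inf_le_left : U i ⊓ U j ≤ U i) (s i) = res inf_le_right (s j)) →
    ∃! f : obj (⨆ i, U i), ∀ i, res (le_iSup U i) f = s i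

attribute [instance] SuperModule.addCommGroup SuperModule.moduleBase SuperModule.module
  SuperModule.tower

/-- The `i`-th power of the parity involution of a supermodule. -/
def SuperModule.tw {X : SuperSpace.{t, u, v} k M} (F : SuperModule.{t, u, v, w} X) {U : Opens M}
    (i : ZMod 2) (f : F.obj U) : F.obj U :=
  if i = 0 then f else F.σ f

/-- `F` is locally free of finite rank: every point has a neighbourhood `U` with homogeneous
sections `e₁, …, eₙ` of `F` over `U` whose restrictions to every open `V ⊆ U` form a basis of
`F(V)` over `O(V)`. -/
def SuperModule.IsLocallyFree {X : SuperSpace.{t, u, v} k M} (F : SuperModule.{t, u, v, w} X) :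
    Prop :=
  ∀ x : M, ∃ U : Opens M, x ∈ U ∧ ∃ (n : ℕ) (par : Fin n → ZMod 2) (e : Fin n → F.obj U),
    (∀ a, F.σ (e a) = superSign (par a) • e a) ∧
    ∀ (V : Opens M) (hV : V ≤ U),
      Function.Bijective fun c : Fin n → X.obj V => ∑ a, c a • F.res hV (e a)

/-! ## Supermanifolds -/

/-- The Grassmann algebra on `q` odd generators. -/
abbrev Grassmann (k : Type t) [Field k] (q : ℕ) : Type t := ExteriorAlgebra k (Fin q → k)

/-- The parity involution of the Grassmann algebra: `-1` on generators. -/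
noncomputable def Grassmann.σ (k : Type t) [Field k] (q : ℕ) : Grassmann k q →ₐ[k] Grassmann k q :=
  ExteriorAlgebra.map (-LinearMap.id)

/-- The functions on an open set `W` that are `C^∞` over `𝕜` in the coordinates `φ`.  For `𝕜 = ℝ`
these are the smooth functions, for `𝕜 = ℂ` the holomorphic ones. -/
def coordFunctions {𝕜 : Type t} [RCLike 𝕜] {p : ℕ} (φ : OpenPartialHomeomorph M (Fin p → 𝕜))
    (W : Opens M) : Subalgebra 𝕜 (W → 𝕜) where
  carrier := {g | ∃ G : (Fin p → 𝕜) → 𝕜, ContDiffOn 𝕜 ∞ G (φ '' W) ∧ ∀ x : W, g x = G (φ x)}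
  mul_mem' := by
    rintro a b ⟨G, hG, ha⟩ ⟨H, hH, hb⟩
    exact ⟨fun y => G y * H y, hG.mul hH, fun x => by simp [ha x, hb x]⟩
  add_mem' := by
    rintro a b ⟨G, hG, ha⟩ ⟨H, hH, hb⟩
    exact ⟨fun y => G y + H y, hG.add hH, fun x => by simp [ha x, hb x]⟩
  algebraMap_mem' c := ⟨fun _ => c, contDiffOn_const, fun _ => rfl⟩

/-- Restriction of coordinate functions to a smaller open set. -/
def coordFunctionsRes {𝕜 : Type t} [RCLike 𝕜] {p : ℕ}
    (φ : OpenPartialHomeomorph M (Fin p → 𝕜)) {W W' : Opens M} (h : W' ≤ W) :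
    coordFunctions φ W →ₐ[𝕜] coordFunctions φ W' where
  toFun g := ⟨fun x => g.1 ⟨x.1, h x.2⟩, by
    obtain ⟨G, hG, hg⟩ := g.2
    exact ⟨G, hG.mono (Set.image_mono h), fun x => hg ⟨x.1, h x.2⟩⟩⟩
  map_one' := rfl
  map_mul' _ _ := rfl
  map_zero' := rfl
  map_add' _ _ := rfl
  commutes' _ := rfl

/-- A chart of dimension `p | q` on an open set `U`: an isomorphism of `(U, O|_U)` with an open
part of `𝕜^p` carrying the sheaf of functions with values in the Grassmann algebra on
`q` odd coordinates. -/
structure SuperChart {𝕜 : Type t} [RCLike 𝕜] (X : SuperSpace.{t, u, v} 𝕜 M) (U : Opens M)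
    (p q : ℕ) where
  /-- the even coordinates of the underlying space -/
  coord : OpenPartialHomeomorph M (Fin p → 𝕜)
  source_eq : coord.source = U
  /-- the isomorphism of sheaves of algebras -/
  iso : ∀ W : Opens M, W ≤ U → X.obj W ≃ₐ[𝕜] coordFunctions coord W ⊗[𝕜] Grassmann 𝕜 q
  iso_res : ∀ (W W' : Opens M) (hW : W ≤ U) (hW' : W' ≤ W) (a : X.obj W),
    iso W' (hW'.trans hW) (X.res hW' a) =
      Algebra.TensorProduct.map (coordFunctionsRes coord hW') (AlgHom.id 𝕜 _) (iso W hW a)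
  iso_σ : ∀ (W : Opens M) (hW : W ≤ U) (a : X.obj W),
    iso W hW (X.σ a) =
      Algebra.TensorProduct.map (AlgHom.id 𝕜 _) (Grassmann.σ 𝕜 q) (iso W hW a)

/-- Supermanifolds over `ℝ` or `ℂ`: smooth supermanifolds for `𝕜 = ℝ`, complex analytic
supermanifolds for `𝕜 = ℂ`.  Ordinary manifolds are the case without odd coordinates. -/
def SuperSpace.IsSupermanifold {𝕜 : Type t} [RCLike 𝕜] (X : SuperSpace.{t, u, v} 𝕜 M) : Prop :=
  ∀ x : M, ∃ U : Opens M, x ∈ U ∧ ∃ p q : ℕ, Nonempty (SuperChart X U p q)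

/-- Formal supermanifolds over `k`: each point is open and the superalgebra of functions on it is
isomorphic to `k[[x₁, …, x_p]] ⊗ Λ(ξ₁, …, ξ_q)` (the formal completion of a vector superspace
of dimension `p | q` at the origin). -/
def SuperSpace.IsFormalSupermanifold (X : SuperSpace.{t, u, v} k M) : Prop :=
  ∀ x : M, ∃ U : Opens M, (U : Set M) = {x} ∧ ∃ (p q : ℕ)
    (e : X.obj U ≃ₐ[k] MvPowerSeries (Fin p) k ⊗[k] Grassmann k q),
    ∀ a, e (X.σ a) = Algebra.TensorProduct.map (AlgHom.id k _) (Grassmann.σ k q) (e a)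

/-! ## Vector fields -/

theorem parity_cases (i : ZMod 2) : i = 0 ∨ i = 1 := by
  revert i; decide

theorem superSign_zero : superSign 0 = 1 := rfl

theorem superSign_one : superSign 1 = -1 := rfl

theorem parity_one_add_one : (1 : ZMod 2) + 1 = 0 := rfl

variable [CharZero k]

/-- Supercommutativity with one argument not necessarily homogeneous. -/
theorem SuperSpace.mul_eq_tw_mul (X : SuperSpace.{t, u, v} k M) {U : Opens M} (l : ZMod 2)
    (a b : X.obj U) (ha : X.σ a = superSign l • a) : a * b = X.tw l b * a := by
  have h0 := X.supercomm l 0 a (b + X.σ b) ha (by simp [superSign, X.σ_σ, add_comm])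
  have h1 := X.supercomm l 1 a (b - X.σ b) ha (by simp [superSign, X.σ_σ])
  have h2 : (2 : k) • (a * b) = (2 : k) • (X.tw l b * a) := by
    have := congrArg₂ (· + ·) h0 h1
    rw [two_smul, two_smul]
    obtain rfl | rfl := parity_cases l <;>
      simp only [superSign, SuperSpace.tw, mul_add, add_mul, mul_sub, sub_mul, mul_zero, mul_one,
        if_true, one_smul, one_ne_zero, if_false, neg_smul] at this ⊢ <;>
      linear_combination (norm := noncomm_ring) this
  have h3 := congrArg ((2 : k)⁻¹ • ·) h2
  simpa [smul_smul] using h3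

/-- A vector field of parity `i` on `U`: a superderivation of parity `i` of the sheaf `O|_U`,
`D(ab) = D(a) b + (-1)^{i|a|} a D(b)`. -/
@[ext]
structure SuperVectorField (X : SuperSpace.{t, u, v} k M) (U : Opens M) (i : ZMod 2) where
  /-- the action on functions -/
  toFun : ∀ V : Opens M, V ≤ U → X.obj V →ₗ[k] X.obj V
  res : ∀ (V W : Opens M) (hV : V ≤ U) (hW : W ≤ V) (a : X.obj V),
    X.res hW (toFun V hV a) = toFun W (hW.trans hV) (X.res hW a)
  σ : ∀ (V : Opens M) (hV : V ≤ U) (a : X.obj V),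
    X.σ (toFun V hV a) = superSign i • toFun V hV (X.σ a)
  leibniz : ∀ (V : Opens M) (hV : V ≤ U) (a b : X.obj V),
    toFun V hV (a * b) = toFun V hV a * b + X.tw i a * toFun V hV b

namespace SuperVectorField

variable {X : SuperSpace.{t, u, v} k M} {U : Opens M} {i j : ZMod 2}

/-- Restriction of a vector field. -/
def restrict (D : SuperVectorField X U i) {V : Opens M} (hV : V ≤ U) : SuperVectorField X V i where
  toFun W hW := D.toFun W (hW.trans hV)
  res W W' hW hW' a := D.res W W' (hW.trans hV) hW' a
  σ W hW a := D.σ W (hW.trans hV) a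
  leibniz W hW a b := D.leibniz W (hW.trans hV) a b

/-- The sum of two vector fields of the same parity. -/
def add (D E : SuperVectorField X U i) : SuperVectorField X U i where
  toFun V hV := D.toFun V hV + E.toFun V hV
  res V W hV hW a := by simp [D.res V W hV hW, E.res V W hV hW]
  σ V hV a := by simp [D.σ, E.σ, smul_add]
  leibniz V hV a b := by
    simp only [LinearMap.add_apply, D.leibniz, E.leibniz]
    noncomm_ring

/-- The product `a D` of a function of parity `l` and a vector field of parity `i`. -/
def smul (l : ZMod 2) (a : X.obj U) (ha : X.σ a = superSign l • a) (D : SuperVectorField X U i) :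
    SuperVectorField X U (l + i) where
  toFun V hV := LinearMap.mulLeft k (X.res hV a) ∘ₗ D.toFun V hV
  res V W hV hW b := by simp [X.res_res, D.res V W hV hW]
  σ V hV b := by
    have h : X.σ (X.res hV a) = superSign l • X.res hV a := by rw [← X.res_σ, ha, map_zsmul]
    simp only [LinearMap.comp_apply, LinearMap.mulLeft_apply, map_mul, h, D.σ]
    obtain rfl | rfl := parity_cases l <;> obtain rfl | rfl := parity_cases i <;>
      simp [superSign, parity_one_add_one]
  leibniz V hV b c := by
    have h : X.σ (X.res hV a) = superSign l • X.res hV a := by rw [← X.res_σ, ha, map_zsmul]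
    simp only [LinearMap.comp_apply, LinearMap.mulLeft_apply, D.leibniz, mul_add, ← mul_assoc]
    rw [X.mul_eq_tw_mul l _ (X.tw i b) h]
    obtain rfl | rfl := parity_cases l <;> obtain rfl | rfl := parity_cases i <;>
      simp [SuperSpace.tw, parity_one_add_one, X.σ_σ]

/-- The superbracket `[D, E] = D E - (-1)^{ij} E D`. -/
def bracket (D : SuperVectorField X U i) (E : SuperVectorField X U j) :
    SuperVectorField X U (i + j) where
  toFun V hV := D.toFun V hV ∘ₗ E.toFun V hV - superSign (i * j) • (E.toFun V hV ∘ₗ D.toFun V hV)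
  res V W hV hW b := by simp [D.res V W hV hW, E.res V W hV hW]
  σ V hV b := by
    obtain rfl | rfl := parity_cases i <;> obtain rfl | rfl := parity_cases j <;>
      simp [D.σ, E.σ, superSign, parity_one_add_one] <;> abel
  leibniz V hV b c := by
    obtain rfl | rfl := parity_cases i <;> obtain rfl | rfl := parity_cases j <;>
      simp [D.leibniz, E.leibniz, D.σ, E.σ, X.σ_σ, superSign, SuperSpace.tw, parity_one_add_one] <;>
      noncomm_ring

end SuperVectorField

/-! ## Differential forms with values in a supermodule

The sheaf `Ω¹ ⊗ F` is realized as the sheaf of `O`-linear maps from vector fields to `F`, a form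
`α` being identified with `X ↦ α(X) = ι_X α`.  The differential is odd, so `ι_X` has parity
`|X| + 1`, and the signs below are those of `ι_{aX} = a ι_X`, `ι_X (df) = X f` and
`ι_X (a α) = (-1)^{|a| (|X| + 1)} a ι_X α`. -/

section Forms

variable {X : SuperSpace.{t, u, v} k M} (F : SuperModule.{t, u, v, w} X)

/-- Sections over `U` of `Ω¹ ⊗ F`: compatible families of left `O`-linear maps from the vector
fields on the open subsets `V` of `U` to `F(V)`. -/
@[ext]
structure SuperForm1 (U : Opens M) where
  /-- the value on a homogeneous vector field -/
  toFun : ∀ (V : Opens M), V ≤ U → ∀ i : ZMod 2, SuperVectorField X V i → F.obj V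
  map_add : ∀ (V : Opens M) (hV : V ≤ U) (i : ZMod 2) (D E : SuperVectorField X V i),
    toFun V hV i (D.add E) = toFun V hV i D + toFun V hV i E
  map_smul : ∀ (V : Opens M) (hV : V ≤ U) (l i : ZMod 2) (a : X.obj V)
    (ha : X.σ a = superSign l • a) (D : SuperVectorField X V i),
    toFun V hV (l + i) (D.smul l a ha) = a • toFun V hV i D
  map_res : ∀ (V W : Opens M) (hV : V ≤ U) (hW : W ≤ V) (i : ZMod 2) (D : SuperVectorField X V i),
    F.res hW (toFun V hV i D) = toFun W (hW.trans hV) i (D.restrict hW)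

/-- Sections over `U` of `Ω² ⊗ F`: compatible families of super-antisymmetric maps on pairs of
vector fields, linear over `O` in the first argument.  The value `α(X, Y)` stands for
`(-1)^{|X| (|Y| + 1)} ι_Y ι_X α`. -/
@[ext]
structure SuperForm2 (U : Opens M) where
  /-- the value on two homogeneous vector fields -/
  toFun : ∀ (V : Opens M), V ≤ U → ∀ i j : ZMod 2,
    SuperVectorField X V i → SuperVectorField X V j → F.obj V
  antisymm : ∀ (V : Opens M) (hV : V ≤ U) (i j : ZMod 2) (D : SuperVectorField X V i)
    (E : SuperVectorField X V j),
    toFun V hV i j D E = -(superSign (i * j) • toFun V hV j i E D)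
  map_add : ∀ (V : Opens M) (hV : V ≤ U) (i j : ZMod 2) (D D' : SuperVectorField X V i)
    (E : SuperVectorField X V j),
    toFun V hV i j (D.add D') E = toFun V hV i j D E + toFun V hV i j D' E
  map_smul : ∀ (V : Opens M) (hV : V ≤ U) (l i j : ZMod 2) (a : X.obj V)
    (ha : X.σ a = superSign l • a) (D : SuperVectorField X V i) (E : SuperVectorField X V j),
    toFun V hV (l + i) j (D.smul l a ha) E = a • toFun V hV i j D E
  map_res : ∀ (V W : Opens M) (hV : V ≤ U) (hW : W ≤ V) (i j : ZMod 2)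
    (D : SuperVectorField X V i) (E : SuperVectorField X V j),
    F.res hW (toFun V hV i j D E) = toFun W (hW.trans hV) i j (D.restrict hW) (E.restrict hW)

variable {F} {U : Opens M}

/-- The value of a form does not depend on how the parity of the vector field is written. -/
theorem SuperForm1.congr (α : SuperForm1 F U) {V : Opens M} (hV : V ≤ U) {i j : ZMod 2}
    (h : i = j) (D : SuperVectorField X V i) (E : SuperVectorField X V j)
    (hDE : D.toFun = E.toFun) : α.toFun V hV i D = α.toFun V hV j E := by
  subst h
  rw [SuperVectorField.ext hDE]

/-- Restriction of a form. -/
def SuperForm1.restrict (α : SuperForm1 F U) {V : Opens M} (hV : V ≤ U) : SuperForm1 F V where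
  toFun W hW := α.toFun W (hW.trans hV)
  map_add W hW := α.map_add W (hW.trans hV)
  map_smul W hW := α.map_smul W (hW.trans hV)
  map_res W W' hW hW' := α.map_res W W' (hW.trans hV) hW'

instance : Zero (SuperForm1 F U) where
  zero :=
    { toFun := fun _ _ _ _ => 0
      map_add := by simp
      map_smul := by simp
      map_res := by simp }

instance : Zero (SuperForm2 F U) where
  zero :=
    { toFun := fun _ _ _ _ _ _ => 0
      antisymm := by simp
      map_add := by simp
      map_smul := by simp
      map_res := by simp }

instance : Add (SuperForm1 F U) where
  add α β :=
    { toFun := fun V hV i D => α.toFun V hV i D + β.toFun V hV i D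
      map_add := fun V hV i D E => by rw [α.map_add, β.map_add]; abel
      map_smul := fun V hV l i a ha D => by rw [α.map_smul, β.map_smul, smul_add]
      map_res := fun V W hV hW i D => by rw [_root_.map_add, α.map_res, β.map_res] }

/-- The `O(U)`-module structure, `(a α)(X) = (-1)^{|a| (|X| + 1)} a α(X)`. -/
instance : SMul (X.obj U) (SuperForm1 F U) where
  smul b α :=
    { toFun := fun V hV i D => X.tw (i + 1) (X.res hV b) • α.toFun V hV i D
      map_add := fun V hV i D E => by rw [α.map_add, smul_add]
      map_smul := fun V hV l i a ha D => by
        rw [α.map_smul, smul_smul, smul_smul, X.mul_eq_tw_mul l a _ ha]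
        obtain rfl | rfl := parity_cases l <;> obtain rfl | rfl := parity_cases i <;>
          simp [SuperSpace.tw, parity_one_add_one, X.σ_σ]
      map_res := fun V W hV hW i D => by
        rw [F.res_smul, α.map_res]
        obtain rfl | rfl := parity_cases i <;>
          simp [SuperSpace.tw, parity_one_add_one, X.res_σ, X.res_res] }

instance : SMul k (SuperForm1 F U) where
  smul c α :=
    { toFun := fun V hV i D => c • α.toFun V hV i D
      map_add := fun V hV i D E => by rw [α.map_add, smul_add]
      map_smul := fun V hV l i a ha D => by rw [α.map_smul, smul_comm]
      map_res := fun V W hV hW i D => by rw [_root_.map_smul, α.map_res] }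

/-- The parity involution of `Ω¹ ⊗ F` for the total parity: `α` has parity `n` if and only if
`α(X)` has parity `n + |X| + 1` for all homogeneous `X`. -/
def SuperForm1.σ (α : SuperForm1 F U) : SuperForm1 F U where
  toFun V hV i D := superSign (i + 1) • F.σ (α.toFun V hV i D)
  map_add V hV i D E := by rw [α.map_add, _root_.map_add, smul_add]
  map_smul V hV l i a ha D := by
    rw [α.map_smul, F.σ_smul, ha]
    obtain rfl | rfl := parity_cases l <;> obtain rfl | rfl := parity_cases i <;>
      simp [superSign, parity_one_add_one]
  map_res V W hV hW i D := by rw [map_zsmul, F.res_σ, α.map_res]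

/-- The form `da ⊗ f`, with `ι_X (da ⊗ f) = X(a) f`. -/
def dTensor (a : X.obj U) (f : F.obj U) : SuperForm1 F U where
  toFun V hV _ D := D.toFun V le_rfl (X.res hV a) • F.res hV f
  map_add V hV i D E := by simp [SuperVectorField.add, add_smul]
  map_smul V hV l i b hb D := by
    simp [SuperVectorField.smul, mul_smul, X.res_self]
  map_res V W hV hW i D := by
    simp [SuperVectorField.restrict, F.res_smul, F.res_res, X.res_res, D.res V W le_rfl hW]

/-! ## Connections -/

variable (F) in
/-- A connection on `F`: an odd `k`-linear morphism of sheaves `∇ : F → Ω¹ ⊗ F` with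
`∇(a f) = da ⊗ f + (-1)^{|a|} a ∇f`. -/
structure SuperConnection where
  /-- the operator on sections -/
  toFun : ∀ {U : Opens M}, F.obj U → SuperForm1 F U
  map_add : ∀ {U : Opens M} (f g : F.obj U), toFun (f + g) = toFun f + toFun g
  map_smul : ∀ {U : Opens M} (c : k) (f : F.obj U), toFun (c • f) = c • toFun f
  map_res : ∀ {U V : Opens M} (hV : V ≤ U) (f : F.obj U),
    (toFun f).restrict hV = toFun (F.res hV f)
  odd : ∀ {U : Opens M} (f : F.obj U), toFun (F.σ f) = (-1 : k) • (toFun f).σ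
  leibniz : ∀ {U : Opens M} (a : X.obj U) (f : F.obj U),
    toFun (a • f) = dTensor a f + X.σ a • toFun f

variable (F) in
/-- An odd `O`-linear operator `A : F → Ω¹ ⊗ F`, so that `A(a f) = (-1)^{|a|} a A(f)`. -/
structure SuperOneFormOperator where
  /-- the operator on sections -/
  toFun : ∀ {U : Opens M}, F.obj U → SuperForm1 F U
  map_add : ∀ {U : Opens M} (f g : F.obj U), toFun (f + g) = toFun f + toFun g
  map_res : ∀ {U V : Opens M} (hV : V ≤ U) (f : F.obj U),
    (toFun f).restrict hV = toFun (F.res hV f)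
  odd : ∀ {U : Opens M} (f : F.obj U), toFun (F.σ f) = (-1 : k) • (toFun f).σ
  map_smul : ∀ {U : Opens M} (a : X.obj U) (f : F.obj U), toFun (a • f) = X.σ a • toFun f

theorem SuperForm1.add_toFun (α β : SuperForm1 F U) {V : Opens M} (hV : V ≤ U) {i : ZMod 2}
    (D : SuperVectorField X V i) :
    (α + β).toFun V hV i D = α.toFun V hV i D + β.toFun V hV i D := rfl

theorem SuperForm1.smul_toFun (a : X.obj U) (α : SuperForm1 F U) {V : Opens M} (hV : V ≤ U)
    {i : ZMod 2} (D : SuperVectorField X V i) :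
    (a • α).toFun V hV i D = X.tw (i + 1) (X.res hV a) • α.toFun V hV i D := rfl

theorem SuperForm1.base_smul_toFun (c : k) (α : SuperForm1 F U) {V : Opens M} (hV : V ≤ U)
    {i : ZMod 2} (D : SuperVectorField X V i) :
    (c • α).toFun V hV i D = c • α.toFun V hV i D := rfl

theorem SuperForm1.σ_toFun (α : SuperForm1 F U) {V : Opens M} (hV : V ≤ U) {i : ZMod 2}
    (D : SuperVectorField X V i) :
    α.σ.toFun V hV i D = superSign (i + 1) • F.σ (α.toFun V hV i D) := rfl

/-- A form is additive on sums of vector fields, however their parities are written. -/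
theorem SuperForm1.congr_add (α : SuperForm1 F U) {V : Opens M} (hV : V ≤ U) {i j l : ZMod 2}
    (hj : i = j) (hl : i = l) (D : SuperVectorField X V i) (E : SuperVectorField X V j)
    (E' : SuperVectorField X V l) (h : D.toFun = fun W hW => E.toFun W hW + E'.toFun W hW) :
    α.toFun V hV i D = α.toFun V hV j E + α.toFun V hV l E' := by
  subst hj hl
  rw [← α.map_add]
  exact α.congr hV rfl _ _ h

/-- A form is compatible with integer multiples of vector fields. -/
theorem SuperForm1.congr_zsmul (α : SuperForm1 F U) {V : Opens M} (hV : V ≤ U) {i j : ZMod 2}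
    (hj : i = j) (c : ℤ) (D : SuperVectorField X V i) (E : SuperVectorField X V j)
    (h : D.toFun = fun W hW => c • E.toFun W hW) :
    α.toFun V hV i D = c • α.toFun V hV j E := by
  have hc : X.σ (c : X.obj V) = superSign 0 • (c : X.obj V) := by simp [superSign]
  have := α.map_smul V hV 0 j (c : X.obj V) hc E
  rw [Int.cast_smul_eq_zsmul] at this
  rw [← this]
  refine α.congr hV (by rw [hj, zero_add]) _ _ ?_
  rw [h]
  funext W hW
  ext b
  simp [SuperVectorField.smul]

namespace SuperConnection

variable (nabla : SuperConnection F)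

/-- The covariant derivative `∇_X f = ι_X ∇f`. -/
def cov {V : Opens M} {i : ZMod 2} (D : SuperVectorField X V i) (f : F.obj V) : F.obj V :=
  (nabla.toFun f).toFun V le_rfl i D

theorem cov_add {V : Opens M} {i : ZMod 2} (D : SuperVectorField X V i) (f g : F.obj V) :
    nabla.cov D (f + g) = nabla.cov D f + nabla.cov D g := by
  simp only [cov, nabla.map_add, SuperForm1.add_toFun]

theorem cov_smul {V : Opens M} {i : ZMod 2} (D : SuperVectorField X V i) (a : X.obj V)
    (f : F.obj V) :
    nabla.cov D (a • f) = D.toFun V le_rfl a • f + X.tw i a • nabla.cov D f := by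
  simp only [cov, nabla.leibniz, SuperForm1.add_toFun, SuperForm1.smul_toFun, dTensor, X.res_self,
    F.res_self]
  obtain rfl | rfl := parity_cases i <;>
    simp [SuperSpace.tw, parity_one_add_one, X.σ_σ]

theorem cov_res {V W : Opens M} (hW : W ≤ V) {i : ZMod 2} (D : SuperVectorField X V i)
    (f : F.obj V) :
    F.res hW (nabla.cov D f) = nabla.cov (D.restrict hW) (F.res hW f) := by
  simp only [cov, ← nabla.map_res, SuperForm1.map_res]
  rfl

/-- The extension of the connection to `Ω¹ ⊗ F → Ω² ⊗ F`,
`(∇α)(X, Y) = ∇_X (α(Y)) - (-1)^{|X| |Y|} ∇_Y (α(X)) - α([X, Y])`. -/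
def ext (α : SuperForm1 F U) : SuperForm2 F U where
  toFun V hV i j D E :=
    nabla.cov D (α.toFun V hV j E) - superSign (i * j) • nabla.cov E (α.toFun V hV i D) -
      α.toFun V hV (i + j) (D.bracket E)
  antisymm V hV i j D E := by
    rw [α.congr_zsmul hV (add_comm i j) (-superSign (i * j)) (D.bracket E) (E.bracket D) (by
      funext W hW
      obtain rfl | rfl := parity_cases i <;> obtain rfl | rfl := parity_cases j <;>
        simp [SuperVectorField.bracket, superSign, add_comm])]
    obtain rfl | rfl := parity_cases i <;> obtain rfl | rfl := parity_cases j <;>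
      simp [superSign] <;> abel
  map_add V hV i j D D' E := by
    rw [α.congr_add hV rfl rfl ((D.add D').bracket E) (D.bracket E) (D'.bracket E) (by
      funext W hW
      simp only [SuperVectorField.bracket, SuperVectorField.add, LinearMap.add_comp,
        LinearMap.comp_add, smul_add]
      abel)]
    rw [α.map_add, nabla.cov_add, smul_add]
    have : nabla.cov (D.add D') (α.toFun V hV j E) =
        nabla.cov D (α.toFun V hV j E) + nabla.cov D' (α.toFun V hV j E) :=
      (nabla.toFun _).map_add _ _ _ _ _
    rw [this]
    abel
  map_smul V hV l i j a ha D E := by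
    have hE : X.σ (E.toFun V le_rfl a) = superSign (j + l) • E.toFun V le_rfl a := by
      rw [E.σ, ha, map_zsmul, smul_smul]
      obtain rfl | rfl := parity_cases l <;> obtain rfl | rfl := parity_cases j <;>
        simp [superSign, parity_one_add_one]
    have hE' : X.σ (-(superSign ((l + i) * j) • E.toFun V le_rfl a)) =
        superSign (j + l) • -(superSign ((l + i) * j) • E.toFun V le_rfl a) := by
      rw [map_neg, map_zsmul, hE, smul_neg, smul_comm]
    rw [α.congr_add hV (add_assoc l i j)
      (by rw [add_comm, add_assoc]) ((D.smul l a ha).bracket E)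
      ((D.bracket E).smul l a ha) (D.smul (j + l) _ hE') (by
        funext W hW
        ext b
        simp only [SuperVectorField.bracket, SuperVectorField.smul, LinearMap.sub_apply,
          LinearMap.comp_apply, LinearMap.mulLeft_apply, LinearMap.smul_apply, LinearMap.add_apply,
          E.leibniz, map_neg, map_zsmul, E.res V W le_rfl hW]
        have h : X.σ (X.res hW a) = superSign l • X.res hW a := by rw [← X.res_σ, ha, map_zsmul]
        obtain rfl | rfl := parity_cases l <;> obtain rfl | rfl := parity_cases i <;>
          obtain rfl | rfl := parity_cases j <;>
          simp [superSign, SuperSpace.tw, parity_one_add_one] at h ⊢ <;>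
            (try simp only [h]) <;> noncomm_ring)]
    rw [α.map_smul, α.map_smul, α.map_smul, nabla.cov_smul]
    have : nabla.cov (D.smul l a ha) (α.toFun V hV j E) = a • nabla.cov D (α.toFun V hV j E) :=
      (nabla.toFun _).map_smul _ _ _ _ _ _ _
    rw [this]
    obtain rfl | rfl := parity_cases l <;> obtain rfl | rfl := parity_cases i <;>
      obtain rfl | rfl := parity_cases j <;>
      simp [superSign, SuperSpace.tw, parity_one_add_one] at ha ⊢ <;>
      simp [ha, smul_sub, smul_add] <;> abel
  map_res V W hV hW i j D E := by
    simp only [map_sub, map_zsmul, nabla.cov_res, α.map_res]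
    rfl

/-- The connection is flat: `∇² = 0`. -/
def IsFlat : Prop :=
  ∀ (U : Opens M) (f : F.obj U), nabla.ext (nabla.toFun f) = 0

/-- The connection `∇ + c A`. -/
def line (A : SuperOneFormOperator F) (c : k) : SuperConnection F where
  toFun f := nabla.toFun f + c • A.toFun f
  map_add f g := by
    rw [nabla.map_add, A.map_add]
    ext V hV i D
    simp only [SuperForm1.add_toFun, SuperForm1.base_smul_toFun, smul_add]
    abel
  map_smul {U} b f := by
    have hA : A.toFun (b • f) = b • A.toFun f := by
      rw [← algebraMap_smul (X.obj U) b f, A.map_smul]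
      ext V hV i D
      obtain rfl | rfl := parity_cases i <;>
        simp [SuperForm1.base_smul_toFun, SuperForm1.smul_toFun, SuperSpace.tw,
          parity_one_add_one]
    rw [nabla.map_smul, hA]
    ext V hV i D
    simp only [SuperForm1.add_toFun, SuperForm1.base_smul_toFun, smul_add, smul_comm b c]
  map_res hV f := by
    rw [← nabla.map_res, ← A.map_res]
    rfl
  odd f := by
    rw [nabla.odd, A.odd]
    ext V hV i D
    simp only [SuperForm1.add_toFun, SuperForm1.base_smul_toFun, SuperForm1.σ_toFun, _root_.map_add,
      _root_.map_smul, smul_add, smul_comm c (-1 : k), smul_comm c (superSign _)]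
  leibniz a f := by
    rw [nabla.leibniz, A.map_smul]
    ext V hV i D
    simp only [SuperForm1.add_toFun, SuperForm1.base_smul_toFun, SuperForm1.smul_toFun, smul_add,
      smul_comm c, add_assoc]

/-- `∇ + λ A` is a pencil of flat connections: `(∇ + λ A)² = 0` for all values of the parameter. -/
def IsFlatPencil (A : SuperOneFormOperator F) : Prop :=
  ∀ c : k, (nabla.line A c).IsFlat

end SuperConnection

/-! ## Endomorphisms -/

variable (F) in
/-- Sections over `U` of `End F`: `O`-linear endomorphisms `B` of the sheaf `F|_U` of arbitrary
parity, `B(a f) = (-1)^{|a| |B|} a B(f)`.  For `B = B₀ + B₁` not homogeneous the sign is expressed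
through `σ B σ = B₀ - B₁`. -/
structure SuperEnd (U : Opens M) where
  /-- the action on sections -/
  toFun : ∀ V : Opens M, V ≤ U → F.obj V →ₗ[k] F.obj V
  map_res : ∀ (V W : Opens M) (hV : V ≤ U) (hW : W ≤ V) (f : F.obj V),
    F.res hW (toFun V hV f) = toFun W (hW.trans hV) (F.res hW f)
  map_smul : ∀ (V : Opens M) (hV : V ≤ U) (l : ZMod 2) (a : X.obj V),
    X.σ a = superSign l • a → ∀ f : F.obj V,
      toFun V hV (a • f) = a • F.tw l (toFun V hV (F.tw l f))

/-- The operator `∇B : F|_U → Ω¹ ⊗ F|_U` obtained by extending the connection to `End F`: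
`(∇B)_X = ∇_X B - (-1)^{|X| |B|} B ∇_X`. -/
def SuperConnection.derivEnd (nabla : SuperConnection F) (B : SuperEnd F U) (V : Opens M)
    (hV : V ≤ U) (f : F.obj V) : SuperForm1 F V where
  toFun W hW i D :=
    (nabla.toFun (B.toFun V hV f)).toFun W hW i D -
      F.tw i (B.toFun W (hW.trans hV) (F.tw i ((nabla.toFun f).toFun W hW i D)))
  map_add W hW i D E := by
    rw [SuperForm1.map_add, SuperForm1.map_add]
    obtain rfl | rfl := parity_cases i <;> simp [SuperModule.tw] <;> abel
  map_smul W hW l i a ha D := by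
    rw [SuperForm1.map_smul, SuperForm1.map_smul, smul_sub]
    have h := B.map_smul W (hW.trans hV) l a ha
    obtain rfl | rfl := parity_cases l <;> obtain rfl | rfl := parity_cases i <;>
      simp [SuperModule.tw, superSign, parity_one_add_one, F.σ_smul] at h ha ⊢ <;>
      simp [h, ha, F.σ_smul, F.σ_σ]
  map_res W W' hW hW' i D := by
    rw [map_sub, SuperForm1.map_res, ← SuperForm1.map_res _ W W' hW hW']
    obtain rfl | rfl := parity_cases i <;> simp [SuperModule.tw, F.res_σ, B.map_res,
      (nabla.toFun f).map_res W W' hW hW']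

/-- The value on `(X, Y)` of `(P ∧ Q)(f)`, for odd operators `P`, `Q : F|_U → Ω¹ ⊗ F|_U` whose
product is the wedge product of forms and the composition of endomorphisms:
`(P ∧ Q)(X, Y) = P_X Q_Y - (-1)^{|X| |Y|} P_Y Q_X`. -/
def operatorWedge (P Q : ∀ V : Opens M, V ≤ U → F.obj V → SuperForm1 F V) (V : Opens M)
    (hV : V ≤ U) (f : F.obj V) (i j : ZMod 2) (D : SuperVectorField X V i)
    (E : SuperVectorField X V j) : F.obj V :=
  (P V hV ((Q V hV f).toFun V le_rfl j E)).toFun V le_rfl i D -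
    superSign (i * j) • (P V hV ((Q V hV f).toFun V le_rfl i D)).toFun V le_rfl j E

/-- The operators `A` and `∇B` agree over `U`. -/
def SuperConnection.IsPotential (nabla : SuperConnection F) (A : SuperOneFormOperator F)
    (B : SuperEnd F U) : Prop :=
  ∀ (V : Opens M) (hV : V ≤ U) (f : F.obj V), A.toFun f = nabla.derivEnd B V hV f

/-- The equation `∇B ∧ ∇B = 0` over `U` (used when `∇B` is odd). -/
def SuperConnection.IsWedgeSquareZero (nabla : SuperConnection F) (B : SuperEnd F U) : Prop :=
  ∀ (V : Opens M) (hV : V ≤ U) (f : F.obj V) (i j : ZMod 2) (D : SuperVectorField X V i)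
    (E : SuperVectorField X V j),
    operatorWedge (nabla.derivEnd B) (nabla.derivEnd B) V hV f i j D E = 0

end Forms

end

/-! Expand `(∇ + λA)² = ∇² + λ(∇A + A∇) + λ² A ∧ A`. Since `∇² = 0` and 2 is invertible, the values
`λ = 1` and `λ = -1` show that the pencil is flat exactly when `∇A + A∇ = 0` and `A ∧ A = 0`
(`SuperConnection.isFlatPencil_iff`). If `A = ∇B` locally, the first equation follows from `∇² = 0`,
because `∇A + A∇` is then a commutator of the curvature with the even part of `B`; and `A ∧ A` is
`∇B ∧ ∇B`. Both equations may be checked locally, so everything reduces to a Poincaré lemma: an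
operator `A` with `∇A + A∇ = 0` has local potentials (`SuperCoordinates.exists_isPotential`).

The potential is found in two stages, without choosing a horizontal frame. In a frame and in the
even coordinate directions the equation is `∂ᵢb + bΓᵢ - Γᵢb = Cᵢ` for a matrix `b` over `R ⊗ Λ`.
Such matrices form a free module of finite rank over the commutative ring `R` of even functions, and
the left hand sides are commuting connections on it, so this is an ordinary flat linear system over
`R` (`SuperTensor.exists_matrix_primitive`). The odd directions are then treated one at a time: if
`R_j` is the error `A_j - [∇_j, B]` in the direction of the odd coordinate `ξ_j`, the replacement of
`B` by `B + ξ_j R_j` removes it and keeps the directions already settled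
(`SuperCoordinates.exists_potential_coord`). Coordinate vector fields suffice because every vector
field is determined by its values on the coordinates.

The ordinary system `∇b = c` is solved radially. Over `ℝ` and `ℂ` alike, its restriction to the ray
through `x` is a linear integral equation in the Banach space of paths on `[0, 1]`. It depends
smoothly on `x` and is the identity at `x = 0`, so it is uniquely solvable for small `x`; the value
at `t = 1` is `b(x)`. Flatness and closedness imply that the error in any other direction solves the
homogeneous equation, hence vanishes (`exists_primitive_of_flat`). For formal power series the Euler
operator `∑ Xᵢ∂ᵢ`, which is invertible on series without constant term, plays the part of radial
integration (`MvPowerSeries.exists_primitive`). -/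

section Analysis

open scoped Topology
open Metric BoundedContinuousFunction

/-! ### Functions on a ball pulled back to rays, as maps into a Banach space of paths -/

section RadialPullback

variable (𝕜 : Type t) [RCLike 𝕜]
  {E : Type*} [NormedAddCommGroup E] [NormedSpace 𝕜 E]
  {F : Type*} [NormedAddCommGroup F] [NormedSpace 𝕜 F]
  {G : Type*} [NormedAddCommGroup G] [NormedSpace 𝕜 G]

open Classical in
/-- The function `t ↦ g (t x)` on the unit interval, if it is continuous. -/
noncomputable def radialPullback {F : Type*} [NormedAddCommGroup F] (g : E → F)
    (x : E) : unitInterval →ᵇ F :=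
  -- The value 0 is a default. It plays no role for `x` in a ball around 0 on which `g` is
  -- continuous, and the lemmas below concern such `x`.
  if h : Continuous fun t : unitInterval => g (((t : ℝ) : 𝕜) • x) then mkOfCompact ⟨_, h⟩ else 0

/-- Pointwise application, on continuous paths. -/
noncomputable def pathApply :
    (unitInterval →ᵇ F →L[𝕜] G) →L[𝕜] (unitInterval →ᵇ F) →L[𝕜] (unitInterval →ᵇ G) :=
  LinearMap.mkContinuous₂
    (LinearMap.mk₂ 𝕜 (fun (h : (unitInterval →ᵇ F →L[𝕜] G)) (y : (unitInterval →ᵇ F)) =>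
        (mkOfCompact ⟨fun t => h t (y t), by fun_prop⟩ : (unitInterval →ᵇ G)))
      (fun _ _ _ => by ext; simp) (fun _ _ _ => by ext; simp)
      (fun _ _ _ => by ext; simp) (fun _ _ _ => by ext; simp)) 1 fun h y => by
    rw [BoundedContinuousFunction.norm_le (by positivity)]
    intro t
    rw [one_mul]
    exact ((h t).le_opNorm _).trans (mul_le_mul (h.norm_coe_le_norm t) (y.norm_coe_le_norm t)
      (norm_nonneg _) (norm_nonneg h))

/-- Pointwise evaluation of a path of linear maps at a vector. -/
noncomputable def pathEval :
    (unitInterval →ᵇ F →L[𝕜] G) →L[𝕜] F →L[𝕜] (unitInterval →ᵇ G) :=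
  LinearMap.mkContinuous₂
    (LinearMap.mk₂ 𝕜 (fun (h : (unitInterval →ᵇ F →L[𝕜] G)) (v : F) =>
        (mkOfCompact ⟨fun t => h t v, by fun_prop⟩ : (unitInterval →ᵇ G)))
      (fun _ _ _ => by ext; simp) (fun _ _ _ => by ext; simp)
      (fun _ _ _ => by ext; simp) (fun _ _ _ => by ext; simp)) 1 fun h y => by
    rw [BoundedContinuousFunction.norm_le (by positivity)]
    intro t
    rw [one_mul]
    exact ((h t).le_opNorm _).trans (mul_le_mul_of_nonneg_right (h.norm_coe_le_norm t)
      (norm_nonneg _))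

/-- Multiplication of a path by its parameter. -/
noncomputable def pathScale : (unitInterval →ᵇ F) →L[𝕜] (unitInterval →ᵇ F) :=
  LinearMap.mkContinuous
    { toFun := fun y => mkOfCompact ⟨fun t => ((t : ℝ) : 𝕜) • y t, by fun_prop⟩
      map_add' := fun _ _ => by ext; simp
      map_smul' := fun a y => by ext; exact smul_comm _ _ _ } 1 fun y => by
    rw [BoundedContinuousFunction.norm_le (by positivity)]
    intro t
    have : ‖((t : ℝ) : 𝕜) • y t‖ ≤ 1 * ‖y‖ := by
      rw [norm_smul]
      refine mul_le_mul ?_ (y.norm_coe_le_norm t) (norm_nonneg _) zero_le_one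
      simpa [abs_of_nonneg t.2.1] using t.2.2
    exact this

/-- The derivative of a radial pullback in terms of the pullback of the derivative. -/
noncomputable def pathDeriv :
    (unitInterval →ᵇ F →L[𝕜] G) →L[𝕜] F →L[𝕜] (unitInterval →ᵇ G) :=
  (pathEval 𝕜).comp (pathScale 𝕜)

@[simp] theorem pathDeriv_apply (h : (unitInterval →ᵇ F →L[𝕜] G)) (v : F) (t : unitInterval) :
    pathDeriv 𝕜 h v t = ((t : ℝ) : 𝕜) • h t v := rfl

@[simp] theorem pathScale_apply (y : unitInterval →ᵇ F)
    (t : unitInterval) : pathScale 𝕜 y t = ((t : ℝ) : 𝕜) • y t := rfl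

@[simp] theorem pathApply_apply (h : (unitInterval →ᵇ F →L[𝕜] G)) (y : (unitInterval →ᵇ F))
    (t : unitInterval) : pathApply 𝕜 h y t = h t (y t) := rfl

@[simp] theorem pathEval_apply (h : (unitInterval →ᵇ F →L[𝕜] G)) (v : F)
    (t : unitInterval) : pathEval 𝕜 h v t = h t v := rfl

variable {𝕜} {r : ℝ}

theorem smul_mem_ball_of_unitInterval {x : E} (hx : x ∈ ball (0 : E) r) (t : unitInterval) :
    ((t : ℝ) : 𝕜) • x ∈ ball (0 : E) r := by
  rw [mem_ball_zero_iff] at hx ⊢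
  rw [norm_smul]
  have : ‖((t : ℝ) : 𝕜)‖ ≤ 1 := by simpa [abs_of_nonneg t.2.1] using t.2.2
  exact (mul_le_of_le_one_left (norm_nonneg _) this).trans_lt hx

theorem radialPullback_apply {F : Type*} [NormedAddCommGroup F] {g : E → F}
    (hg : ContinuousOn g (ball 0 r)) {x : E}
    (hx : x ∈ ball (0 : E) r) (t : unitInterval) :
    radialPullback 𝕜 g x t = g (((t : ℝ) : 𝕜) • x) := by
  have h : Continuous fun t : unitInterval => g (((t : ℝ) : 𝕜) • x) :=
    hg.comp_continuous (by fun_prop) fun t => smul_mem_ball_of_unitInterval hx t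
  rw [radialPullback, dif_pos h]
  rfl

/-- The map `(x, t) ↦ g(tx)` is jointly continuous, and currying over the compact interval turns
this into continuity for the sup norm. -/
theorem continuousOn_radialPullback {F : Type*} [NormedAddCommGroup F] {g : E → F}
    (hg : ContinuousOn g (ball 0 r)) :
    ContinuousOn (radialPullback 𝕜 g) (ball 0 r) := by
  rw [continuousOn_iff_continuous_domRestrict]
  have hc : Continuous fun q : ball (0 : E) r × unitInterval =>
      g (((q.2 : ℝ) : 𝕜) • (q.1 : E)) :=
    hg.comp_continuous (by fun_prop) fun q => smul_mem_ball_of_unitInterval q.1.2 q.2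
  convert (ContinuousMap.isometryEquivBoundedOfCompact unitInterval F).continuous.comp
    (ContinuousMap.curry ⟨_, hc⟩).continuous using 1
  funext x
  ext t
  exact radialPullback_apply hg x.2 t

/-- For each `t` the mean value inequality bounds the error by the oscillation of the derivative of
`g` along the ray. Continuity of the pulled back derivative in the sup norm makes the bound uniform
in `t`. -/
theorem hasFDerivAt_radialPullback [NormedSpace ℝ E] {g : E → F}
    (hd : DifferentiableOn 𝕜 g (ball 0 r))
    (hg : ContinuousOn (fderiv 𝕜 g) (ball 0 r)) {x : E} (hx : x ∈ ball (0 : E) r) :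
    HasFDerivAt (radialPullback 𝕜 g)
      (pathDeriv 𝕜 (radialPullback 𝕜 (fderiv 𝕜 g) x)) x := by
  rw [hasFDerivAt_iff_isLittleO, Asymptotics.isLittleO_iff]
  intro ε hε
  have h1 := ((continuousOn_radialPullback (𝕜 := 𝕜) hg).continuousAt (isOpen_ball.mem_nhds hx))
  obtain ⟨δ, hδ, hδr⟩ := Metric.mem_nhds_iff.1
    ((h1.eventually (Metric.ball_mem_nhds _ hε)).and (isOpen_ball.mem_nhds hx))
  filter_upwards [ball_mem_nhds x hδ] with x' hx'
  rw [BoundedContinuousFunction.norm_le (by positivity)]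
  intro t
  have hmem : ∀ z ∈ ball x δ, z ∈ ball (0 : E) r := fun z hz => (hδr hz).2
  have hder : ∀ z ∈ ball x δ, HasFDerivWithinAt (fun z => g (((t : ℝ) : 𝕜) • z))
      (((t : ℝ) : 𝕜) • fderiv 𝕜 g (((t : ℝ) : 𝕜) • z)) (ball x δ) z := by
    intro z hz
    have hz' := smul_mem_ball_of_unitInterval (𝕜 := 𝕜) (hmem z hz) t
    have := ((hd _ hz').differentiableAt (isOpen_ball.mem_nhds hz')).hasFDerivAt.comp z
      ((((t : ℝ) : 𝕜) • ContinuousLinearMap.id 𝕜 E).hasFDerivAt)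
    refine HasFDerivAt.hasFDerivWithinAt ?_
    convert this using 1
    · rfl
    · rw [ContinuousLinearMap.comp_smul, ContinuousLinearMap.comp_id]
  have := (convex_ball x δ).norm_image_sub_le_of_norm_hasFDerivWithin_le' (C := ε)
    (φ := ((t : ℝ) : 𝕜) • fderiv 𝕜 g (((t : ℝ) : 𝕜) • x)) hder ?_
    (mem_ball_self hδ) hx'
  · rw [BoundedContinuousFunction.sub_apply, BoundedContinuousFunction.sub_apply, pathDeriv_apply,
      radialPullback_apply hd.continuousOn (hmem _ hx'), radialPullback_apply hd.continuousOn hx,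
      radialPullback_apply hg hx]
    exact this
  · intro z hz
    rw [← smul_sub, norm_smul]
    have ht : ‖((t : ℝ) : 𝕜)‖ ≤ 1 := by simpa [abs_of_nonneg t.2.1] using t.2.2
    refine (mul_le_of_le_one_left (norm_nonneg _) ht).trans ?_
    have h2 : dist (radialPullback 𝕜 (fderiv 𝕜 g) z) (radialPullback 𝕜 (fderiv 𝕜 g) x) < ε :=
      (hδr hz).1
    have h3 := (BoundedContinuousFunction.dist_coe_le_dist t).trans h2.le
    rwa [radialPullback_apply hg (hmem z hz), radialPullback_apply hg hx, dist_eq_norm] at h3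

/-- Induction on `n`: the derivative of the pullback is the fixed continuous linear map `pathDeriv`
applied to the pullback of the derivative. `E` and `F` share a universe so that the induction
hypothesis applies to `E →L[𝕜] F` in place of `F`. -/
theorem contDiffOn_radialPullback_nat {E F : Type u} [NormedAddCommGroup E] [NormedSpace 𝕜 E]
    [NormedSpace ℝ E] [NormedAddCommGroup F] [NormedSpace 𝕜 F] {r : ℝ} (n : ℕ) {g : E → F}
    (hg : ContDiffOn 𝕜 n g (ball 0 r)) :
    ContDiffOn 𝕜 n (radialPullback 𝕜 g) (ball 0 r) := by
  induction n generalizing F with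
  | zero => exact contDiffOn_zero.2 (continuousOn_radialPullback hg.continuousOn)
  | succ n ih =>
    rw [Nat.cast_add, Nat.cast_one, contDiffOn_succ_iff_fderiv_of_isOpen isOpen_ball] at hg
    have hd := fun x hx => hasFDerivAt_radialPullback hg.1 hg.2.2.continuousOn (x := x) hx
    rw [Nat.cast_add, Nat.cast_one, contDiffOn_succ_iff_fderiv_of_isOpen isOpen_ball]
    refine ⟨fun x hx => (hd x hx).differentiableAt.differentiableWithinAt, by simp, ?_⟩
    refine ((pathDeriv 𝕜 (F := E) (G := F)).contDiff.comp_contDiffOn (ih hg.2.2)).congr ?_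
    intro x hx
    exact (hd x hx).fderiv

theorem contDiffOn_radialPullback {E F : Type u} [NormedAddCommGroup E] [NormedSpace 𝕜 E]
    [NormedSpace ℝ E] [NormedAddCommGroup F] [NormedSpace 𝕜 F] {r : ℝ} {g : E → F}
    (hg : ContDiffOn 𝕜 ∞ g (ball 0 r)) :
    ContDiffOn 𝕜 ∞ (radialPullback 𝕜 g) (ball 0 r) :=
  contDiffOn_infty.2 fun n => contDiffOn_radialPullback_nat n (contDiffOn_infty.1 hg n)

end RadialPullback

/-! ### Integration of paths and the fundamental theorem of calculus -/

section Integration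

variable (𝕜 : Type*) [RCLike 𝕜]
  {F : Type*} [NormedAddCommGroup F] [NormedSpace 𝕜 F] [NormedSpace ℝ F] [IsScalarTower ℝ 𝕜 F]

/-- The primitive of a path which vanishes at zero, as a function on the line. -/
noncomputable def pathPrimitive (y : (unitInterval →ᵇ F)) (s : ℝ) : F :=
  ∫ t in (0 : ℝ)..s, Set.IccExtend zero_le_one y t

theorem continuous_iccExtend {F : Type*} [PseudoMetricSpace F] (y : (unitInterval →ᵇ F)) :
    Continuous (Set.IccExtend (zero_le_one (α := ℝ)) y) := y.continuous.Icc_extend'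

/-- The primitive of a path which vanishes at zero. -/
noncomputable def pathIntegral [CompleteSpace F] :
    (unitInterval →ᵇ F) →L[𝕜] (unitInterval →ᵇ F) :=
  LinearMap.mkContinuous
    { toFun := fun y => mkOfCompact ⟨fun s => pathPrimitive y s,
        (intervalIntegral.continuous_primitive
          (fun _ _ => (continuous_iccExtend y).intervalIntegrable _ _) 0).comp
          continuous_subtype_val⟩
      map_add' := fun y z => by
        ext s
        exact intervalIntegral.integral_add ((continuous_iccExtend y).intervalIntegrable _ _)
          ((continuous_iccExtend z).intervalIntegrable _ _)
      map_smul' := fun a y => by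
        ext s
        exact intervalIntegral.integral_smul a _ } 1 fun y => by
    rw [BoundedContinuousFunction.norm_le (by positivity)]
    intro s
    have := intervalIntegral.norm_integral_le_of_norm_le_const (a := 0) (b := s) (C := ‖y‖)
      (f := Set.IccExtend zero_le_one y) fun t _ => y.norm_coe_le_norm _
    refine this.trans ?_
    rw [mul_comm, sub_zero]
    refine mul_le_mul_of_nonneg_right ?_ (norm_nonneg _)
    rw [abs_of_nonneg s.2.1]
    exact s.2.2

theorem pathIntegral_apply [CompleteSpace F] (y : (unitInterval →ᵇ F)) (s : unitInterval) :
    pathIntegral 𝕜 y s = pathPrimitive y s := rfl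


/-- `Set.IccExtend` continues the path by constants to a continuous function on the line, so the
derivative is two-sided even at the end points 0 and 1. -/
theorem hasDerivAt_pathPrimitive [CompleteSpace F] (y : (unitInterval →ᵇ F)) (s : ℝ) :
    HasDerivAt (pathPrimitive y) (Set.IccExtend zero_le_one y s) s :=
  ((continuous_iccExtend y).integral_hasStrictDerivAt 0 s).hasDerivAt

/-- The fundamental theorem of calculus for paths. -/
theorem eq_pathIntegral [CompleteSpace F] {Z z : (unitInterval →ᵇ F)} {Y : ℝ → F}
    (hY : ∀ s : unitInterval, Y s = Z s) (h0 : Y 0 = 0)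
    (hd : ∀ s : unitInterval, HasDerivAt Y (z s) s) : Z = pathIntegral 𝕜 z := by
  ext s
  rw [pathIntegral_apply, ← hY, pathPrimitive]
  have := intervalIntegral.integral_eq_sub_of_hasDerivAt (a := 0) (b := s) (f := Y)
    (f' := Set.IccExtend zero_le_one z) ?_ ((continuous_iccExtend z).intervalIntegrable _ _)
  · rw [this, h0, sub_zero]
  · intro t ht
    rw [Set.uIcc_of_le s.2.1] at ht
    have ht' : t ∈ Set.Icc (0 : ℝ) 1 := ⟨ht.1, ht.2.trans s.2.2⟩
    rw [Set.IccExtend_of_mem _ _ ht']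
    exact hd ⟨t, ht'⟩

end Integration

/-! ### Linear equations with parameters, the Poincaré lemma on a ball and Hadamard's lemma -/

section Linear

variable {𝕜 : Type t} [RCLike 𝕜]
  {E : Type u} [NormedAddCommGroup E] [NormedSpace 𝕜 E]
  {F : Type u} [NormedAddCommGroup F] [NormedSpace 𝕜 F] [NormedSpace ℝ F] [IsScalarTower ℝ 𝕜 F]
  [CompleteSpace F]

omit [NormedSpace ℝ F] [IsScalarTower ℝ 𝕜 F] in
/-- Linear equations `y + K y = h` depending smoothly on a parameter, with `K = 0` at the origin,
have smooth solutions for small values of the parameter. -/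
theorem exists_contDiffOn_linear_equation {r : ℝ} (hr : 0 < r)
    {K : E → F →L[𝕜] F} {h : E → F}
    (hK : ContDiffOn 𝕜 ∞ K (ball 0 r)) (hh : ContDiffOn 𝕜 ∞ h (ball 0 r)) (h0 : K 0 = 0) :
    ∃ ε > 0, ε ≤ r ∧ ∃ y : E → F, ContDiffOn 𝕜 ∞ y (ball 0 ε) ∧
      ∀ x ∈ ball (0 : E) ε, y x + K x (y x) = h x ∧ (∀ z, z + K x z = 0 → z = 0) ∧
        ∀ v, fderiv 𝕜 y x v + (K x (fderiv 𝕜 y x v) + fderiv 𝕜 K x v (y x)) =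
          fderiv 𝕜 h x v := by
  -- Invertible operators on a Banach space form an open set on which inversion is smooth. As `T 0 =
  -- 1`, the solution `T(x)⁻¹ h(x)` exists and is smooth on a smaller ball.
  let T : E → F →L[𝕜] F := fun x => 1 + K x
  have hT : ContDiffOn 𝕜 ∞ T (ball 0 r) := contDiffOn_const.add hK
  have hT0 : T 0 = 1 := by simp [T, h0]
  have hu : ∀ᶠ x in 𝓝 (0 : E), IsUnit (T x) := by
    have hc := hT.continuousOn.continuousAt (ball_mem_nhds 0 hr)
    refine hc (Units.isOpen.mem_nhds ?_)
    rw [hT0]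
    exact isUnit_one
  obtain ⟨ε, hε, hεr⟩ := Metric.mem_nhds_iff.1 (hu.and (ball_mem_nhds 0 hr))
  have hsub : ball (0 : E) (min ε r) ⊆ ball 0 r := ball_subset_ball (min_le_right _ _)
  have hunit : ∀ x ∈ ball (0 : E) (min ε r), IsUnit (T x) := fun x hx =>
    (hεr (ball_subset_ball (min_le_left _ _) hx)).1
  have h1 : ∀ x z, z + K x z = T x z := fun x z => rfl
  have hy : ContDiffOn 𝕜 ∞ (fun x => Ring.inverse (T x) (h x)) (ball 0 (min ε r)) := by
    refine ContDiffOn.clm_apply ?_ (hh.mono hsub)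
    intro x hx
    obtain ⟨a, ha⟩ := hunit x hx
    have := contDiffAt_ringInverse 𝕜 (n := ∞) a
    rw [ha] at this
    exact this.comp_contDiffWithinAt x (hT.mono hsub x hx)
  have heq : ∀ x ∈ ball (0 : E) (min ε r),
      Ring.inverse (T x) (h x) + K x (Ring.inverse (T x) (h x)) = h x := by
    intro x hx
    rw [h1, ← mul_apply_eq_comp, Ring.mul_inverse_cancel _ (hunit x hx)]
    rfl
  refine ⟨min ε r, lt_min hε hr, min_le_right _ _, _, hy, fun x hx => ⟨heq x hx, ?_, ?_⟩⟩
  · intro z hz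
    rw [h1] at hz
    have := congrArg (fun z => Ring.inverse (T x) z) hz
    rw [← mul_apply_eq_comp, Ring.inverse_mul_cancel _ (hunit x hx), map_zero] at this
    exact this
  · intro v
    have hx' := isOpen_ball.mem_nhds hx
    have dy := ((hy.contDiffAt hx').differentiableAt (by simp)).hasFDerivAt
    have dK := (((hK.mono hsub).contDiffAt hx').differentiableAt (by simp)).hasFDerivAt
    have dh := (((hh.mono hsub).contDiffAt hx').differentiableAt (by simp)).hasFDerivAt
    -- The derivative of the solution is obtained by differentiating the equation it satisfies, not
    -- the formula with the inverse.
    have := (dy.add (dK.clm_apply dy)).unique (dh.congr_of_eventuallyEq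
      (Filter.eventually_of_mem hx' heq))
    exact congrArg (fun L => L v) this

variable [NormedSpace ℝ E] [IsScalarTower ℝ 𝕜 E]

theorem hasDerivAt_radial {G : Type*} [NormedAddCommGroup G] [NormedSpace 𝕜 G] [NormedSpace ℝ G]
    [IsScalarTower ℝ 𝕜 G] {r : ℝ} {g : E → G} (hg : ContDiffOn 𝕜 ∞ g (ball 0 r)) {x : E}
    (hx : x ∈ ball (0 : E) r) (s : unitInterval) :
    HasDerivAt (fun s : ℝ => g ((s : 𝕜) • x)) (fderiv 𝕜 g (((s : ℝ) : 𝕜) • x) x) s := by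
  have hx' := smul_mem_ball_of_unitInterval (𝕜 := 𝕜) hx s
  have h1 := ((hg.contDiffAt (isOpen_ball.mem_nhds hx')).differentiableAt
    (by simp)).hasFDerivAt.restrictScalars ℝ
  have h2 : HasDerivAt (fun s : ℝ => (s : 𝕜) • x) x s := by
    simp only [← RCLike.real_smul_eq_coe_smul]
    simpa using (hasDerivAt_id (s : ℝ)).smul_const x
  exact h1.comp_hasDerivAt (s : ℝ) h2

/-- The variation of the radial solution of a flat inhomogeneous linear system, corrected by the
equation to be solved, satisfies the homogeneous integral equation. -/
theorem radial_variation {Ω : E → E →L[𝕜] F →L[𝕜] F} {c : E → E →L[𝕜] F} {r : ℝ}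
    (hΩ : ContDiffOn 𝕜 ∞ Ω (ball 0 r)) (hc : ContDiffOn 𝕜 ∞ c (ball 0 r))
    (flat : ∀ x ∈ ball (0 : E) r, ∀ u v, fderiv 𝕜 Ω x u v + (Ω x u).comp (Ω x v) =
      fderiv 𝕜 Ω x v u + (Ω x v).comp (Ω x u))
    (closed : ∀ x ∈ ball (0 : E) r, ∀ u v, fderiv 𝕜 c x u v + Ω x u (c x v) =
      fderiv 𝕜 c x v u + Ω x v (c x u))
    {x : E} (hx : x ∈ ball (0 : E) r) (v : E) {y W z w Z q : (unitInterval →ᵇ F)}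
    (hy : y = pathIntegral 𝕜 z) (hW : W = pathIntegral 𝕜 w)
    (hz : ∀ t : unitInterval, z t = c (((t : ℝ) : 𝕜) • x) x - Ω (((t : ℝ) : 𝕜) • x) x (y t))
    (hw : ∀ t : unitInterval, w t =
      ((t : ℝ) : 𝕜) • fderiv 𝕜 c (((t : ℝ) : 𝕜) • x) v x + c (((t : ℝ) : 𝕜) • x) v
      - (((t : ℝ) : 𝕜) • fderiv 𝕜 Ω (((t : ℝ) : 𝕜) • x) v x + Ω (((t : ℝ) : 𝕜) • x) v) (y t)
      - Ω (((t : ℝ) : 𝕜) • x) x (W t))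
    (hZ : ∀ t : unitInterval, Z t = W t - ((t : ℝ) : 𝕜) • c (((t : ℝ) : 𝕜) • x) v
      + ((t : ℝ) : 𝕜) • Ω (((t : ℝ) : 𝕜) • x) v (y t))
    (hq : ∀ t : unitInterval, q t = - Ω (((t : ℝ) : 𝕜) • x) x (Z t)) :
    Z = pathIntegral 𝕜 q := by
  -- Here `y` stands for `t ↦ b(tx)`, `W` for its derivative in `x` in the direction `v`, and `z`,
  -- `w` for the derivatives of `y`, `W` in `t`. The path `Z` is the error of the equation in the
  -- direction `v`, multiplied by `t` through the chain rule.
  have : IsScalarTower ℝ 𝕜 (F →L[𝕜] F) := ⟨fun a b f => by ext; simp [smul_assoc]⟩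
  have hΩv : ContDiffOn 𝕜 ∞ (fun x => Ω x v) (ball 0 r) := hΩ.clm_apply contDiffOn_const
  have hcv : ContDiffOn 𝕜 ∞ (fun x => c x v) (ball 0 r) := hc.clm_apply contDiffOn_const
  refine eq_pathIntegral 𝕜 (Y := fun s : ℝ => pathPrimitive w s - (s : 𝕜) • c ((s : 𝕜) • x) v
      + (s : 𝕜) • Ω ((s : 𝕜) • x) v (pathPrimitive z s)) ?_ ?_ ?_
  · intro s
    rw [hZ, hW, hy, pathIntegral_apply, pathIntegral_apply]
  · simp [pathPrimitive]
  · intro s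
    have hs := smul_mem_ball_of_unitInterval (𝕜 := 𝕜) hx s
    have dP : ∀ u : (unitInterval →ᵇ F), HasDerivAt (pathPrimitive u) (u s) s := fun u => by
      have := hasDerivAt_pathPrimitive u s
      rwa [Set.IccExtend_val] at this
    have d1 : HasDerivAt (fun s : ℝ => (s : 𝕜)) 1 s := by
      have := (RCLike.ofRealCLM (K := 𝕜)).hasDerivAt (x := (s : ℝ))
      simpa using this
    have hdiff : ∀ {G : Type u} [NormedAddCommGroup G] [NormedSpace 𝕜 G] (g : E → E →L[𝕜] G),
        ContDiffOn 𝕜 ∞ g (ball 0 r) →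
        fderiv 𝕜 (fun x => g x v) (((s : ℝ) : 𝕜) • x) x = fderiv 𝕜 g (((s : ℝ) : 𝕜) • x) x v := by
      intro G _ _ g hg
      have h1 := ((hg.contDiffAt (isOpen_ball.mem_nhds hs)).differentiableAt
        (by simp)).hasFDerivAt
      rw [(h1.clm_apply (hasFDerivAt_const v _)).fderiv]
      simp
    have d2 := hasDerivAt_radial hcv hx s
    have d3 := hasDerivAt_radial hΩv hx s
    rw [hdiff _ hc] at d2
    rw [hdiff _ hΩ] at d3
    have d4 := ((ContinuousLinearMap.restrictScalarsL 𝕜 F F ℝ ℝ).hasFDerivAt.comp_hasDerivAt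
      (s : ℝ) d3).clm_apply (dP z)
    have hres : ∀ (f : F →L[𝕜] F) (u : F),
        ContinuousLinearMap.restrictScalarsL 𝕜 F F ℝ ℝ f u = f u := fun _ _ => rfl
    have d5 := ((dP w).sub (d1.smul d2)).add (d1.smul d4)
    have hyz : pathPrimitive z s = y s := by rw [hy, pathIntegral_apply]
    -- Closedness and flatness at `sx` exchange the derivative in the direction `v` with the
    -- derivative along the ray; after this exchange all inhomogeneous terms cancel.
    have e1 := closed _ hs v x
    have e2 := congrArg (fun L => L (y s)) (flat _ hs v x)
    simp only [_root_.add_apply, ContinuousLinearMap.comp_apply] at e2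
    refine d5.congr_deriv ?_
    rw [hq, hw, hZ, hz]
    simp only [Function.comp_apply, hres, hyz, map_add, map_sub, map_smul, smul_add,
      smul_sub, one_smul, _root_.add_apply, _root_.smul_apply]
    rw [← eq_sub_iff_add_eq] at e1 e2
    rw [e1, e2]
    simp only [smul_add, smul_sub]
    abel

variable (𝕜) in
/-- The integral operator with a given kernel. -/
noncomputable def radialOperator :
    (unitInterval →ᵇ F →L[𝕜] F) →L[𝕜] (unitInterval →ᵇ F) →L[𝕜] (unitInterval →ᵇ F) :=
  (ContinuousLinearMap.compL 𝕜 _ _ _ (pathIntegral 𝕜)).comp (pathApply 𝕜)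

-- The path `t ↦ g(tx) x` is the one-form `g` contracted with the velocity of the ray; both the
-- kernel and the right hand side of the radial equation have this shape.
omit [IsScalarTower ℝ 𝕜 E] in
theorem contDiffOn_radialEval {G : Type u} [NormedAddCommGroup G] [NormedSpace 𝕜 G] {r : ℝ}
    {g : E → E →L[𝕜] G} (hg : ContDiffOn 𝕜 ∞ g (ball 0 r)) :
    ContDiffOn 𝕜 ∞ (fun x => pathEval 𝕜 (radialPullback 𝕜 g x) x) (ball 0 r) := by
  have h := ContinuousLinearMap.contDiff (𝕜 := 𝕜) (n := ∞) (E := unitInterval →ᵇ (E →L[𝕜] G))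
    (F := E →L[𝕜] (unitInterval →ᵇ G)) (pathEval 𝕜)
  exact (h.comp_contDiffOn (contDiffOn_radialPullback hg)).clm_apply contDiffOn_id

omit [IsScalarTower ℝ 𝕜 E] in
theorem fderiv_radialEval_apply {G : Type u} [NormedAddCommGroup G] [NormedSpace 𝕜 G] {r : ℝ}
    {g : E → E →L[𝕜] G} (hg : ContDiffOn 𝕜 ∞ g (ball 0 r)) {x : E} (hx : x ∈ ball (0 : E) r)
    (v : E) (t : unitInterval) :
    fderiv 𝕜 (fun x => pathEval 𝕜 (radialPullback 𝕜 g x) x) x v t =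
      ((t : ℝ) : 𝕜) • fderiv 𝕜 g (((t : ℝ) : 𝕜) • x) v x + g (((t : ℝ) : 𝕜) • x) v := by
  have h1 := hasFDerivAt_radialPullback (hg.differentiableOn (by simp))
    (hg.continuousOn_fderiv_of_isOpen isOpen_ball (by simp)) hx
  have h2 := ContinuousLinearMap.hasFDerivAt (𝕜 := 𝕜) (E := unitInterval →ᵇ (E →L[𝕜] G))
    (F := E →L[𝕜] (unitInterval →ᵇ G)) (pathEval 𝕜) (x := radialPullback 𝕜 g x)
  have h3 := h2.comp x h1
  have h4 := h3.clm_apply (hasFDerivAt_id x)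
  have h5 : HasFDerivAt (fun x => pathEval 𝕜 (radialPullback 𝕜 g x) x) _ x := h4
  rw [h5.fderiv]
  have e1 := radialPullback_apply (𝕜 := 𝕜) hg.continuousOn hx t
  have e2 := radialPullback_apply (𝕜 := 𝕜)
    (hg.continuousOn_fderiv_of_isOpen isOpen_ball (by simp)) hx t
  rw [← e1, ← e2]
  exact add_comm _ _

/-- The Poincaré lemma for a flat connection on a trivial bundle over a ball: closed 1-forms
with values in the bundle are exact near the centre. -/
theorem exists_primitive_of_flat {Ω : E → E →L[𝕜] F →L[𝕜] F} {c : E → E →L[𝕜] F} {r : ℝ}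
    (hr : 0 < r)
    (hΩ : ContDiffOn 𝕜 ∞ Ω (ball 0 r)) (hc : ContDiffOn 𝕜 ∞ c (ball 0 r))
    (flat : ∀ x ∈ ball (0 : E) r, ∀ u v, fderiv 𝕜 Ω x u v + (Ω x u).comp (Ω x v) =
      fderiv 𝕜 Ω x v u + (Ω x v).comp (Ω x u))
    (closed : ∀ x ∈ ball (0 : E) r, ∀ u v, fderiv 𝕜 c x u v + Ω x u (c x v) =
      fderiv 𝕜 c x v u + Ω x v (c x u)) :
    ∃ ε > 0, ε ≤ r ∧ ∃ b : E → F, ContDiffOn 𝕜 ∞ b (ball 0 ε) ∧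
      ∀ x ∈ ball (0 : E) ε, ∀ v, fderiv 𝕜 b x v + Ω x v (b x) = c x v := by
  -- Along the ray through `x`, the equation for `y(t) = b(tx)` with `b(0) = 0` reads `y + K(x) y =
  -- ∫ c(tx) x dt`, where `K(x) y` is the primitive of `Ω(tx) x · y(t)`. The velocity `x` makes `K`
  -- vanish at the origin.
  let K : E → (unitInterval →ᵇ F) →L[𝕜] (unitInterval →ᵇ F) := fun x =>
    radialOperator 𝕜 (pathEval 𝕜 (radialPullback 𝕜 Ω x) x)
  have hR := ContinuousLinearMap.contDiff (𝕜 := 𝕜) (n := ∞) (E := unitInterval →ᵇ (F →L[𝕜] F))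
    (F := (unitInterval →ᵇ F) →L[𝕜] (unitInterval →ᵇ F)) (radialOperator 𝕜)
  have hI := ContinuousLinearMap.contDiff (𝕜 := 𝕜) (n := ∞) (E := unitInterval →ᵇ F)
    (F := unitInterval →ᵇ F) (pathIntegral 𝕜)
  have hK : ContDiffOn 𝕜 ∞ K (ball 0 r) := hR.comp_contDiffOn (contDiffOn_radialEval hΩ)
  obtain ⟨ε, hε, hεr, y, hy, hyT⟩ := exists_contDiffOn_linear_equation hr hK
    (hI.comp_contDiffOn (contDiffOn_radialEval hc)) (by simp [K])
  refine ⟨ε, hε, hεr, fun x => y x 1, ?_, ?_⟩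
  · exact (BoundedContinuousFunction.evalCLM 𝕜 (1 : unitInterval)).contDiff.comp_contDiffOn hy
  intro x hx v
  have hx' : x ∈ ball (0 : E) r := ball_subset_ball hεr hx
  obtain ⟨h1, h2, h3⟩ := hyT x hx
  replace h3 := h3 v
  have hK' : fderiv 𝕜 K x v = radialOperator 𝕜
      (fderiv 𝕜 (fun x => pathEval 𝕜 (radialPullback 𝕜 Ω x) x) x v) := by
    have d := (((contDiffOn_radialEval hΩ).contDiffAt (isOpen_ball.mem_nhds hx')).differentiableAt
      (by simp)).hasFDerivAt
    have d2 := ContinuousLinearMap.hasFDerivAt (𝕜 := 𝕜) (E := unitInterval →ᵇ (F →L[𝕜] F))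
      (F := (unitInterval →ᵇ F) →L[𝕜] (unitInterval →ᵇ F)) (radialOperator 𝕜)
      (x := pathEval 𝕜 (radialPullback 𝕜 Ω x) x)
    exact congrArg (fun L => L v) (d2.comp x d).fderiv
  have hh' : fderiv 𝕜 ((pathIntegral 𝕜) ∘ fun x => pathEval 𝕜 (radialPullback 𝕜 c x) x) x v =
      pathIntegral 𝕜 (fderiv 𝕜 (fun x => pathEval 𝕜 (radialPullback 𝕜 c x) x) x v) := by
    have d := (((contDiffOn_radialEval hc).contDiffAt (isOpen_ball.mem_nhds hx')).differentiableAt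
      (by simp)).hasFDerivAt
    have d2 := ContinuousLinearMap.hasFDerivAt (𝕜 := 𝕜) (E := unitInterval →ᵇ F)
      (F := unitInterval →ᵇ F) (pathIntegral 𝕜)
      (x := pathEval 𝕜 (radialPullback 𝕜 c x) x)
    exact congrArg (fun L => L v) (HasFDerivAt.comp (g := pathIntegral 𝕜)
      (f := fun x => pathEval 𝕜 (radialPullback 𝕜 c x) x) x d2 d).fderiv
  have eΩ := fun t => radialPullback_apply (𝕜 := 𝕜) hΩ.continuousOn hx' t
  have ec := fun t => radialPullback_apply (𝕜 := 𝕜) hc.continuousOn hx' t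
  have hΩv : ContDiffOn 𝕜 ∞ (fun x => Ω x v) (ball 0 r) := hΩ.clm_apply contDiffOn_const
  have hcv : ContDiffOn 𝕜 ∞ (fun x => c x v) (ball 0 r) := hc.clm_apply contDiffOn_const
  rw [hK', hh'] at h3
  -- `z` is the integrand of the radial equation for `y x`, and `w` that of the same equation
  -- differentiated in the direction `v`.
  have hv := radial_variation hΩ hc flat closed hx' v (y := y x) (W := fderiv 𝕜 y x v)
    (z := pathEval 𝕜 (radialPullback 𝕜 c x) x -
      pathApply 𝕜 (pathEval 𝕜 (radialPullback 𝕜 Ω x) x) (y x))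
    (w := fderiv 𝕜 (fun x => pathEval 𝕜 (radialPullback 𝕜 c x) x) x v -
      pathApply 𝕜 (fderiv 𝕜 (fun x => pathEval 𝕜 (radialPullback 𝕜 Ω x) x) x v) (y x) -
      pathApply 𝕜 (pathEval 𝕜 (radialPullback 𝕜 Ω x) x) (fderiv 𝕜 y x v))
    (Z := fderiv 𝕜 y x v - pathScale 𝕜 (radialPullback 𝕜 (fun x => c x v) x) +
      pathScale 𝕜 (pathApply 𝕜 (radialPullback 𝕜 (fun x => Ω x v) x) (y x)))
    (q := - pathApply 𝕜 (pathEval 𝕜 (radialPullback 𝕜 Ω x) x)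
      (fderiv 𝕜 y x v - pathScale 𝕜 (radialPullback 𝕜 (fun x => c x v) x) +
      pathScale 𝕜 (pathApply 𝕜 (radialPullback 𝕜 (fun x => Ω x v) x) (y x)))) ?_ ?_ ?_ ?_ ?_ ?_
  · rw [map_neg] at hv
    -- `1 + K x` is injective, so the error `Z` vanishes. Its value at `t = 1` is the equation to be
    -- proved.
    have hZ := h2 _ (eq_neg_iff_add_eq_zero.1 hv)
    have h1' := congrArg (fun u => u (1 : unitInterval)) hZ
    have e1 := radialPullback_apply (𝕜 := 𝕜) hcv.continuousOn hx' 1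
    have e2 := radialPullback_apply (𝕜 := 𝕜) hΩv.continuousOn hx' 1
    simp only [BoundedContinuousFunction.add_apply, BoundedContinuousFunction.sub_apply,
      pathScale_apply, pathApply_apply, e1, e2] at h1'
    have hb : fderiv 𝕜 (fun x => y x 1) x v = fderiv 𝕜 y x v 1 := by
      have d := (((hy.contDiffAt (isOpen_ball.mem_nhds hx))).differentiableAt
        (by simp)).hasFDerivAt
      exact congrArg (fun L => L v)
        (((BoundedContinuousFunction.evalCLM 𝕜 (1 : unitInterval)).hasFDerivAt).comp x d).fderiv
    rw [hb]
    simp at h1'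
    rw [← sub_eq_zero, ← h1']
    abel
  · rw [map_sub, eq_sub_iff_add_eq]
    exact h1
  · rw [map_sub, map_sub, eq_sub_iff_add_eq, eq_sub_iff_add_eq, ← h3, add_assoc]
    rfl
  · intro t
    simp [eΩ, ec]
  · intro t
    simp only [BoundedContinuousFunction.sub_apply, pathApply_apply, pathEval_apply,
      fderiv_radialEval_apply hc hx', fderiv_radialEval_apply hΩ hx', eΩ]
  · intro t
    have e1 := radialPullback_apply (𝕜 := 𝕜) hcv.continuousOn hx' t
    have e2 := radialPullback_apply (𝕜 := 𝕜) hΩv.continuousOn hx' t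
    simp only [BoundedContinuousFunction.add_apply, BoundedContinuousFunction.sub_apply,
      pathScale_apply, pathApply_apply, e1, e2]
  · intro t
    simp only [BoundedContinuousFunction.neg_apply, pathApply_apply, pathEval_apply, eΩ]

/-- Hadamard's lemma. -/
theorem exists_sub_eq_apply {G : Type u} [NormedAddCommGroup G] [NormedSpace 𝕜 G] [NormedSpace ℝ G]
    [IsScalarTower ℝ 𝕜 G] [CompleteSpace G] {g : E → G} {r : ℝ}
    (hg : ContDiffOn 𝕜 ∞ g (ball 0 r)) :
    ∃ h : E → E →L[𝕜] G, ContDiffOn 𝕜 ∞ h (ball 0 r) ∧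
      ∀ x ∈ ball (0 : E) r, g x - g 0 = h x x := by
  have : IsScalarTower ℝ 𝕜 (E →L[𝕜] G) := ⟨fun a b f => by ext; simp [smul_assoc]⟩
  have hg' : ContDiffOn 𝕜 ∞ (fderiv 𝕜 g) (ball 0 r) :=
    ((contDiffOn_infty_iff_fderiv_of_isOpen isOpen_ball).1 hg).2
  have hI := ContinuousLinearMap.contDiff (𝕜 := 𝕜) (n := ∞) (E := unitInterval →ᵇ (E →L[𝕜] G))
    (F := unitInterval →ᵇ (E →L[𝕜] G)) (pathIntegral 𝕜)
  -- The witness is `h(x) = ∫₀¹ Dg(tx) dt`.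
  refine ⟨fun x => pathIntegral 𝕜 (radialPullback 𝕜 (fderiv 𝕜 g) x) 1, ?_, ?_⟩
  · exact (BoundedContinuousFunction.evalCLM 𝕜 (1 : unitInterval)).contDiff.comp_contDiffOn
      (hI.comp_contDiffOn (contDiffOn_radialPullback hg'))
  · intro x hx
    have h1 := eq_pathIntegral 𝕜
      (Z := radialPullback 𝕜 g x - BoundedContinuousFunction.const _ (g 0))
      (z := pathEval 𝕜 (radialPullback 𝕜 (fderiv 𝕜 g) x) x)
      (Y := fun s => g ((s : 𝕜) • x) - g 0)
      (fun s => by simp [radialPullback_apply hg.continuousOn hx]) (by simp)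
      (fun s => by
        have := (hasDerivAt_radial hg hx s).sub_const (g 0)
        rwa [pathEval_apply, radialPullback_apply hg'.continuousOn hx])
    have h2 := congrArg (fun u => u (1 : unitInterval)) h1
    have e1 := radialPullback_apply (𝕜 := 𝕜) hg.continuousOn hx 1
    simp only [BoundedContinuousFunction.sub_apply, e1, BoundedContinuousFunction.const_apply,
      RCLike.ofReal_one, one_smul, Set.Icc.coe_one] at h2
    rw [h2]
    beta_reduce
    rw [pathIntegral_apply, pathIntegral_apply, pathPrimitive, pathPrimitive,
      ContinuousLinearMap.intervalIntegral_apply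
        ((continuous_iccExtend _).intervalIntegrable _ _)]
    rfl

end Linear

end Analysis

/-! ## Pencils of flat connections -/

section Pencil

variable {k : Type t} [Field k] [CharZero k] {M : Type u} [TopologicalSpace M]
  {X : SuperSpace.{t, u, v} k M} {F : SuperModule.{t, u, v, w} X}

omit [CharZero k] in
/-- Sections of a sheaf which agree locally are equal. -/
theorem SuperModule.eq_of_locally_eq (F : SuperModule.{t, u, v, w} X) {U : Opens M} (f g : F.obj U)
    (h : ∀ x ∈ U, ∃ (V : Opens M) (hV : V ≤ U), x ∈ V ∧ F.res hV f = F.res hV g) : f = g := by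
  choose V hV hx hfg using fun x : U => h x.1 x.2
  have hU : U = ⨆ i, V i := by
    refine le_antisymm (fun x hx' => ?_) (iSup_le hV)
    exact (le_iSup V ⟨x, hx'⟩) (hx ⟨x, hx'⟩)
  -- `glue` is stated over a literal supremum, so the open set is made a variable that can be
  -- replaced by it.
  have key : ∀ (ι : Type u) (V : ι → Opens M) (W : Opens M) (hW : W = ⨆ i, V i) (f g : F.obj W),
      (∀ i, F.res (hW ▸ le_iSup V i : V i ≤ W) f = F.res (hW ▸ le_iSup V i : V i ≤ W) g) →
      f = g := by
    intro ι V W hW f g hfg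
    subst hW
    obtain ⟨a, -, ha⟩ := F.glue V (fun i => F.res (le_iSup V i) f) fun i j => by
      rw [F.res_res, F.res_res]
    exact (ha f fun i => rfl).trans (ha g fun i => (hfg i).symm).symm
  exact key U V U hU f g hfg

/-- The contraction of `A f` with a vector field. -/
def SuperOneFormOperator.cov (A : SuperOneFormOperator F) {V : Opens M} {i : ZMod 2}
    (D : SuperVectorField X V i) (f : F.obj V) : F.obj V :=
  (A.toFun f).toFun V le_rfl i D

omit [CharZero k] in
theorem SuperModule.σ_superSign {U : Opens M} (i : ZMod 2) (f : F.obj U) :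
    F.σ (superSign i • f) = superSign i • F.σ f := map_zsmul _ _ _

theorem neg_superSign_add_one (i : ZMod 2) : -superSign (i + 1) = superSign i := by
  obtain rfl | rfl := parity_cases i <;> simp [superSign, parity_one_add_one]

namespace SuperOneFormOperator

variable (A : SuperOneFormOperator F) {U V : Opens M} {i j : ZMod 2}

theorem cov_add (D : SuperVectorField X V i) (f g : F.obj V) :
    A.cov D (f + g) = A.cov D f + A.cov D g := by
  simp only [cov, A.map_add, SuperForm1.add_toFun]

theorem cov_smul (D : SuperVectorField X V i) (a : X.obj V) (f : F.obj V) :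
    A.cov D (a • f) = X.tw i a • A.cov D f := by
  simp only [cov, A.map_smul, SuperForm1.smul_toFun, X.res_self]
  obtain rfl | rfl := parity_cases i <;> simp [SuperSpace.tw, parity_one_add_one, X.σ_σ]

theorem cov_res {W : Opens M} (hW : W ≤ V) (D : SuperVectorField X V i) (f : F.obj V) :
    F.res hW (A.cov D f) = A.cov (D.restrict hW) (F.res hW f) := by
  simp only [cov, ← A.map_res, SuperForm1.map_res]
  rfl

theorem toFun_eq_cov (f : F.obj U) (hV : V ≤ U) (D : SuperVectorField X V i) :
    (A.toFun f).toFun V hV i D = A.cov D (F.res hV f) := by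
  rw [cov, ← A.map_res]
  rfl

/-- `A` is odd and the contraction with `D` has parity `|D| + 1`, so that `A_D` has parity `|D|`. -/
theorem cov_σ (D : SuperVectorField X V i) (f : F.obj V) :
    A.cov D (F.σ f) = superSign i • F.σ (A.cov D f) := by
  rw [cov, A.odd, SuperForm1.base_smul_toFun, SuperForm1.σ_toFun, neg_one_smul, ← neg_zsmul,
    neg_superSign_add_one]
  rfl

/-- `A_D` as a `k`-linear map. -/
def covHom (D : SuperVectorField X V i) : F.obj V →+ F.obj V :=
  AddMonoidHom.mk' (A.cov D) (A.cov_add D)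

end SuperOneFormOperator

namespace SuperConnection

variable (nabla : SuperConnection F) (A : SuperOneFormOperator F) {U V : Opens M} {i j : ZMod 2}

theorem toFun_eq_cov (f : F.obj U) (hV : V ≤ U) (D : SuperVectorField X V i) :
    (nabla.toFun f).toFun V hV i D = nabla.cov D (F.res hV f) := by
  rw [cov, ← nabla.map_res]
  rfl

theorem cov_σ (D : SuperVectorField X V i) (f : F.obj V) :
    nabla.cov D (F.σ f) = superSign i • F.σ (nabla.cov D f) := by
  rw [cov, nabla.odd, SuperForm1.base_smul_toFun, SuperForm1.σ_toFun, neg_one_smul, ← neg_zsmul,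
    neg_superSign_add_one]
  rfl

theorem cov_base_smul (D : SuperVectorField X V i) (c : k) (f : F.obj V) :
    nabla.cov D (c • f) = c • nabla.cov D f := by
  simp only [cov, nabla.map_smul, SuperForm1.base_smul_toFun]

/-- `∇_D` as an additive map. -/
def covHom (D : SuperVectorField X V i) : F.obj V →+ F.obj V :=
  AddMonoidHom.mk' (nabla.cov D) (nabla.cov_add D)

/-- The value of `∇² f` on two vector fields. -/
def curvature (D : SuperVectorField X V i) (E : SuperVectorField X V j) (f : F.obj V) : F.obj V :=
  nabla.cov D (nabla.cov E f) - superSign (i * j) • nabla.cov E (nabla.cov D f) -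
    nabla.cov (D.bracket E) f

/-- The value of `(∇ A + A ∇) f` on two vector fields. -/
def anticomm (D : SuperVectorField X V i) (E : SuperVectorField X V j) (f : F.obj V) : F.obj V :=
  (nabla.cov D (A.cov E f) + A.cov D (nabla.cov E f)) -
    superSign (i * j) • (nabla.cov E (A.cov D f) + A.cov E (nabla.cov D f)) -
    A.cov (D.bracket E) f

/-- The value of `∇²f` over a smaller open set is the curvature applied to the restriction of `f`,
so it is enough to test vector fields on the domain of `f`. -/
theorem isFlat_iff : nabla.IsFlat ↔ ∀ (V : Opens M) (i j : ZMod 2) (D : SuperVectorField X V i)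
    (E : SuperVectorField X V j) (f : F.obj V), nabla.curvature D E f = 0 := by
  constructor
  · intro h V i j D E f
    exact congrArg (fun α : SuperForm2 F V => α.toFun V le_rfl i j D E) (h V f)
  · intro h U f
    ext V hV i j D E
    have := h V i j D E (F.res hV f)
    rw [curvature, ← nabla.toFun_eq_cov f hV, ← nabla.toFun_eq_cov f hV,
      ← nabla.toFun_eq_cov f hV] at this
    exact this

theorem line_cov (c : k) (D : SuperVectorField X V i) (f : F.obj V) :
    (nabla.line A c).cov D f = nabla.cov D f + c • A.cov D f := rfl

end SuperConnection

/-- The value of `(A ∧ A) f` on two vector fields. -/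
def SuperOneFormOperator.wedgeSquare (A : SuperOneFormOperator F) {V : Opens M} {i j : ZMod 2}
    (D : SuperVectorField X V i) (E : SuperVectorField X V j) (f : F.obj V) : F.obj V :=
  A.cov D (A.cov E f) - superSign (i * j) • A.cov E (A.cov D f)

theorem SuperOneFormOperator.cov_base_smul (A : SuperOneFormOperator F) {V : Opens M} {i : ZMod 2}
    (D : SuperVectorField X V i) (c : k) (f : F.obj V) : A.cov D (c • f) = c • A.cov D f := by
  rw [← algebraMap_smul (X.obj V) c f, A.cov_smul, ← algebraMap_smul (X.obj V) c (A.cov D f)]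
  congr 1
  obtain rfl | rfl := parity_cases i <;> simp [SuperSpace.tw]

namespace SuperConnection

variable (nabla : SuperConnection F) (A : SuperOneFormOperator F) {U V : Opens M} {i j : ZMod 2}

/-- This is `(∇ + cA)²` expanded in powers of `c`, evaluated on two vector fields. -/
theorem line_curvature (c : k) (D : SuperVectorField X V i) (E : SuperVectorField X V j)
    (f : F.obj V) : (nabla.line A c).curvature D E f = nabla.curvature D E f +
      c • nabla.anticomm A D E f + (c * c) • A.wedgeSquare D E f := by
  simp only [curvature, anticomm, SuperOneFormOperator.wedgeSquare, line_cov, nabla.cov_add,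
    A.cov_add, nabla.cov_base_smul, A.cov_base_smul, smul_add, smul_sub, mul_smul,
    smul_comm c (superSign _)]
  abel

/-- The pencil `∇ + λ A` is flat if and only if `∇ A + A ∇ = 0` and `A ∧ A = 0`. -/
theorem isFlatPencil_iff (hflat : nabla.IsFlat) : nabla.IsFlatPencil A ↔
    ∀ (V : Opens M) (i j : ZMod 2) (D : SuperVectorField X V i) (E : SuperVectorField X V j)
      (f : F.obj V), nabla.anticomm A D E f = 0 ∧ A.wedgeSquare D E f = 0 := by
  rw [isFlat_iff] at hflat
  constructor
  · intro h V i j D E f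
    -- The parameters 1 and -1 are enough: the sum of the two equations isolates twice the quadratic
    -- coefficient.
    have h1 := (isFlat_iff _).1 (h 1) V i j D E f
    have h2 := (isFlat_iff _).1 (h (-1)) V i j D E f
    rw [line_curvature, hflat] at h1 h2
    simp only [zero_add, one_smul, mul_one, neg_one_smul, mul_neg, neg_neg] at h1 h2
    have h3 : (2 : k) • A.wedgeSquare D E f = 0 := by
      rw [two_smul]
      calc _ = (nabla.anticomm A D E f + A.wedgeSquare D E f) +
            (-nabla.anticomm A D E f + A.wedgeSquare D E f) := by abel
        _ = 0 := by rw [h1, h2, add_zero]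
    have h4 : A.wedgeSquare D E f = 0 := by simpa using h3
    rw [h4, add_zero] at h1
    exact ⟨h1, h4⟩
  · intro h c
    rw [isFlat_iff]
    intro V i j D E f
    rw [line_curvature, hflat, (h V i j D E f).1, (h V i j D E f).2]
    simp

variable {nabla A}

theorem IsPotential.wedgeSquare_eq {B : SuperEnd F U} (hB : nabla.IsPotential A B) (hV : V ≤ U)
    (D : SuperVectorField X V i) (E : SuperVectorField X V j) (f : F.obj V) :
    operatorWedge (nabla.derivEnd B) (nabla.derivEnd B) V hV f i j D E = A.wedgeSquare D E f := by
  simp only [operatorWedge, ← hB V hV]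
  rfl

/-- An odd operator with a potential has, over each open set, a potential which commutes with
parity. -/
theorem IsPotential.exists_even {B : SuperEnd F U} (hB : nabla.IsPotential A B) (hV : V ≤ U) :
    ∃ C : F.obj V →ₗ[k] F.obj V, ∀ (i : ZMod 2) (D : SuperVectorField X V i) (f : F.obj V),
      A.cov D f = nabla.cov D (C f) - C (nabla.cov D f) := by
  -- The witness is the even part `(B + σBσ)/2`. It is still a potential because `A_D` and `∇_D`
  -- commute with `σ` up to the same sign, and for an even potential the signs in the equation
  -- disappear.
  refine ⟨(2 : k)⁻¹ • (B.toFun V hV + F.σ ∘ₗ B.toFun V hV ∘ₗ F.σ), fun i D f => ?_⟩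
  have h1 : ∀ f, A.cov D f = nabla.cov D (B.toFun V hV f) -
      F.tw i (B.toFun V hV (F.tw i (nabla.cov D f))) := fun f => by
    rw [SuperOneFormOperator.cov, hB V hV]
    rfl
  have h2 : A.cov D f = superSign i • F.σ (A.cov D (F.σ f)) := by
    rw [A.cov_σ, SuperModule.σ_superSign, F.σ_σ, smul_smul]
    obtain rfl | rfl := parity_cases i <;> simp [superSign]
  have h3 : (2 : k) • A.cov D f = nabla.cov D (B.toFun V hV f) +
      nabla.cov D (F.σ (B.toFun V hV (F.σ f))) -
      (B.toFun V hV (nabla.cov D f) + F.σ (B.toFun V hV (F.σ (nabla.cov D f)))) := by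
    rw [two_smul]
    nth_rewrite 2 [h2]
    rw [h1, h1, nabla.cov_σ, nabla.cov_σ]
    obtain rfl | rfl := parity_cases i <;>
      simp [superSign, SuperModule.tw, F.σ_σ] <;> abel
  have h4 := congrArg (fun g => (2 : k)⁻¹ • g) h3
  simp only [smul_smul, inv_mul_cancel₀ (two_ne_zero' k), one_smul] at h4
  rw [h4]
  simp only [LinearMap.smul_apply, LinearMap.add_apply, LinearMap.comp_apply, nabla.cov_base_smul,
    nabla.cov_add, smul_sub, smul_add]

/-- With `A_D = [∇_D, C]` for an even `C`, the expression becomes the commutator of the curvature of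
`∇` with `C`. -/
theorem IsPotential.anticomm_eq_zero {B : SuperEnd F U} (hflat : nabla.IsFlat)
    (hB : nabla.IsPotential A B) (hV : V ≤ U)
    (D : SuperVectorField X V i) (E : SuperVectorField X V j) (f : F.obj V) :
    nabla.anticomm A D E f = 0 := by
  obtain ⟨C, hC⟩ := hB.exists_even hV
  have hsub : ∀ (i : ZMod 2) (D : SuperVectorField X V i) (f g : F.obj V),
      nabla.cov D (f - g) = nabla.cov D f - nabla.cov D g := fun i D => map_sub (nabla.covHom D)
  rw [isFlat_iff] at hflat
  have h1 := hflat V i j D E (C f)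
  have h2 := congrArg C (hflat V i j D E f)
  simp only [curvature, map_sub, map_zsmul, map_zero] at h1 h2
  simp only [anticomm, hC, hsub]
  calc _ = (nabla.cov D (nabla.cov E (C f)) - superSign (i * j) • nabla.cov E (nabla.cov D (C f)) -
        nabla.cov (D.bracket E) (C f)) - (C (nabla.cov D (nabla.cov E f)) -
        superSign (i * j) • C (nabla.cov E (nabla.cov D f)) - C (nabla.cov (D.bracket E) f)) := by
        simp only [smul_add, smul_sub]
        abel
    _ = 0 := by rw [h1, h2, sub_zero]

theorem anticomm_res (A : SuperOneFormOperator F) (nabla : SuperConnection F) {W : Opens M}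
    (hW : W ≤ V) (D : SuperVectorField X V i) (E : SuperVectorField X V j)
    (f : F.obj V) : F.res hW (nabla.anticomm A D E f) =
      nabla.anticomm A (D.restrict hW) (E.restrict hW) (F.res hW f) := by
  simp only [anticomm, map_sub, _root_.map_add, map_zsmul, nabla.cov_res, A.cov_res]
  rfl

theorem wedgeSquare_res (A : SuperOneFormOperator F) {W : Opens M}
    (hW : W ≤ V) (D : SuperVectorField X V i) (E : SuperVectorField X V j)
    (f : F.obj V) : F.res hW (A.wedgeSquare D E f) =
      A.wedgeSquare (D.restrict hW) (E.restrict hW) (F.res hW f) := by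
  simp only [SuperOneFormOperator.wedgeSquare, map_sub, map_zsmul, A.cov_res]

/-- The equivalence of flatness of the pencil with the existence of local potentials with vanishing
wedge square, given that operators which anticommute with the connection have local potentials. -/
theorem isFlatPencil_iff_of_exists_potential (hflat : nabla.IsFlat)
    (hex : (∀ (V : Opens M) (i j : ZMod 2) (D : SuperVectorField X V i)
      (E : SuperVectorField X V j) (f : F.obj V), nabla.anticomm A D E f = 0) →
      ∀ x : M, ∃ U : Opens M, x ∈ U ∧ ∃ B : SuperEnd F U, nabla.IsPotential A B) :
    nabla.IsFlatPencil A ↔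
      (∀ x : M, ∃ U : Opens M, x ∈ U ∧ ∃ B : SuperEnd F U, nabla.IsPotential A B) ∧
      ∀ (U : Opens M) (B : SuperEnd F U), nabla.IsPotential A B → nabla.IsWedgeSquareZero B := by
  rw [isFlatPencil_iff _ _ hflat]
  constructor
  · intro h
    refine ⟨hex fun V i j D E f => (h V i j D E f).1, fun U B hB V hV f i j D E => ?_⟩
    rw [hB.wedgeSquare_eq]
    exact (h V i j D E f).2
  · rintro ⟨h1, h2⟩ V i j D E f
    -- Sections of a sheaf vanish if they vanish locally, and near each point (i) supplies a
    -- potential.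
    constructor <;> refine F.eq_of_locally_eq _ _ fun x hx => ?_ <;>
      obtain ⟨U, hxU, B, hB⟩ := h1 x <;>
      refine ⟨V ⊓ U, inf_le_left, ⟨hx, hxU⟩, ?_⟩
    · rw [anticomm_res, hB.anticomm_eq_zero hflat inf_le_right, map_zero]
    · rw [wedgeSquare_res, ← hB.wedgeSquare_eq inf_le_right, map_zero]
      exact h2 U B hB _ _ _ _ _ _ _

end SuperConnection

end Pencil

/-! ## Coordinate systems -/

section Coordinates

variable {k : Type t} [Field k] [CharZero k] {M : Type u} [TopologicalSpace M]
  {X : SuperSpace.{t, u, v} k M} {F : SuperModule.{t, u, v, w} X}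

namespace SuperVectorField

variable {U V : Opens M} {i j : ZMod 2}

omit [CharZero k] in
theorem toFun_one (D : SuperVectorField X U i) (hV : V ≤ U) : D.toFun V hV 1 = 0 := by
  have h := D.leibniz V hV 1 1
  have h1 : X.tw i (1 : X.obj V) = 1 := by
    obtain rfl | rfl := parity_cases i <;> simp [SuperSpace.tw]
  rw [h1, one_mul, one_mul, mul_one] at h
  exact left_eq_add.1 h

/-- The zero vector field. -/
def zero (X : SuperSpace.{t, u, v} k M) (U : Opens M) (i : ZMod 2) : SuperVectorField X U i where
  toFun _ _ := 0
  res := by simp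
  σ := by simp
  leibniz := by simp

/-- A vector field with its parity written in another way. -/
def ofEq (h : i = j) (D : SuperVectorField X U i) : SuperVectorField X U j where
  toFun := D.toFun
  res := D.res
  σ := by subst h; exact D.σ
  leibniz := by subst h; exact D.leibniz

end SuperVectorField

/-- The parity of the coordinates on a space of dimension `p | q`. -/
def coordParity {p q : ℕ} : Fin p ⊕ Fin q → ZMod 2 := Sum.elim (fun _ => 0) fun _ => 1

/-- Coordinates on an open set, with the dual vector fields; vector fields are determined by their
values on the coordinates. -/
structure SuperCoordinates (X : SuperSpace.{t, u, v} k M) (U : Opens M) (p q : ℕ) where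
  /-- the coordinate functions -/
  coord : Fin p ⊕ Fin q → X.obj U
  /-- the coordinate vector fields -/
  vf : ∀ a : Fin p ⊕ Fin q, SuperVectorField X U (coordParity a)
  σ_coord : ∀ a, X.σ (coord a) = superSign (coordParity a) • coord a
  vf_coord : ∀ a b, (vf a).toFun U le_rfl (coord b) = if a = b then 1 else 0
  ext : ∀ (V : Opens M) (hV : V ≤ U) (i : ZMod 2) (D E : SuperVectorField X V i),
    (∀ a, D.toFun V le_rfl (X.res hV (coord a)) = E.toFun V le_rfl (X.res hV (coord a))) →
    D.toFun = E.toFun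

namespace SuperCoordinates

variable {U V : Opens M} {p q : ℕ} (S : SuperCoordinates X U p q)

omit [CharZero k] in
theorem vf_res_coord (hV : V ≤ U) (a b : Fin p ⊕ Fin q) :
    (S.vf a).toFun V hV (X.res hV (S.coord b)) = if a = b then 1 else 0 := by
  rw [← (S.vf a).res U V le_rfl hV, S.vf_coord]
  split_ifs <;> simp

/-- A form is determined by its values on the coordinate vector fields. -/
theorem form_apply {U' : Opens M} (α : SuperForm1 F U') (hV : V ≤ U) (hV' : V ≤ U') {i : ZMod 2}
    (D : SuperVectorField X V i) : α.toFun V hV' i D =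
      ∑ a, D.toFun V le_rfl (X.res hV (S.coord a)) •
        α.toFun V hV' (coordParity a) ((S.vf a).restrict hV) := by
  -- The field `∑ D(x_a) ∂_a` is assembled term by term together with the value of `α` on it. Each
  -- coefficient has parity `i + |a|`, so each term has parity `i`; `S.ext` then identifies the full
  -- sum with `D`.
  have key : ∀ s : Finset (Fin p ⊕ Fin q), ∃ E : SuperVectorField X V i,
      (∀ b, E.toFun V le_rfl b = ∑ a ∈ s, D.toFun V le_rfl (X.res hV (S.coord a)) *
        (S.vf a).toFun V hV b) ∧
      α.toFun V hV' i E = ∑ a ∈ s, D.toFun V le_rfl (X.res hV (S.coord a)) •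
        α.toFun V hV' (coordParity a) ((S.vf a).restrict hV) := by
    intro s
    induction s using Finset.induction_on with
    | empty =>
      refine ⟨SuperVectorField.zero X V i, fun b => rfl, ?_⟩
      rw [α.congr_zsmul hV' rfl 0 (SuperVectorField.zero X V i) (SuperVectorField.zero X V i)
        (by funext W hW; simp [SuperVectorField.zero])]
      simp
    | insert a s ha ih =>
      obtain ⟨E, hE, hαE⟩ := ih
      have hσ : X.σ (D.toFun V le_rfl (X.res hV (S.coord a))) =
          superSign (i + coordParity a) • D.toFun V le_rfl (X.res hV (S.coord a)) := by
        rw [D.σ, ← X.res_σ, S.σ_coord, map_zsmul, map_zsmul, smul_smul]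
        congr 1
        obtain rfl | rfl := parity_cases i <;> obtain h | h := parity_cases (coordParity a) <;>
          rw [h] <;> rfl
      have hpar : i + coordParity a + coordParity a = i := by
        rw [add_assoc, CharTwo.add_self_eq_zero, add_zero]
      refine ⟨(SuperVectorField.ofEq hpar (((S.vf a).restrict hV).smul _ _ hσ)).add E, ?_, ?_⟩
      · intro b
        rw [Finset.sum_insert ha, ← hE]
        simp [SuperVectorField.add, SuperVectorField.ofEq, SuperVectorField.smul, X.res_self,
          SuperVectorField.restrict]
      · rw [Finset.sum_insert ha, α.map_add, hαE, ← α.map_smul V hV' _ _ _ hσ]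
        congr 1
        exact α.congr hV' hpar.symm _ _ rfl
  obtain ⟨E, hE, hαE⟩ := key Finset.univ
  rw [← hαE]
  refine α.congr hV' rfl _ _ (S.ext V hV i D E fun b => ?_)
  rw [hE]
  simp [S.vf_res_coord]

/-- Coordinate vector fields commute. -/
theorem form_bracket {U' : Opens M} (α : SuperForm1 F U') (hV : V ≤ U) (hV' : V ≤ U')
    (a b : Fin p ⊕ Fin q) :
    α.toFun V hV' _ (((S.vf a).restrict hV).bracket ((S.vf b).restrict hV)) = 0 := by
  rw [S.form_apply α hV hV']
  refine Finset.sum_eq_zero fun c _ => ?_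
  -- The derivatives of the coordinates are the constants 0 and 1, which every vector field kills.
  have : (((S.vf a).restrict hV).bracket ((S.vf b).restrict hV)).toFun V le_rfl
      (X.res hV (S.coord c)) = 0 := by
    simp only [SuperVectorField.bracket, SuperVectorField.restrict, LinearMap.sub_apply,
      LinearMap.comp_apply, LinearMap.smul_apply, S.vf_res_coord]
    split_ifs <;> simp [SuperVectorField.toFun_one]
  rw [this, zero_smul]

/-- Flat even connections on trivial bundles have local primitives of closed endomorphism valued
one-forms in the even directions, near `x`. -/
def HasPrimitives (x : M) : Prop :=
  ∀ (V : Opens M) (hV : V ≤ U), x ∈ V → ∀ (n : ℕ) (Γ C : Fin p → Matrix (Fin n) (Fin n) (X.obj V)),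
    -- The row index is the frame vector being differentiated and coefficients stand on the left.
    -- Hence `∇ᵢ∇ⱼ` has the matrix `∂ᵢΓⱼ + ΓⱼΓᵢ`, with the factors in this order.
    (∀ i j, (Γ j).map ((S.vf (.inl i)).toFun V hV) + Γ j * Γ i =
      (Γ i).map ((S.vf (.inl j)).toFun V hV) + Γ i * Γ j) →
    (∀ i j, (C j).map ((S.vf (.inl i)).toFun V hV) + C j * Γ i + Γ j * C i =
      (C i).map ((S.vf (.inl j)).toFun V hV) + C i * Γ j + Γ i * C j) →
    ∃ (W : Opens M) (hW : W ≤ V), x ∈ W ∧ ∃ b : Matrix (Fin n) (Fin n) (X.obj W),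
      ∀ i, b.map ((S.vf (.inl i)).toFun W (hW.trans hV)) + b * (Γ i).map (X.res hW) =
        (C i).map (X.res hW) + (Γ i).map (X.res hW) * b

end SuperCoordinates

omit [CharZero k] in
/-- Local frames of a locally free sheaf. -/
theorem SuperModule.IsLocallyFree.exists_basis (hF : F.IsLocallyFree) (x : M) :
    ∃ U : Opens M, x ∈ U ∧ ∃ (n : ℕ) (e : Fin n → F.obj U) (par : Fin n → ZMod 2),
      (∀ a, F.σ (e a) = superSign (par a) • e a) ∧ ∀ (V : Opens M) (hV : V ≤ U),
        ∃ b : Module.Basis (Fin n) (X.obj V) (F.obj V), ∀ a, b a = F.res hV (e a) := by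
  obtain ⟨U, hx, n, par, e, hpar, h⟩ := hF x
  refine ⟨U, hx, n, e, par, hpar, fun V hV => ?_⟩
  let L : (Fin n → X.obj V) ≃ₗ[X.obj V] F.obj V :=
    LinearEquiv.ofBijective (Fintype.linearCombination (X.obj V) fun a => F.res hV (e a)) (by
      convert h V hV using 1
      funext c
      rw [Fintype.linearCombination_apply])
  refine ⟨Module.Basis.ofEquivFun L.symm, fun a => ?_⟩
  simp [L, Fintype.linearCombination_apply, Pi.single_apply]

end Coordinates

/-! ## Local potentials -/

section LocalPotential

variable {k : Type t} [Field k] [CharZero k] {M : Type u} [TopologicalSpace M]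
  {X : SuperSpace.{t, u, v} k M} {F : SuperModule.{t, u, v, w} X}

namespace SuperCoordinates

variable {U V : Opens M} {p q : ℕ} (S : SuperCoordinates X U p q)
  (nabla : SuperConnection F) (A : SuperOneFormOperator F)

/-- The bracket term of the curvature drops out for coordinate fields, so flatness becomes
supercommutation of the covariant derivatives. -/
theorem cov_comm (hflat : nabla.IsFlat) (hV : V ≤ U) (a b : Fin p ⊕ Fin q) (f : F.obj V) :
    nabla.cov ((S.vf a).restrict hV) (nabla.cov ((S.vf b).restrict hV) f) =
      superSign (coordParity a * coordParity b) •
        nabla.cov ((S.vf b).restrict hV) (nabla.cov ((S.vf a).restrict hV) f) := by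
  have h := nabla.isFlat_iff.1 hflat V _ _ ((S.vf a).restrict hV) ((S.vf b).restrict hV) f
  have h0 : nabla.cov (((S.vf a).restrict hV).bracket ((S.vf b).restrict hV)) f = 0 :=
    S.form_bracket (nabla.toFun f) hV le_rfl a b
  rwa [SuperConnection.curvature, h0, sub_zero, sub_eq_zero] at h

theorem cov_anticomm (hV : V ≤ U) (a b : Fin p ⊕ Fin q) (f : F.obj V)
    (h : nabla.anticomm A ((S.vf a).restrict hV) ((S.vf b).restrict hV) f = 0) :
    nabla.cov ((S.vf a).restrict hV) (A.cov ((S.vf b).restrict hV) f) +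
        A.cov ((S.vf a).restrict hV) (nabla.cov ((S.vf b).restrict hV) f) =
      superSign (coordParity a * coordParity b) •
        (nabla.cov ((S.vf b).restrict hV) (A.cov ((S.vf a).restrict hV) f) +
          A.cov ((S.vf b).restrict hV) (nabla.cov ((S.vf a).restrict hV) f)) := by
  have h0 : A.cov (((S.vf a).restrict hV).bracket ((S.vf b).restrict hV)) f = 0 :=
    S.form_bracket (A.toFun f) hV le_rfl a b
  rwa [SuperConnection.anticomm, h0, sub_zero, sub_eq_zero] at h

variable {nabla A} in
/-- The condition that `B` is a potential for `A` in the direction of a coordinate. -/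
theorem cov_inl_smul (hV : V ≤ U) (i : Fin p) (a : X.obj V) (f : F.obj V) :
    nabla.cov ((S.vf (.inl i)).restrict hV) (a • f) =
      (S.vf (.inl i)).toFun V hV a • f + a • nabla.cov ((S.vf (.inl i)).restrict hV) f :=
  nabla.cov_smul _ a f

variable {nabla A} in
theorem oneForm_inl_smul (hV : V ≤ U) (i : Fin p) (a : X.obj V) (f : F.obj V) :
    A.cov ((S.vf (.inl i)).restrict hV) (a • f) = a • A.cov ((S.vf (.inl i)).restrict hV) f :=
  A.cov_smul _ a f

variable {n : ℕ}

/-- In an even direction the Leibniz rule has no sign. Functions need not commute, so the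
coefficients of `f` stay to the left of the connection matrix. -/
theorem repr_cov (hV : V ≤ U) (e : Module.Basis (Fin n) (X.obj V) (F.obj V)) (i : Fin p)
    (f : F.obj V) (r : Fin n) : e.repr (nabla.cov ((S.vf (.inl i)).restrict hV) f) r =
      (S.vf (.inl i)).toFun V hV (e.repr f r) +
        ∑ l, e.repr f l * e.repr (nabla.cov ((S.vf (.inl i)).restrict hV) (e l)) r := by
  conv_lhs => rw [← e.sum_repr f]
  have := map_sum (nabla.covHom ((S.vf (.inl i)).restrict hV)) (fun l => e.repr f l • e l)
    Finset.univ
  refine (congrArg (fun g => e.repr g r) this).trans ?_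
  have h2 : ∀ l, nabla.covHom ((S.vf (.inl i)).restrict hV) (e.repr f l • e l) = _ :=
    fun l => S.cov_inl_smul hV i _ _
  simp only [h2, Finset.sum_add_distrib, _root_.map_add, map_sum, _root_.map_smul,
    Finsupp.coe_add, Pi.add_apply, Finsupp.coe_finsetSum, Finset.sum_apply, Finsupp.smul_apply,
    smul_eq_mul, Module.Basis.repr_self]
  congr 1
  rw [Finset.sum_eq_single r (fun l _ hl => by simp [hl]) (by simp)]
  simp

theorem repr_oneForm (hV : V ≤ U) (e : Module.Basis (Fin n) (X.obj V) (F.obj V)) (i : Fin p)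
    (f : F.obj V) (r : Fin n) : e.repr (A.cov ((S.vf (.inl i)).restrict hV) f) r =
        ∑ l, e.repr f l * e.repr (A.cov ((S.vf (.inl i)).restrict hV) (e l)) r := by
  conv_lhs => rw [← e.sum_repr f]
  have := map_sum (A.covHom ((S.vf (.inl i)).restrict hV)) (fun l => e.repr f l • e l)
    Finset.univ
  refine (congrArg (fun g => e.repr g r) this).trans ?_
  have h2 : ∀ l, A.covHom ((S.vf (.inl i)).restrict hV) (e.repr f l • e l) = _ :=
    fun l => S.oneForm_inl_smul hV i _ _
  simp only [h2, map_sum, _root_.map_smul, Finsupp.coe_finsetSum, Finset.sum_apply,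
    Finsupp.smul_apply, smul_eq_mul]

/-- Near every point there is an endomorphism which is a potential for `A` in the even
directions. -/
theorem exists_potential_inl (hflat : nabla.IsFlat)
    (hA : ∀ (V : Opens M) (i j : ZMod 2) (D : SuperVectorField X V i)
      (E : SuperVectorField X V j) (f : F.obj V), nabla.anticomm A D E f = 0)
    {x : M} (hS : S.HasPrimitives x) (hV : V ≤ U) (hx : x ∈ V) (e : Fin n → F.obj V)
    (he : ∀ (W : Opens M) (hW : W ≤ V),
      ∃ b : Module.Basis (Fin n) (X.obj W) (F.obj W), ∀ a, b a = F.res hW (e a)) :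
    ∃ (W : Opens M) (hW : W ≤ V), x ∈ W ∧ ∃ B : F.obj W →ₗ[X.obj W] F.obj W, ∀ i f,
      A.cov ((S.vf (.inl i)).restrict (hW.trans hV)) f =
        nabla.cov ((S.vf (.inl i)).restrict (hW.trans hV)) (B f) -
          B (nabla.cov ((S.vf (.inl i)).restrict (hW.trans hV)) f) := by
  obtain ⟨eV, heV⟩ := he V le_rfl
  let Γ : Fin p → Matrix (Fin n) (Fin n) (X.obj V) := fun i a r =>
    eV.repr (nabla.cov ((S.vf (.inl i)).restrict hV) (eV a)) r
  let C : Fin p → Matrix (Fin n) (Fin n) (X.obj V) := fun i a r =>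
    eV.repr (A.cov ((S.vf (.inl i)).restrict hV) (eV a)) r
  -- On the frame, flatness of `∇` is the zero curvature equation for `Γ`, and `∇A + A∇ = 0` is
  -- closedness of `C`.
  obtain ⟨W, hW, hxW, b, hb⟩ := hS V hV hx n Γ C (fun i j => by
      ext a r
      have h := congrArg (fun g => eV.repr g r) (S.cov_comm nabla hflat hV (.inl i) (.inl j) (eV a))
      have hs : superSign (coordParity (Sum.inl i : Fin p ⊕ Fin q) *
        coordParity (Sum.inl j : Fin p ⊕ Fin q)) = 1 := rfl
      simp only [hs, one_smul] at h
      rw [S.repr_cov nabla hV eV i (nabla.cov _ (eV a)), S.repr_cov nabla hV eV j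
        (nabla.cov _ (eV a))] at h
      simpa only [Matrix.add_apply, Matrix.map_apply, Matrix.mul_apply] using h) (fun i j => by
      ext a r
      have h := congrArg (fun g => eV.repr g r) (S.cov_anticomm nabla A hV (.inl i) (.inl j) (eV a)
        (hA _ _ _ _ _ _))
      have hs : superSign (coordParity (Sum.inl i : Fin p ⊕ Fin q) *
        coordParity (Sum.inl j : Fin p ⊕ Fin q)) = 1 := rfl
      simp only [hs, one_smul, _root_.map_add, Finsupp.coe_add, Pi.add_apply] at h
      rw [S.repr_cov nabla hV eV i (A.cov _ (eV a)), S.repr_cov nabla hV eV j (A.cov _ (eV a)),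
        S.repr_oneForm A hV eV i (nabla.cov _ (eV a)),
        S.repr_oneForm A hV eV j (nabla.cov _ (eV a))] at h
      simpa only [Matrix.add_apply, Matrix.map_apply, Matrix.mul_apply] using h)
  obtain ⟨eW, heW⟩ := he W hW
  have hres : ∀ a, F.res hW (eV a) = eW a := fun a => by rw [heV, heW, F.res_res]
  have hrep : ∀ (g : F.obj V) r, eW.repr (F.res hW g) r = X.res hW (eV.repr g r) := by
    intro g r
    conv_lhs => rw [← eV.sum_repr g]
    simp only [map_sum, F.res_smul, hres]
    simp [Finsupp.single_apply]
  refine ⟨W, hW, hxW, eW.constr ℕ fun a => ∑ l, b a l • eW l, fun i f => ?_⟩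
  set B := eW.constr ℕ fun a => ∑ l, b a l • eW l with hB
  have hBr : ∀ a r, eW.repr (B (eW a)) r = b a r := fun a r => by
    rw [hB, Module.Basis.constr_basis]
    simp [Finsupp.single_apply]
  have key : ∀ a, A.cov ((S.vf (.inl i)).restrict (hW.trans hV)) (eW a) =
        nabla.cov ((S.vf (.inl i)).restrict (hW.trans hV)) (B (eW a)) -
          B (nabla.cov ((S.vf (.inl i)).restrict (hW.trans hV)) (eW a)) := by
    intro a
    rw [eq_sub_iff_add_eq]
    refine eW.repr.injective (Finsupp.ext fun r => ?_)
    have h := congrFun (congrFun (hb i) a) r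
    simp only [Matrix.add_apply, Matrix.map_apply, Matrix.mul_apply] at h
    have hΓ : ∀ a r, X.res hW (Γ i a r) =
        eW.repr (nabla.cov ((S.vf (.inl i)).restrict (hW.trans hV)) (eW a)) r := fun a r => by
      rw [← hrep, nabla.cov_res, hres]
      rfl
    have hC : ∀ a r, X.res hW (C i a r) =
        eW.repr (A.cov ((S.vf (.inl i)).restrict (hW.trans hV)) (eW a)) r := fun a r => by
      rw [← hrep, A.cov_res, hres]
      rfl
    rw [S.repr_cov nabla (hW.trans hV)]
    simp only [hBr]
    rw [_root_.map_add, Finsupp.add_apply]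
    rw [← eW.sum_repr (nabla.cov ((S.vf (.inl i)).restrict (hW.trans hV)) (eW a))]
    simp only [hΓ, hC] at h
    rw [h, map_sum, map_sum, Finsupp.coe_finsetSum, Finset.sum_apply]
    simp only [_root_.map_smul, Finsupp.smul_apply, hBr, smul_eq_mul]
  -- The derivative terms in `[∇ᵢ, B](a f)` cancel, so both sides are linear over functions and the
  -- frame suffices.
  have hext : ∀ f, (A.covHom ((S.vf (.inl i)).restrict (hW.trans hV))) f =
      (nabla.covHom ((S.vf (.inl i)).restrict (hW.trans hV)) (B f) -
        B (nabla.covHom ((S.vf (.inl i)).restrict (hW.trans hV)) f)) := by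
    intro f
    rw [← eW.sum_repr f]
    simp only [map_sum, ← Finset.sum_sub_distrib]
    refine Finset.sum_congr rfl fun l _ => ?_
    refine (S.oneForm_inl_smul (hW.trans hV) i _ _).trans ?_
    rw [key l, _root_.map_smul]
    have h1 : ∀ (a : X.obj W) f, nabla.covHom ((S.vf (.inl i)).restrict (hW.trans hV)) (a • f) =
      _ := fun a f => S.cov_inl_smul (hW.trans hV) i a f
    rw [h1, h1, _root_.map_add, _root_.map_smul, _root_.map_smul, smul_sub]
    abel
  exact hext f

/-- The average of an endomorphism and its parity conjugate. -/
theorem exists_potential_inl_even (hV : V ≤ U) (B : F.obj V →ₗ[X.obj V] F.obj V)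
    (hB : ∀ i f, A.cov ((S.vf (.inl i)).restrict hV) f =
        nabla.cov ((S.vf (.inl i)).restrict hV) (B f) -
          B (nabla.cov ((S.vf (.inl i)).restrict hV) f)) :
    ∃ B : F.obj V →ₗ[X.obj V] F.obj V, (∀ f, B (F.σ f) = F.σ (B f)) ∧
      ∀ i f, A.cov ((S.vf (.inl i)).restrict hV) f =
        nabla.cov ((S.vf (.inl i)).restrict hV) (B f) -
          B (nabla.cov ((S.vf (.inl i)).restrict hV) f) := by
  let B' : F.obj V →ₗ[X.obj V] F.obj V :=
    { toFun := fun f => F.σ (B (F.σ f))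
      map_add' := fun f g => by simp
      map_smul' := fun a f => by simp [F.σ_smul, X.σ_σ] }
  have hB' : ∀ f, B' f = F.σ (B (F.σ f)) := fun f => rfl
  have hN : ∀ (i : Fin p) (f : F.obj V), nabla.cov ((S.vf (.inl i)).restrict hV) (F.σ f) =
      F.σ (nabla.cov ((S.vf (.inl i)).restrict hV) f) := fun i f => by
    rw [nabla.cov_σ]; exact one_smul _ _
  have hAσ : ∀ (i : Fin p) (f : F.obj V), A.cov ((S.vf (.inl i)).restrict hV) (F.σ f) =
      F.σ (A.cov ((S.vf (.inl i)).restrict hV) f) := fun i f => by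
    rw [A.cov_σ]; exact one_smul _ _
  -- In even directions `A` and `∇` commute with `σ`; hence `B' = σBσ` is a potential too, and so is
  -- the average, which commutes with `σ`.
  refine ⟨(2 : k)⁻¹ • (B + B'), fun f => ?_, fun i f => ?_⟩
  · simp only [LinearMap.smul_apply, LinearMap.add_apply, hB', F.σ_σ, _root_.map_smul,
      _root_.map_add]
    rw [add_comm]
  · have h1 := hB i f
    have h2 : A.cov ((S.vf (.inl i)).restrict hV) f =
        nabla.cov ((S.vf (.inl i)).restrict hV) (B' f) -
          B' (nabla.cov ((S.vf (.inl i)).restrict hV) f) := by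
      have := congrArg F.σ (hB i (F.σ f))
      rw [hAσ, F.σ_σ, hN, map_sub, ← hN] at this
      rw [this, hB', hB']
    have h3 : (2 : k) • A.cov ((S.vf (.inl i)).restrict hV) f = (2 : k) •
        (nabla.cov ((S.vf (.inl i)).restrict hV) (((2 : k)⁻¹ • (B + B')) f) -
          ((2 : k)⁻¹ • (B + B')) (nabla.cov ((S.vf (.inl i)).restrict hV) f)) := by
      rw [LinearMap.smul_apply, LinearMap.smul_apply, nabla.cov_base_smul, ← smul_sub, smul_smul,
        mul_inv_cancel₀ two_ne_zero, one_smul, two_smul, LinearMap.add_apply, LinearMap.add_apply,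
        nabla.cov_add]
      nth_rewrite 1 [h1]
      rw [h2]
      abel
    have h4 := congrArg (fun g => (2 : k)⁻¹ • g) h3
    simpa only [smul_smul, inv_mul_cancel₀ (two_ne_zero' k), one_smul] using h4

/-- An even endomorphism which is a potential for `A` in the even directions can be corrected to
be a potential in all coordinate directions. -/
theorem exists_potential_coord (hflat : nabla.IsFlat)
    (hA : ∀ (V : Opens M) (i j : ZMod 2) (D : SuperVectorField X V i)
      (E : SuperVectorField X V j) (f : F.obj V), nabla.anticomm A D E f = 0)
    (hV : V ≤ U) (B : F.obj V →ₗ[X.obj V] F.obj V) (hBσ : ∀ f, B (F.σ f) = F.σ (B f))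
    (hB : ∀ i f, A.cov ((S.vf (.inl i)).restrict hV) f =
        nabla.cov ((S.vf (.inl i)).restrict hV) (B f) -
          B (nabla.cov ((S.vf (.inl i)).restrict hV) f)) (s : Finset (Fin q)) :
    ∃ B : F.obj V →ₗ[X.obj V] F.obj V, (∀ f, B (F.σ f) = F.σ (B f)) ∧
      ∀ a, (∀ j, a = .inr j → j ∈ s) → ∀ f, A.cov ((S.vf a).restrict hV) f =
        nabla.cov ((S.vf a).restrict hV) (B f) - B (nabla.cov ((S.vf a).restrict hV) f) := by
  induction s using Finset.induction_on with
  | empty =>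
    refine ⟨B, hBσ, fun a ha => ?_⟩
    rcases a with i | j
    · exact hB i
    · exact absurd (ha j rfl) (Finset.notMem_empty j)
  | insert j s hj ih =>
    obtain ⟨B, hBσ, hB⟩ := ih
    let N : Fin p ⊕ Fin q → F.obj V →+ F.obj V := fun a => nabla.covHom ((S.vf a).restrict hV)
    -- `R a` is the error of `B` in the direction `a`. It is linear over functions up to the sign of
    -- parity `|a|`, and it is closed, since `A` is closed and `[∇, B]` is closed by flatness.
    let R : Fin p ⊕ Fin q → F.obj V →+ F.obj V := fun a =>
      A.covHom ((S.vf a).restrict hV) - ((N a).comp B.toAddMonoidHom - B.toAddMonoidHom.comp (N a))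
    have hNs : ∀ a (c : X.obj V) f, N a (c • f) = (S.vf a).toFun V hV c • f +
      X.tw (coordParity a) c • N a f := fun a c f => nabla.cov_smul _ c f
    have hRdef : ∀ a f, R a f = A.cov ((S.vf a).restrict hV) f - (N a (B f) - B (N a f)) :=
      fun a f => rfl
    have hRs : ∀ a (c : X.obj V) f, R a (c • f) = X.tw (coordParity a) c • R a f := by
      intro a c f
      rw [hRdef, A.cov_smul, _root_.map_smul, hNs, hNs, hRdef, _root_.map_add, _root_.map_smul,
        _root_.map_smul]
      simp only [smul_sub]
      abel
    have hRσ : ∀ a f, R a (F.σ f) = superSign (coordParity a) • F.σ (R a f) := by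
      intro a f
      have hNσ : ∀ f, N a (F.σ f) = superSign (coordParity a) • F.σ (N a f) :=
        nabla.cov_σ ((S.vf a).restrict hV)
      rw [hRdef, A.cov_σ, hBσ, hNσ, hNσ, map_zsmul, hBσ, hRdef]
      simp only [smul_sub, map_sub]
    have hcomm : ∀ a b f, N a (N b f) =
        superSign (coordParity a * coordParity b) • N b (N a f) :=
      fun a b f => S.cov_comm nabla hflat hV a b f
    have hR : ∀ a b f, N a (R b f) + R a (N b f) =
        superSign (coordParity a * coordParity b) • (N b (R a f) + R b (N a f)) := by
      intro a b f
      have h1 := S.cov_anticomm nabla A hV a b f (hA _ _ _ _ _ _)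
      have h2 := hcomm a b (B f)
      have h3 := congrArg B (hcomm a b f)
      have hN : ∀ a f, nabla.cov ((S.vf a).restrict hV) f = N a f := fun _ _ => rfl
      rw [map_zsmul] at h3
      simp only [hN] at h1
      simp only [hRdef, map_sub]
      calc _ = N a (A.cov ((S.vf b).restrict hV) f) + A.cov ((S.vf a).restrict hV) (N b f) -
            (N a (N b (B f)) - B (N a (N b f))) := by abel
        _ = _ := by
          rw [h1, h2, h3, ← smul_sub, ← smul_sub]
          congr 1
          abel
    have hR0 : ∀ a, (∀ j, a = .inr j → j ∈ s) → ∀ f, R a f = 0 := fun a ha f => by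
      rw [hRdef, hB a ha f]
      exact sub_self _
    -- The correction is `Q = ξ_j R_j`. From `∂_j ξ_j = 1` one gets `[∇_j, Q] = R_j - ξ_j(∇_j R_j +
    -- R_j ∇_j)`, and the last bracket vanishes.
    let Q : F.obj V →ₗ[X.obj V] F.obj V :=
      { toFun := fun f => X.res hV (S.coord (.inr j)) • R (.inr j) f
        map_add' := fun f g => by rw [_root_.map_add, smul_add]
        map_smul' := fun c f => by
          have hξ : X.σ (X.res hV (S.coord (.inr j))) =
              superSign 1 • X.res hV (S.coord (.inr j)) := by
            rw [← X.res_σ, S.σ_coord, map_zsmul]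
            rfl
          rw [hRs, smul_smul, X.mul_eq_tw_mul 1 _ _ hξ, mul_smul]
          simp [coordParity, SuperSpace.tw, X.σ_σ] }
    have hQ : ∀ f, Q f = X.res hV (S.coord (.inr j)) • R (.inr j) f := fun f => rfl
    have hξσ : X.σ (X.res hV (S.coord (.inr j))) = - X.res hV (S.coord (.inr j)) := by
      rw [← X.res_σ, S.σ_coord, map_zsmul]
      simp [coordParity, superSign]
    have hQN : ∀ a f, (∀ j', a = .inr j' → j' ∈ insert j s) →
        N a (Q f) - Q (N a f) = if a = .inr j then R a f else 0 := by
      intro a f ha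
      have htw : X.tw (coordParity a) (X.res hV (S.coord (.inr j))) =
          superSign (coordParity a) • X.res hV (S.coord (.inr j)) := by
        obtain h | h := parity_cases (coordParity a) <;> rw [h] <;>
          simp [SuperSpace.tw, superSign, hξσ]
      have hrel := hR a (.inr j) f
      have hone : coordParity a * coordParity (.inr j : Fin p ⊕ Fin q) = coordParity a := mul_one _
      rw [hone] at hrel
      have hsq : ∀ g : F.obj V, superSign (coordParity a) • superSign (coordParity a) • g = g :=
        fun g => by
        rw [smul_smul]
        obtain h | h := parity_cases (coordParity a) <;> rw [h] <;> simp [superSign]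
      rw [hQ, hQ, hNs, S.vf_res_coord, htw, smul_assoc, ← smul_comm]
      split_ifs with haj
      · subst haj
        -- For the odd direction `j` taken twice, closedness says that `∇_j R_j + R_j ∇_j` equals
        -- its own negative.
        have h2 : (2 : k) • (N (.inr j) (R (.inr j) f) + R (.inr j) (N (.inr j) f)) = 0 := by
          rw [two_smul]
          nth_rewrite 1 [hrel]
          simp only [coordParity, superSign, Sum.elim_inr, one_ne_zero, if_false, neg_one_smul]
          exact neg_add_cancel _
        have h3 : N (.inr j) (R (.inr j) f) = - R (.inr j) (N (.inr j) f) := by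
          rw [eq_neg_iff_add_eq_zero]
          exact (smul_eq_zero.1 h2).resolve_left two_ne_zero
        rw [one_smul, h3]
        simp [coordParity, superSign]
      -- In a direction `a` already settled `R a = 0`, and closedness says that `∇_a` supercommutes
      -- with `R_j`. As `∂_a ξ_j = 0`, the correction leaves this direction unchanged.
      · have h0 := hR0 a (fun j' hj' => by
          rcases Finset.mem_insert.1 (ha j' hj') with rfl | h
          · exact absurd hj' haj
          · exact h)
        rw [h0, h0, map_zero, add_zero, zero_add] at hrel
        rw [hrel, hsq, zero_smul, zero_add, sub_self]
    refine ⟨B + Q, fun f => ?_, fun a ha f => ?_⟩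
    · rw [LinearMap.add_apply, LinearMap.add_apply, hBσ, _root_.map_add, hQ, hQ, hRσ, F.σ_smul, hξσ]
      simp [coordParity, superSign]
    · have h1 := hQN a f ha
      have h2 := hRdef a f
      have hgoal : nabla.cov ((S.vf a).restrict hV) ((B + Q) f) -
          (B + Q) (nabla.cov ((S.vf a).restrict hV) f) =
          (N a (B f) - B (N a f)) + (N a (Q f) - Q (N a f)) := by
        rw [LinearMap.add_apply, LinearMap.add_apply, nabla.cov_add]
        change _ = (nabla.cov _ _ - B (nabla.cov _ f)) + (nabla.cov _ _ - Q (nabla.cov _ f))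
        abel
      rw [hgoal, h1]
      split_ifs with haj
      · rw [h2]
        abel
      · have h0 := hR0 a (fun j' hj' => by
          rcases Finset.mem_insert.1 (ha j' hj') with rfl | h
          · exact absurd hj' haj
          · exact h) f
        rw [h2, sub_eq_zero] at h0
        rw [h0, add_zero]

end SuperCoordinates

end LocalPotential

/-! ### From an endomorphism of sections over one open set to a potential on the sheaf -/

section LocalPotential

variable {k : Type t} [Field k] [CharZero k] {M : Type u} [TopologicalSpace M]
  {X : SuperSpace.{t, u, v} k M} {F : SuperModule.{t, u, v, w} X}

omit [CharZero k] in
/-- An even endomorphism of the sections of a free sheaf extends to an even endomorphism of the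
sheaf. -/
theorem SuperModule.exists_superEnd {W : Opens M} {n : ℕ} (e : Fin n → F.obj W)
    (par : Fin n → ZMod 2) (hpar : ∀ a, F.σ (e a) = superSign (par a) • e a)
    (he : ∀ (V : Opens M) (hV : V ≤ W),
      ∃ b : Module.Basis (Fin n) (X.obj V) (F.obj V), ∀ a, b a = F.res hV (e a))
    (B : F.obj W →ₗ[X.obj W] F.obj W) (hBσ : ∀ f, B (F.σ f) = F.σ (B f)) :
    ∃ B' : SuperEnd F W, (∀ f, B'.toFun W le_rfl f = B f) ∧
      (∀ V hV (a : X.obj V) f, B'.toFun V hV (a • f) = a • B'.toFun V hV f) ∧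
      ∀ V hV f, B'.toFun V hV (F.σ f) = F.σ (B'.toFun V hV f) := by
  choose b hb using he
  let T : ∀ (V : Opens M) (hV : V ≤ W), F.obj V →ₗ[X.obj V] F.obj V := fun V hV =>
    (b V hV).constr ℕ fun a => F.res hV (B (e a))
  have hT : ∀ V hV a, T V hV (b V hV a) = F.res hV (B (e a)) := fun V hV a =>
    Module.Basis.constr_basis _ _ _ _
  have hσ : ∀ V hV f, T V hV (F.σ f) = F.σ (T V hV f) := by
    intro V hV f
    rw [← (b V hV).sum_repr f]
    simp only [map_sum, F.σ_smul, _root_.map_smul, hT]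
    refine Finset.sum_congr rfl fun a _ => ?_
    have h1 : F.σ (b V hV a) = superSign (par a) • b V hV a := by
      rw [hb, ← F.res_σ, hpar, map_zsmul]
    rw [h1, map_zsmul, hT, ← F.res_σ, ← hBσ, hpar, map_zsmul, map_zsmul]
  -- Since `T` is even, conjugating it with `σ` changes nothing, and the sign rule of `SuperEnd`
  -- reduces to linearity.
  have htw : ∀ V hV (l : ZMod 2) f, F.tw l (T V hV (F.tw l f)) = T V hV f := by
    intro V hV l f
    obtain rfl | rfl := parity_cases l <;> simp [SuperModule.tw, hσ, F.σ_σ]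
  have hres : ∀ V V' hV (hV' : V' ≤ V) f,
      F.res hV' (T V hV f) = T V' (hV'.trans hV) (F.res hV' f) := by
    intro V V' hV hV' f
    rw [← (b V hV).sum_repr f]
    simp only [map_sum, F.res_smul, _root_.map_smul, hT]
    refine Finset.sum_congr rfl fun a _ => ?_
    have h1 : F.res hV' (b V hV a) = b V' (hV'.trans hV) a := by rw [hb, hb, F.res_res]
    rw [h1, hT, F.res_res]
  refine ⟨⟨fun V hV => (T V hV).restrictScalars k, hres, fun V hV l a _ f => ?_⟩, fun f => ?_,
    fun V hV a f => (T V hV).map_smul a f, hσ⟩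
  · rw [LinearMap.restrictScalars_apply, LinearMap.restrictScalars_apply, htw, _root_.map_smul]
  · have : T W le_rfl = B := (b W le_rfl).ext fun a => by rw [hT, F.res_self, hb, F.res_self]
    exact LinearMap.congr_fun this f

namespace SuperCoordinates

variable {U : Opens M} {p q : ℕ} (S : SuperCoordinates X U p q)
  (nabla : SuperConnection F) (A : SuperOneFormOperator F)

/-- An even endomorphism is a potential as soon as it is one on a frame in the directions of the
coordinates. -/
theorem isPotential_of_coord {W : Opens M} (hW : W ≤ U) {n : ℕ} (e : Fin n → F.obj W)
    (he : ∀ (V : Opens M) (hV : V ≤ W),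
      ∃ b : Module.Basis (Fin n) (X.obj V) (F.obj V), ∀ a, b a = F.res hV (e a))
    (B : SuperEnd F W)
    (hlin : ∀ V hV (a : X.obj V) f, B.toFun V hV (a • f) = a • B.toFun V hV f)
    (hσ : ∀ V hV f, B.toFun V hV (F.σ f) = F.σ (B.toFun V hV f))
    (hB : ∀ a f, A.cov ((S.vf a).restrict hW) f =
      nabla.cov ((S.vf a).restrict hW) (B.toFun W le_rfl f) -
        B.toFun W le_rfl (nabla.cov ((S.vf a).restrict hW) f)) : nabla.IsPotential A B := by
  intro V hV f
  ext V' hV' i D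
  have hd : (nabla.derivEnd B V hV f).toFun V' hV' i D =
      nabla.cov D (B.toFun V' (hV'.trans hV) (F.res hV' f)) -
        B.toFun V' (hV'.trans hV) (nabla.cov D (F.res hV' f)) := by
    change (nabla.toFun (B.toFun V hV f)).toFun V' hV' i D -
      F.tw i (B.toFun V' _ (F.tw i ((nabla.toFun f).toFun V' hV' i D))) = _
    rw [nabla.toFun_eq_cov, nabla.toFun_eq_cov, B.map_res]
    obtain rfl | rfl := parity_cases i <;> simp [SuperModule.tw, hσ, F.σ_σ]
  rw [hd, A.toFun_eq_cov]
  generalize F.res hV' f = g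
  replace hV' := hV'.trans hV
  -- On smaller open sets the identity is inherited on the restricted frame. It extends to all
  -- sections because the derivative terms in `[∇_a, B]` cancel.
  have hcoord : ∀ a g, A.cov ((S.vf a).restrict (hV'.trans hW)) g =
      nabla.cov ((S.vf a).restrict (hV'.trans hW)) (B.toFun V' hV' g) -
        B.toFun V' hV' (nabla.cov ((S.vf a).restrict (hV'.trans hW)) g) := by
    intro a g
    obtain ⟨b, hb⟩ := he V' hV'
    let N := nabla.covHom ((S.vf a).restrict (hV'.trans hW))
    let L := A.covHom ((S.vf a).restrict (hV'.trans hW))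
    change L g = N (B.toFun V' hV' g) - B.toFun V' hV' (N g)
    rw [← b.sum_repr g]
    simp only [map_sum, ← Finset.sum_sub_distrib]
    refine Finset.sum_congr rfl fun l _ => ?_
    have h1 : L (b l) = N (B.toFun V' hV' (b l)) - B.toFun V' hV' (N (b l)) := by
      have h2 := congrArg (F.res hV') (hB a (e l))
      rw [map_sub, A.cov_res, nabla.cov_res, B.map_res, B.map_res, nabla.cov_res, ← hb] at h2
      exact h2
    have hN : ∀ c g, N (c • g) = _ := nabla.cov_smul ((S.vf a).restrict (hV'.trans hW))
    have hL : ∀ c g, L (c • g) = _ := A.cov_smul ((S.vf a).restrict (hV'.trans hW))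
    rw [hL, hlin, hN, hN, _root_.map_add, hlin, hlin]
    change _ • L (b l) = _ + _ • N _ - (_ + _ • B.toFun V' hV' (N (b l)))
    rw [h1, smul_sub]
    abel
  -- All three covariant terms expand over the coordinate fields with the same coefficients
  -- `D(x_a)`, which pass through the linear map `B`.
  have e1 := S.form_apply (A.toFun g) (hV'.trans hW) le_rfl D
  have e2 := S.form_apply (nabla.toFun (B.toFun V' hV' g)) (hV'.trans hW) le_rfl D
  have e3 := S.form_apply (nabla.toFun g) (hV'.trans hW) le_rfl D
  change A.cov D g = ∑ a, _ • A.cov _ g at e1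
  change nabla.cov D _ = ∑ a, _ • nabla.cov _ _ at e2
  change nabla.cov D _ = ∑ a, _ • nabla.cov _ _ at e3
  rw [e1, e2, e3, map_sum, ← Finset.sum_sub_distrib]
  refine Finset.sum_congr rfl fun a _ => ?_
  rw [hcoord, hlin, smul_sub]

/-- An operator which anticommutes with a flat connection has local potentials. -/
theorem exists_isPotential (hflat : nabla.IsFlat) (hF : F.IsLocallyFree)
    (hA : ∀ (V : Opens M) (i j : ZMod 2) (D : SuperVectorField X V i)
      (E : SuperVectorField X V j) (f : F.obj V), nabla.anticomm A D E f = 0)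
    {x : M} (hx : x ∈ U) (hS : S.HasPrimitives x) :
    ∃ V : Opens M, x ∈ V ∧ ∃ B : SuperEnd F V, nabla.IsPotential A B := by
  obtain ⟨U', hx', n, e, par, hpar, he⟩ := hF.exists_basis x
  have he' : ∀ (V : Opens M) (hV : V ≤ U'), ∀ (W : Opens M) (hW : W ≤ V),
      ∃ b : Module.Basis (Fin n) (X.obj W) (F.obj W), ∀ a, b a = F.res hW (F.res hV (e a)) :=
    fun V hV W hW => by
      simp only [F.res_res]
      exact he W (hW.trans hV)
  obtain ⟨W, hW, hxW, B, hB⟩ := S.exists_potential_inl nabla A hflat hA hS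
    (inf_le_left : U ⊓ U' ≤ U) ⟨hx, hx'⟩ _ (he' _ inf_le_right)
  obtain ⟨B, hBσ, hB⟩ := S.exists_potential_inl_even nabla A _ B hB
  obtain ⟨B, hBσ, hB⟩ := S.exists_potential_coord nabla A hflat hA _ B hBσ hB Finset.univ
  have hWU' := hW.trans (inf_le_right : U ⊓ U' ≤ U')
  obtain ⟨B', hB', hlin, hσ⟩ := SuperModule.exists_superEnd (fun a => F.res hWU' (e a)) par
    (fun a => by rw [← F.res_σ, hpar, map_zsmul]) (he' W hWU') B hBσ
  refine ⟨W, hxW, B', S.isPotential_of_coord nabla A (hW.trans inf_le_left) _ (he' W hWU') B' hlin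
    hσ fun a f => ?_⟩
  rw [hB', hB']
  exact hB a (fun j _ => Finset.mem_univ j) f

end SuperCoordinates

variable {nabla : SuperConnection F} {A : SuperOneFormOperator F}

/-- The characterization of pencils of flat connections, for spaces with local coordinates in which
closed even one-forms have primitives. -/
theorem isFlatPencil_iff_of_coordinates
    (hX : ∀ x : M, ∃ (U : Opens M) (p q : ℕ) (S : SuperCoordinates X U p q),
      x ∈ U ∧ S.HasPrimitives x) (hF : F.IsLocallyFree) (hflat : nabla.IsFlat) :
    nabla.IsFlatPencil A ↔
      (∀ x : M, ∃ U : Opens M, x ∈ U ∧ ∃ B : SuperEnd F U, nabla.IsPotential A B) ∧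
      ∀ (U : Opens M) (B : SuperEnd F U), nabla.IsPotential A B → nabla.IsWedgeSquareZero B :=
  SuperConnection.isFlatPencil_iff_of_exists_potential hflat fun hA x => by
    obtain ⟨U, p, q, S, hx, hS⟩ := hX x
    exact S.exists_isPotential nabla A hflat hF hA hx hS

end LocalPotential

/-! ## Superalgebras of the form `R ⊗ Λ` -/

namespace Grassmann

variable {k : Type t} [Field k] {q : ℕ}

theorem σ_ι (v : Fin q → k) : Grassmann.σ k q (ExteriorAlgebra.ι k v) = -ExteriorAlgebra.ι k v := by
  rw [Grassmann.σ, ExteriorAlgebra.map_apply_ι]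
  simp

/-- The derivative with respect to an odd coordinate. -/
noncomputable def deriv (j : Fin q) : Grassmann k q →ₗ[k] Grassmann k q :=
  CliffordAlgebra.contractLeft (LinearMap.proj j : Module.Dual k (Fin q → k))

theorem deriv_ι_mul (j : Fin q) (v : Fin q → k) (b : Grassmann k q) :
    deriv j (ExteriorAlgebra.ι k v * b) = v j • b - ExteriorAlgebra.ι k v * deriv j b :=
  CliffordAlgebra.contractLeft_ι_mul _ _ _

theorem deriv_algebraMap (j : Fin q) (c : k) : deriv j (algebraMap k (Grassmann k q) c) = 0 :=
  CliffordAlgebra.contractLeft_algebraMap _ _ _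

theorem deriv_ι (j : Fin q) (v : Fin q → k) :
    deriv j (ExteriorAlgebra.ι k v) = algebraMap k (Grassmann k q) (v j) :=
  CliffordAlgebra.contractLeft_ι _ _ _

/-- The contraction rule is this identity when `a` is a generator, and the identity is stable under
products and sums in `a`. -/
theorem deriv_mul (j : Fin q) (a b : Grassmann k q) :
    deriv j (a * b) = deriv j a * b + Grassmann.σ k q a * deriv j b := by
  induction a using ExteriorAlgebra.induction generalizing b with
  | algebraMap c =>
    rw [deriv_algebraMap, AlgHom.commutes, ← Algebra.smul_def, ← Algebra.smul_def, map_smul]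
    simp
  | ι v =>
    rw [deriv_ι_mul, deriv_ι, σ_ι, ← Algebra.smul_def]
    noncomm_ring
  | mul x y hx hy =>
    rw [mul_assoc, hx, hy, hx, map_mul]
    noncomm_ring
  | add x y hx hy =>
    rw [add_mul, map_add, hx, hy, map_add, map_add]
    noncomm_ring

theorem σ_deriv (j : Fin q) (a : Grassmann k q) :
    Grassmann.σ k q (deriv j a) = -deriv j (Grassmann.σ k q a) := by
  induction a using ExteriorAlgebra.induction with
  | algebraMap c => simp [deriv_algebraMap]
  | ι v => rw [deriv_ι, σ_ι, map_neg, deriv_ι, AlgHom.commutes, neg_neg]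
  | mul x y hx hy =>
    rw [deriv_mul, map_add, map_mul, map_mul, map_mul, deriv_mul, hx, hy]
    noncomm_ring
  | add x y hx hy => rw [map_add, map_add, hx, hy, map_add, map_add, neg_add]

/-- The odd coordinates. -/
noncomputable def odd (j : Fin q) : Grassmann k q := ExteriorAlgebra.ι k (Pi.single j 1)

theorem ι_eq_sum (v : Fin q → k) : ExteriorAlgebra.ι k v = ∑ j, v j • odd j := by
  conv_lhs => rw [pi_eq_sum_univ' v]
  rw [map_sum]
  refine Finset.sum_congr rfl fun j _ => ?_
  rw [map_smul, odd]

end Grassmann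

namespace SuperTensor

variable {k : Type t} [Field k] {q : ℕ} {R : Type v} [CommRing R] [Algebra k R]
  {R' : Type w} [CommRing R'] [Algebra k R']

/-- The parity involution of `R ⊗ Λ`. -/
noncomputable abbrev σ (k : Type t) [Field k] (q : ℕ) (R : Type v) [CommRing R] [Algebra k R] :
    R ⊗[k] Grassmann k q →ₐ[k] R ⊗[k] Grassmann k q :=
  Algebra.TensorProduct.map (AlgHom.id k R) (Grassmann.σ k q)

/-- The extension of a derivation of `R` to `R ⊗ Λ`. -/
noncomputable abbrev even (q : ℕ) (δ : R →ₗ[k] R) :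
    R ⊗[k] Grassmann k q →ₗ[k] R ⊗[k] Grassmann k q :=
  TensorProduct.map δ LinearMap.id

/-- The derivative of `R ⊗ Λ` with respect to an odd coordinate. -/
noncomputable abbrev odd (R : Type v) [CommRing R] [Algebra k R] (j : Fin q) :
    R ⊗[k] Grassmann k q →ₗ[k] R ⊗[k] Grassmann k q :=
  TensorProduct.map LinearMap.id (Grassmann.deriv j)

theorem even_mul {δ : R →ₗ[k] R} (hδ : ∀ a b, δ (a * b) = δ a * b + a * δ b)
    (x y : R ⊗[k] Grassmann k q) : even q δ (x * y) = even q δ x * y + x * even q δ y := by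
  induction x using TensorProduct.induction_on with
  | zero => simp
  | add x x' hx hx' => rw [add_mul, map_add, hx, hx', map_add]; noncomm_ring
  | tmul a c =>
    induction y using TensorProduct.induction_on with
    | zero => simp
    | add y y' hy hy' => rw [mul_add, map_add, hy, hy', map_add]; noncomm_ring
    | tmul b d => simp [hδ, TensorProduct.add_tmul]

theorem odd_mul (j : Fin q) (x y : R ⊗[k] Grassmann k q) :
    odd R j (x * y) = odd R j x * y + σ k q R x * odd R j y := by
  induction x using TensorProduct.induction_on with
  | zero => simp
  | add x x' hx hx' => rw [add_mul, map_add, hx, hx', map_add, map_add]; noncomm_ring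
  | tmul a c =>
    induction y using TensorProduct.induction_on with
    | zero => simp
    | add y y' hy hy' => rw [mul_add, map_add, hy, hy', map_add]; noncomm_ring
    | tmul b d => simp [Grassmann.deriv_mul, TensorProduct.tmul_add]

theorem σ_even (δ : R →ₗ[k] R) (x : R ⊗[k] Grassmann k q) :
    σ k q R (even q δ x) = even q δ (σ k q R x) := by
  induction x using TensorProduct.induction_on with
  | zero => simp
  | add x y hx hy => rw [map_add, map_add, hx, hy, map_add, map_add]
  | tmul a c => simp

theorem σ_odd (j : Fin q) (x : R ⊗[k] Grassmann k q) :
    σ k q R (odd R j x) = -odd R j (σ k q R x) := by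
  induction x using TensorProduct.induction_on with
  | zero => simp
  | add x y hx hy => rw [map_add, map_add, hx, hy, map_add, map_add, neg_add]
  | tmul a c => simp [Grassmann.σ_deriv, TensorProduct.tmul_neg]

theorem map_even (r : R →ₐ[k] R') {δ : R →ₗ[k] R} {δ' : R' →ₗ[k] R'}
    (h : ∀ a, r (δ a) = δ' (r a)) (x : R ⊗[k] Grassmann k q) :
    Algebra.TensorProduct.map r (AlgHom.id k _) (even q δ x) =
      even q δ' (Algebra.TensorProduct.map r (AlgHom.id k _) x) := by
  induction x using TensorProduct.induction_on with
  | zero => simp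
  | add x y hx hy => rw [map_add, map_add, hx, hy, map_add, map_add]
  | tmul a c => simp [h]

theorem map_odd (r : R →ₐ[k] R') (j : Fin q) (x : R ⊗[k] Grassmann k q) :
    Algebra.TensorProduct.map r (AlgHom.id k _) (odd R j x) =
      odd R' j (Algebra.TensorProduct.map r (AlgHom.id k _) x) := by
  induction x using TensorProduct.induction_on with
  | zero => simp
  | add x y hx hy => rw [map_add, map_add, hx, hy, map_add, map_add]
  | tmul a c => simp

/-- A superderivation of `R ⊗ Λ` is determined by its values on `R` and on the odd coordinates. -/
theorem superderivation_ext (τ : R ⊗[k] Grassmann k q → R ⊗[k] Grassmann k q)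
    (D E : R ⊗[k] Grassmann k q →ₗ[k] R ⊗[k] Grassmann k q)
    (hD : ∀ a b, D (a * b) = D a * b + τ a * D b) (hE : ∀ a b, E (a * b) = E a * b + τ a * E b)
    (hR : ∀ r : R, D (r ⊗ₜ 1) = E (r ⊗ₜ 1))
    (hΛ : ∀ j : Fin q, D (1 ⊗ₜ Grassmann.odd j) = E (1 ⊗ₜ Grassmann.odd j)) : D = E := by
  have h1 : ∀ c : Grassmann k q, D (1 ⊗ₜ c) = E (1 ⊗ₜ c) := by
    intro c
    induction c using ExteriorAlgebra.induction with
    | algebraMap c =>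
      have : (1 : R) ⊗ₜ[k] algebraMap k (Grassmann k q) c = (algebraMap k R c) ⊗ₜ[k] 1 := by
        rw [Algebra.algebraMap_eq_smul_one, Algebra.algebraMap_eq_smul_one, TensorProduct.smul_tmul]
      rw [this, hR]
    | ι v =>
      rw [Grassmann.ι_eq_sum, TensorProduct.tmul_sum, map_sum, map_sum]
      refine Finset.sum_congr rfl fun j _ => ?_
      rw [TensorProduct.tmul_smul, map_smul, map_smul, hΛ]
    | mul x y hx hy =>
      have : (1 : R) ⊗ₜ[k] (x * y) = (1 ⊗ₜ x) * (1 ⊗ₜ y) := by simp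
      rw [this, hD, hE, hx, hy]
    | add x y hx hy => rw [TensorProduct.tmul_add, map_add, map_add, hx, hy]
  refine TensorProduct.ext' fun r c => ?_
  have : r ⊗ₜ[k] c = (r ⊗ₜ 1) * ((1 : R) ⊗ₜ c) := by simp
  rw [this, hD, hE, hR, h1]

end SuperTensor

/-! ## Connections on free modules in a basis -/

section FreeConnection

variable {R R' N N' J : Type*} [CommRing R] [CommRing R'] [AddCommGroup N] [Module R N]
  [AddCommGroup N'] [Module R' N'] [Fintype J]

theorem repr_connection (e : Module.Basis J R N) (δ : R → R) (d : N →+ N)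
    (hd : ∀ (a : R) s, d (a • s) = δ a • s + a • d s) (s : N) (j : J) :
    e.repr (d s) j = δ (e.repr s j) + ∑ l, e.repr (d (e l)) j * e.repr s l := by
  classical
  -- `δ` is a bare function; its vanishing at 0 is extracted from the Leibniz rule.
  have h0 : δ 0 = 0 := by
    have := hd 0 (e j)
    rw [zero_smul, map_zero, zero_smul, add_zero] at this
    have h := congrArg (fun g => e.repr g j) this.symm
    simpa using h
  conv_lhs => rw [← e.sum_repr s]
  simp only [hd, Finset.sum_add_distrib, map_add, map_sum, map_smul,
    Finsupp.coe_add, Pi.add_apply, Finsupp.coe_finsetSum, Finset.sum_apply, Finsupp.smul_apply,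
    smul_eq_mul, Module.Basis.repr_self]
  congr 1
  · rw [Finset.sum_eq_single j (fun l _ hl => by simp [hl]) (by simp)]
    simp
  · exact Finset.sum_congr rfl fun l _ => mul_comm _ _

/-- Solving the equations `d i s = c i` for commuting connections `d i` in a basis. -/
theorem exists_primitive_of_basis {p : ℕ} {I : Type*} {R' N' : I → Type*} [∀ ν, CommRing (R' ν)]
    [∀ ν, AddCommGroup (N' ν)] [∀ ν, Module (R' ν) (N' ν)]
    (e : Module.Basis J R N) (e' : ∀ ν, Module.Basis J (R' ν) (N' ν))
    (r : ∀ ν, R →+* R' ν) (ρ : ∀ ν, N →+ N' ν)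
    (hρ : ∀ ν a s, ρ ν (a • s) = r ν a • ρ ν s) (hρe : ∀ ν j, ρ ν (e j) = e' ν j)
    (δ : Fin p → R → R) (δ' : ∀ ν, Fin p → R' ν → R' ν)
    (d : Fin p → N →+ N) (d' : ∀ ν, Fin p → N' ν →+ N' ν)
    (hd : ∀ i (a : R) s, d i (a • s) = δ i a • s + a • d i s)
    (hd' : ∀ ν i (a : R' ν) s, d' ν i (a • s) = δ' ν i a • s + a • d' ν i s)
    (hdd' : ∀ ν i s, ρ ν (d i s) = d' ν i (ρ ν s)) (c : Fin p → N)
    (hcomm : ∀ i l s, d i (d l s) = d l (d i s)) (hc : ∀ i l, d i (c l) = d l (c i))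
    (hR : ∀ (Ω : Fin p → Matrix J J R) (c : Fin p → J → R),
      (∀ i l, (Ω l).map (δ i) + Ω i * Ω l = (Ω i).map (δ l) + Ω l * Ω i) →
      (∀ i l j, δ i (c l j) + ∑ m, Ω i j m * c l m = δ l (c i j) + ∑ m, Ω l j m * c i m) →
      ∃ ν, ∃ b : J → R' ν, ∀ i j,
        δ' ν i (b j) + ∑ m, r ν (Ω i j m) * b m = r ν (c i j)) :
    ∃ ν, ∃ s : N' ν, ∀ i, d' ν i s = ρ ν (c i) := by
  classical
  have hrep : ∀ ν s j, (e' ν).repr (ρ ν s) j = r ν (e.repr s j) := by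
    intro ν s j
    conv_lhs => rw [← e.sum_repr s]
    simp only [map_sum, hρ, hρe]
    simp [Finsupp.single_apply]
  -- The index `ν` runs over the smaller domains on which a solution may live. In the basis,
  -- commutation of the `d i` is flatness of their matrices, and `hc` is closedness of the right
  -- hand side.
  obtain ⟨ν, b, hb⟩ := hR (fun i => Matrix.of fun j l => e.repr (d i (e l)) j)
    (fun i j => e.repr (c i) j)
    (fun i l => by
      ext j m
      have h := congrArg (fun g => e.repr g j) (hcomm i l (e m))
      rw [repr_connection e (δ i) (d i) (hd i) (d l (e m)),
        repr_connection e (δ l) (d l) (hd l) (d i (e m))] at h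
      simpa only [Matrix.add_apply, Matrix.map_apply, Matrix.mul_apply, Matrix.of_apply] using h)
    (fun i l j => by
      simp only [Matrix.of_apply]
      rw [← repr_connection e (δ i) (d i) (hd i), ← repr_connection e (δ l) (d l) (hd l), hc])
  refine ⟨ν, ∑ j, b j • e' ν j, fun i => (e' ν).repr.injective (Finsupp.ext fun j => ?_)⟩
  rw [repr_connection (e' ν) (δ' ν i) (d' ν i) (hd' ν i), hrep, ← hb]
  have h1 : ∀ j, (e' ν).repr (∑ j, b j • e' ν j) j = b j := fun j => by
    simp [Finsupp.single_apply]
  simp only [h1]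
  simp only [← hρe ν, ← hdd' ν, hrep, Matrix.of_apply]

end FreeConnection

theorem Matrix.map_mul_of_leibniz {n T : Type*} [Fintype n] [Ring T] (δ : T →+ T)
    (hδ : ∀ a b, δ (a * b) = δ a * b + a * δ b) (s t : Matrix n n T) :
    (s * t).map δ = s.map δ * t + s * t.map δ := by
  ext i j
  simp only [Matrix.map_apply, Matrix.mul_apply, Matrix.add_apply, map_sum, hδ,
    Finset.sum_add_distrib]

/-- Closed one-forms with values in the endomorphisms of a trivial bundle over `R ⊗ Λ` have
primitives if this holds for trivial bundles over `R`. -/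
theorem SuperTensor.exists_matrix_primitive {k : Type t} [Field k] {p q n : ℕ} {R : Type v}
    [CommRing R] [Algebra k R] {I : Type*} {R' : I → Type v} [∀ ν, CommRing (R' ν)]
    [∀ ν, Algebra k (R' ν)] (r : ∀ ν, R →ₐ[k] R' ν)
    (δ : Fin p → R →ₗ[k] R) (δ' : ∀ ν, Fin p → R' ν →ₗ[k] R' ν)
    (hδ : ∀ i a b, δ i (a * b) = δ i a * b + a * δ i b)
    (hδ' : ∀ ν i a b, δ' ν i (a * b) = δ' ν i a * b + a * δ' ν i b)
    (hδδ' : ∀ ν i a, r ν (δ i a) = δ' ν i (r ν a))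
    (hcomm : ∀ i l a, δ i (δ l a) = δ l (δ i a))
    (hR : ∀ (J : Type) [Fintype J] (Ω : Fin p → Matrix J J R) (c : Fin p → J → R),
      (∀ i l, (Ω l).map (δ i) + Ω i * Ω l = (Ω i).map (δ l) + Ω l * Ω i) →
      (∀ i l j, δ i (c l j) + ∑ m, Ω i j m * c l m = δ l (c i j) + ∑ m, Ω l j m * c i m) →
      ∃ ν, ∃ b : J → R' ν, ∀ i j,
        δ' ν i (b j) + ∑ m, r ν (Ω i j m) * b m = r ν (c i j))
    (Γ C : Fin p → Matrix (Fin n) (Fin n) (R ⊗[k] Grassmann k q))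
    (hΓ : ∀ i j, (Γ j).map (even q (δ i)) + Γ j * Γ i = (Γ i).map (even q (δ j)) + Γ i * Γ j)
    (hC : ∀ i j, (C j).map (even q (δ i)) + C j * Γ i + Γ j * C i =
      (C i).map (even q (δ j)) + C i * Γ j + Γ i * C j) :
    ∃ ν, ∃ b : Matrix (Fin n) (Fin n) (R' ν ⊗[k] Grassmann k q), ∀ i,
      b.map (even q (δ' ν i)) +
          b * (Γ i).map (Algebra.TensorProduct.map (r ν) (AlgHom.id k (Grassmann k q))) =
        (C i).map (Algebra.TensorProduct.map (r ν) (AlgHom.id k (Grassmann k q))) +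
          (Γ i).map (Algebra.TensorProduct.map (r ν) (AlgHom.id k (Grassmann k q))) * b := by
  -- With this basis of `Λ` and the matrix units, matrices over `R ⊗ Λ` become a free `R`-module of
  -- finite rank. The operators `s ↦ ∂ᵢs + sΓᵢ - Γᵢs` are connections on it, so the noncommutative
  -- matrix equation becomes a linear system over `R`.
  let bΛ : Module.Basis (Finset (Fin q)) k (Grassmann k q) :=
    (Pi.basisFun k (Fin q)).ExteriorAlgebra
  let ρ : ∀ ν, R ⊗[k] Grassmann k q →ₐ[k] R' ν ⊗[k] Grassmann k q := fun ν =>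
    Algebra.TensorProduct.map (r ν) (AlgHom.id k (Grassmann k q))
  let E : Fin p → Matrix (Fin n) (Fin n) (R ⊗[k] Grassmann k q) →+
      Matrix (Fin n) (Fin n) (R ⊗[k] Grassmann k q) := fun i =>
    (even q (δ i)).toAddMonoidHom.mapMatrix
  have hE : ∀ i s, E i s = s.map (even q (δ i)) := fun i s => rfl
  have hEmul : ∀ i s t, E i (s * t) = E i s * t + s * E i t := fun i s t =>
    Matrix.map_mul_of_leibniz (even q (δ i)).toAddMonoidHom (even_mul (hδ i)) s t
  let E' : ∀ ν, Fin p → Matrix (Fin n) (Fin n) (R' ν ⊗[k] Grassmann k q) →+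
      Matrix (Fin n) (Fin n) (R' ν ⊗[k] Grassmann k q) := fun ν i =>
    (even q (δ' ν i)).toAddMonoidHom.mapMatrix
  have hEcomm : ∀ i l s, E i (E l s) = E l (E i s) := by
    intro i l s
    ext a b
    simp only [hE, Matrix.map_apply]
    induction s a b using TensorProduct.induction_on with
    | zero => simp
    | add x y hx hy => simp only [map_add, hx, hy]
    | tmul x y => simp [hcomm i l]
  have hsmul : ∀ i (a : R) x, even q (δ i) (a • x) = δ i a • x + a • even q (δ i) x := by
    intro i a x
    have h1 : ∀ a : R, ∀ x : R ⊗[k] Grassmann k q, a • x = (a ⊗ₜ 1) * x := fun a x => by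
      rw [Algebra.smul_def]
      rfl
    rw [h1, even_mul (hδ i), h1, h1]
    simp
  have hsmul' : ∀ ν i (a : R' ν) x,
      even q (δ' ν i) (a • x) = δ' ν i a • x + a • even q (δ' ν i) x := by
    intro ν i a x
    have h1 : ∀ a : R' ν, ∀ x : R' ν ⊗[k] Grassmann k q, a • x = (a ⊗ₜ 1) * x := fun a x => by
      rw [Algebra.smul_def]
      rfl
    rw [h1, even_mul (hδ' ν i), h1, h1]
    simp
  simp only [← hE] at hΓ hC
  obtain ⟨ν, s, hs⟩ := exists_primitive_of_basis
    ((Algebra.TensorProduct.basis R bΛ).matrix (Fin n) (Fin n))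
    (fun ν => (Algebra.TensorProduct.basis (R' ν) bΛ).matrix (Fin n) (Fin n))
    (fun ν => (r ν).toRingHom) (fun ν => (ρ ν).toAddMonoidHom.mapMatrix)
    (fun ν a s => by
      ext i j
      change ρ ν (a • s i j) = r ν a • ρ ν (s i j)
      rw [Algebra.smul_def, map_mul, Algebra.smul_def]
      congr 1)
    (fun ν j => by
      obtain ⟨a, b, l⟩ := j
      rw [Module.Basis.matrix_apply, Module.Basis.matrix_apply]
      refine (Matrix.map_single _ _ _ (ρ ν)).trans ?_
      simp [ρ, Algebra.TensorProduct.basis_apply])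
    (fun i => δ i) (fun ν i => δ' ν i)
    (fun i => AddMonoidHom.mk' (fun s => E i s + (s * Γ i - Γ i * s)) fun s t => by
      rw [map_add]; noncomm_ring)
    (fun ν i => AddMonoidHom.mk' (fun s => E' ν i s +
      (s * (Γ i).map (ρ ν) - (Γ i).map (ρ ν) * s)) fun s t => by
        rw [map_add]; noncomm_ring)
    (fun i a s => by
      simp only [AddMonoidHom.mk'_apply, smul_mul_assoc, mul_smul_comm, smul_add, smul_sub]
      have : E i (a • s) = δ i a • s + a • E i s := by
        ext x y
        exact hsmul i a (s x y)
      rw [this, add_assoc])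
    (fun ν i a s => by
      simp only [AddMonoidHom.mk'_apply, smul_mul_assoc, mul_smul_comm, smul_add, smul_sub]
      have : E' ν i (a • s) = δ' ν i a • s + a • E' ν i s := by
        ext x y
        exact hsmul' ν i a (s x y)
      rw [this, add_assoc])
    (fun ν i s => by
      change (E i s + (s * Γ i - Γ i * s)).map (ρ ν) = E' ν i (s.map (ρ ν)) +
        (s.map (ρ ν) * (Γ i).map (ρ ν) - (Γ i).map (ρ ν) * s.map (ρ ν))
      rw [Matrix.map_add _ (map_add _), Matrix.map_sub _ (map_sub _), Matrix.map_mul,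
        Matrix.map_mul]
      congr 1
      ext x y
      exact map_even (r ν) (hδδ' ν i) (s x y))
    C
    (fun i l s => by
      simp only [AddMonoidHom.mk'_apply, map_add, map_sub, hEmul]
      rw [hEcomm i l]
      -- The curvature of the commutator connection is the commutator with the curvature of `Γ`,
      -- which is zero.
      have h1 : E i (Γ l) = E l (Γ i) + Γ i * Γ l - Γ l * Γ i := by
        rw [← hΓ i l, add_sub_cancel_right]
      rw [h1]
      noncomm_ring)
    (fun i l => by
      simp only [AddMonoidHom.mk'_apply]
      have h1 : E i (C l) = E l (C i) + C i * Γ l + Γ i * C l - Γ l * C i - C l * Γ i := by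
        rw [← hC i l]
        abel
      rw [h1]
      abel)
    (hR _)
  refine ⟨ν, s, fun i => ?_⟩
  have h := hs i
  change E' ν i s + (s * (Γ i).map (ρ ν) - (Γ i).map (ρ ν) * s) = (C i).map (ρ ν) at h
  change E' ν i s + s * (Γ i).map (ρ ν) = (C i).map (ρ ν) + (Γ i).map (ρ ν) * s
  rw [← h]
  abel

/-! ## Coordinates from a splitting of the structure sheaf -/

namespace SuperTensor

variable {k : Type t} [Field k] {q : ℕ} {R : Type v} [CommRing R] [Algebra k R]
  {R' : Type w} [CommRing R'] [Algebra k R']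

/-- The coefficients of an element of `R ⊗ Λ`. -/
noncomputable def coeff (R : Type v) [CommRing R] [Algebra k R] (s : Finset (Fin q)) :
    R ⊗[k] Grassmann k q →ₗ[k] R :=
  (TensorProduct.rid k R).toLinearMap ∘ₗ
    TensorProduct.map LinearMap.id ((Pi.basisFun k (Fin q)).ExteriorAlgebra.coord s)

theorem coeff_smul (s : Finset (Fin q)) (a : R) (x : R ⊗[k] Grassmann k q) :
    coeff R s ((a ⊗ₜ 1) * x) = a * coeff R s x := by
  induction x using TensorProduct.induction_on with
  | zero => simp
  | add x y hx hy => rw [mul_add, map_add, hx, hy, map_add, mul_add]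
  | tmul b c => simp [coeff]

theorem mul_tmul_one (a : R) (x : R ⊗[k] Grassmann k q) : x * (a ⊗ₜ 1) = (a ⊗ₜ 1) * x := by
  induction x using TensorProduct.induction_on with
  | zero => simp
  | add x y hx hy => rw [mul_add, add_mul, hx, hy]
  | tmul b c => simp [mul_comm]

theorem coeff_map (r : R →ₐ[k] R') (s : Finset (Fin q)) (x : R ⊗[k] Grassmann k q) :
    coeff R' s (Algebra.TensorProduct.map r (AlgHom.id k _) x) = r (coeff R s x) := by
  induction x using TensorProduct.induction_on with
  | zero => simp
  | add x y hx hy => simp only [map_add, hx, hy]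
  | tmul b c => simp [coeff]

theorem eq_zero_of_coeff {x : R ⊗[k] Grassmann k q} (h : ∀ s, coeff R s x = 0) : x = 0 := by
  have key : ∀ (x : R ⊗[k] Grassmann k q) s, (Algebra.TensorProduct.basis R
      (Pi.basisFun k (Fin q)).ExteriorAlgebra).repr x s = coeff R s x := by
    intro x s
    induction x using TensorProduct.induction_on with
    | zero => simp
    | add x y hx hy => simp only [map_add, Finsupp.add_apply, hx, hy]
    | tmul b c => simp [coeff, Algebra.TensorProduct.basis_repr_tmul, Algebra.smul_def, mul_comm]
  refine (Algebra.TensorProduct.basis R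
      (Pi.basisFun k (Fin q)).ExteriorAlgebra).repr.injective (Finsupp.ext fun s => ?_)
  rw [key, h, map_zero, Finsupp.zero_apply]

end SuperTensor

/-- A splitting of the structure sheaf on `U` as `R ⊗ Λ`, for a sheaf of algebras `R` with `p`
coordinates and the corresponding commuting derivations. -/
structure SplitCoordinates {k : Type t} [Field k] {M : Type u} [TopologicalSpace M]
    (X : SuperSpace.{t, u, v} k M) (U : Opens M) (p q : ℕ) where
  /-- even functions -/
  R : Opens M → Type w
  [commRing : ∀ W, CommRing (R W)]
  [algebra : ∀ W, Algebra k (R W)]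
  /-- restriction -/
  r : ∀ {W W' : Opens M}, W' ≤ W → R W →ₐ[k] R W'
  r_r : ∀ {W W' W'' : Opens M} (h : W' ≤ W) (h' : W'' ≤ W') (a : R W),
    r h' (r h a) = r (h'.trans h) a
  /-- the splitting -/
  iso : ∀ W : Opens M, W ≤ U → X.obj W ≃ₐ[k] R W ⊗[k] Grassmann k q
  iso_res : ∀ (W W' : Opens M) (hW : W ≤ U) (hW' : W' ≤ W) (a : X.obj W),
    iso W' (hW'.trans hW) (X.res hW' a) =
      Algebra.TensorProduct.map (r hW') (AlgHom.id k _) (iso W hW a)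
  iso_σ : ∀ (W : Opens M) (hW : W ≤ U) (a : X.obj W),
    iso W hW (X.σ a) = SuperTensor.σ k q (R W) (iso W hW a)
  /-- the coordinates -/
  x : Fin p → R U
  /-- the partial derivatives -/
  δ : ∀ W : Opens M, W ≤ U → Fin p → R W →ₗ[k] R W
  δ_mul : ∀ (W : Opens M) (hW : W ≤ U) i (a b : R W),
    δ W hW i (a * b) = δ W hW i a * b + a * δ W hW i b
  δ_res : ∀ (W W' : Opens M) (hW : W ≤ U) (hW' : W' ≤ W) i (a : R W),
    r hW' (δ W hW i a) = δ W' (hW'.trans hW) i (r hW' a)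
  δ_comm : ∀ (W : Opens M) (hW : W ≤ U) i j (a : R W),
    δ W hW i (δ W hW j a) = δ W hW j (δ W hW i a)
  δ_x : ∀ i j, δ U le_rfl i (x j) = if i = j then 1 else 0
  ext : ∀ (W : Opens M) (hW : W ≤ U) (d : ∀ W' : Opens M, W' ≤ W → R W' →ₗ[k] R W'),
    (∀ W' hW' a b, d W' hW' (a * b) = d W' hW' a * b + a * d W' hW' b) →
    (∀ (W' W'' : Opens M) (h : W' ≤ W) (h' : W'' ≤ W') (a : R W'),
      r h' (d W' h a) = d W'' (h'.trans h) (r h' a)) →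
    (∀ i, d W le_rfl (r hW (x i)) = 0) → ∀ a, d W le_rfl a = 0

attribute [instance] SplitCoordinates.commRing SplitCoordinates.algebra

namespace SplitCoordinates

open SuperTensor

variable {k : Type t} [Field k] {M : Type u} [TopologicalSpace M] {X : SuperSpace.{t, u, v} k M}
  {U : Opens M} {p q : ℕ} (T : SplitCoordinates.{t, u, v, w} X U p q)

theorem res_symm (W W' : Opens M) (hW : W ≤ U) (hW' : W' ≤ W) (z : T.R W ⊗[k] Grassmann k q) :
    X.res hW' ((T.iso W hW).symm z) = (T.iso W' (hW'.trans hW)).symm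
      (Algebra.TensorProduct.map (T.r hW') (AlgHom.id k _) z) := by
  rw [AlgEquiv.eq_symm_apply, T.iso_res W W' hW, AlgEquiv.apply_symm_apply]

theorem σ_symm (W : Opens M) (hW : W ≤ U) (z : T.R W ⊗[k] Grassmann k q) :
    X.σ ((T.iso W hW).symm z) = (T.iso W hW).symm (SuperTensor.σ k q (T.R W) z) := by
  rw [AlgEquiv.eq_symm_apply, T.iso_σ, AlgEquiv.apply_symm_apply]

/-- The coordinate vector fields. -/
noncomputable def vf : ∀ a : Fin p ⊕ Fin q, SuperVectorField X U (coordParity a)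
  | .inl i =>
    { toFun := fun W hW => (T.iso W hW).symm.toLinearMap ∘ₗ even q (T.δ W hW i) ∘ₗ
        (T.iso W hW).toLinearMap
      res := fun V W hV hW a => by
        simp [T.res_symm V W hV hW, T.iso_res V W hV hW, map_even _ (T.δ_res V W hV hW i)]
      σ := fun V hV a => by
        simp [coordParity, T.σ_symm, T.iso_σ, σ_even, superSign]
      leibniz := fun V hV a b => by
        have h := even_mul (q := q) (T.δ_mul V hV i) (T.iso V hV a) (T.iso V hV b)
        simp [coordParity, SuperSpace.tw, h] }
  | .inr j =>
    { toFun := fun W hW => (T.iso W hW).symm.toLinearMap ∘ₗ odd (T.R W) j ∘ₗ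
        (T.iso W hW).toLinearMap
      res := fun V W hV hW a => by
        simp [T.res_symm V W hV hW, T.iso_res V W hV hW, map_odd]
      σ := fun V hV a => by
        simp [coordParity, T.σ_symm, T.iso_σ, σ_odd, superSign]
      leibniz := fun V hV a b => by
        have h := odd_mul j (T.iso V hV a) (T.iso V hV b)
        simp [coordParity, SuperSpace.tw, h, ← T.iso_σ] }

/-- The coordinates. -/
noncomputable def coord (a : Fin p ⊕ Fin q) : X.obj U :=
  (T.iso U le_rfl).symm (Sum.elim (fun i => T.x i ⊗ₜ 1) (fun j => 1 ⊗ₜ Grassmann.odd j) a)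

/-- Both fields are carried over to `R ⊗ Λ`. Each coefficient of their difference on `R` is an
ordinary derivation of the sheaf `R` that kills the coordinates, hence zero by `T.ext`; this uses
that `R` is even and central. On the odd coordinates the fields agree by assumption, and
`superderivation_ext` concludes on every smaller open set. -/
theorem toFun_eq_zero (V : Opens M) (hV : V ≤ U) (i : ZMod 2) (D E : SuperVectorField X V i)
    (h : ∀ a, D.toFun V le_rfl (X.res hV (T.coord a)) = E.toFun V le_rfl (X.res hV (T.coord a))) :
    D.toFun = E.toFun := by
  let D' : ∀ (D : SuperVectorField X V i) (W : Opens M), W ≤ V →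
    T.R W ⊗[k] Grassmann k q →ₗ[k] T.R W ⊗[k] Grassmann k q := fun D W hW =>
      (T.iso W (hW.trans hV)).toLinearMap ∘ₗ D.toFun W hW ∘ₗ
        (T.iso W (hW.trans hV)).symm.toLinearMap
  let τ : ∀ W : Opens M, T.R W ⊗[k] Grassmann k q → T.R W ⊗[k] Grassmann k q := fun W z =>
    if i = 0 then z else SuperTensor.σ k q (T.R W) z
  have hD' : ∀ D W hW a b, D' D W hW (a * b) = D' D W hW a * b + τ W a * D' D W hW b := by
    intro D W hW a b
    have h2 : T.iso W (hW.trans hV) (X.tw i ((T.iso W (hW.trans hV)).symm a)) = τ W a := by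
      simp only [SuperSpace.tw, τ]
      split_ifs <;> simp [T.iso_σ]
    simp [D', D.leibniz, h2]
  have hτ : ∀ W (a : T.R W), τ W (a ⊗ₜ 1) = a ⊗ₜ 1 := by
    intro W a
    simp only [τ]
    split_ifs <;> simp
  have hres : ∀ D (W W' : Opens M) (hW : W ≤ V) (hW' : W' ≤ W) z,
      Algebra.TensorProduct.map (T.r hW') (AlgHom.id k _) (D' D W hW z) =
        D' D W' (hW'.trans hW) (Algebra.TensorProduct.map (T.r hW') (AlgHom.id k _) z) := by
    intro D W W' hW hW' z
    simp only [D', LinearMap.comp_apply, AlgEquiv.toLinearMap_apply]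
    rw [← T.iso_res W W' (hW.trans hV) hW', D.res W W' hW hW',
      T.res_symm W W' (hW.trans hV) hW']
  have hcoord : ∀ a, D' D V le_rfl (T.iso V hV (X.res hV (T.coord a))) =
      D' E V le_rfl (T.iso V hV (X.res hV (T.coord a))) := by
    intro a
    simp [D', h a]
  have hR : ∀ W hW (a : T.R W), D' D W hW (a ⊗ₜ 1) = D' E W hW (a ⊗ₜ 1) := by
    intro W hW a
    rw [← sub_eq_zero]
    refine eq_zero_of_coeff fun s => ?_
    have hx : ∀ l, (coeff (T.R W) s) (D' D W hW (T.r (hW.trans hV) (T.x l) ⊗ₜ 1) -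
        D' E W hW (T.r (hW.trans hV) (T.x l) ⊗ₜ 1)) = 0 := by
      intro l
      have h1 := hcoord (.inl l)
      rw [T.iso_res U V le_rfl hV, coord, AlgEquiv.apply_symm_apply, Sum.elim_inl,
        Algebra.TensorProduct.map_tmul, map_one] at h1
      have h2 := congrArg (Algebra.TensorProduct.map (T.r hW) (AlgHom.id k _)) h1
      rw [hres, hres] at h2
      simp only [Algebra.TensorProduct.map_tmul, map_one, T.r_r] at h2
      rw [h2, sub_self, map_zero]
    exact T.ext W (hW.trans hV) (fun W' hW' => coeff (T.R W') s ∘ₗ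
        (D' D W' (hW'.trans hW) - D' E W' (hW'.trans hW)) ∘ₗ
          (TensorProduct.mk k (T.R W') (Grassmann k q)).flip 1)
      (fun W' hW' a b => by
        have h1 : (a * b) ⊗ₜ[k] (1 : Grassmann k q) = (a ⊗ₜ 1) * (b ⊗ₜ 1) := by simp
        simp only [LinearMap.comp_apply, LinearMap.flip_apply, TensorProduct.mk_apply, h1,
          LinearMap.sub_apply, hD', hτ]
        rw [mul_tmul_one b, mul_tmul_one b]
        simp only [map_sub, map_add, coeff_smul]
        ring)
      (fun W' W'' h h' a => by
        simp only [LinearMap.comp_apply, LinearMap.flip_apply, TensorProduct.mk_apply,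
          LinearMap.sub_apply, ← coeff_map, map_sub, hres]
        simp)
      hx a
  have hΛ : ∀ W hW j, D' D W hW (1 ⊗ₜ Grassmann.odd j) = D' E W hW (1 ⊗ₜ Grassmann.odd j) := by
    intro W hW j
    have h1 := hcoord (.inr j)
    rw [T.iso_res U V le_rfl hV, coord, AlgEquiv.apply_symm_apply, Sum.elim_inr,
      Algebra.TensorProduct.map_tmul, map_one] at h1
    have h2 := congrArg (Algebra.TensorProduct.map (T.r hW) (AlgHom.id k _)) h1
    rw [hres, hres] at h2
    simpa only [Algebra.TensorProduct.map_tmul, map_one, AlgHom.id_apply] using h2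
  funext W hW
  have h3 := superderivation_ext (τ W) (D' D W hW) (D' E W hW) (hD' D W hW) (hD' E W hW)
    (hR W hW) (hΛ W hW)
  ext a
  have h4 := LinearMap.congr_fun h3 (T.iso W (hW.trans hV) a)
  simpa [D'] using h4

/-- The coordinate system defined by a splitting. -/
noncomputable def toSuperCoordinates : SuperCoordinates X U p q where
  coord := T.coord
  vf := T.vf
  σ_coord a := by
    obtain i | j := a
    · simp [coord, T.σ_symm, coordParity, superSign]
    · simp [coord, T.σ_symm, coordParity, superSign, Grassmann.odd, Grassmann.σ_ι,
        TensorProduct.tmul_neg]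
  vf_coord a b := by
    obtain i | j := a <;> obtain l | l := b
    · simp only [coord, vf, LinearMap.comp_apply, AlgEquiv.toLinearMap_apply,
        AlgEquiv.apply_symm_apply, Sum.elim_inl, TensorProduct.map_tmul, T.δ_x, Sum.inl.injEq]
      split_ifs <;> simp [← Algebra.TensorProduct.one_def]
    · have h : T.δ U le_rfl i 1 = 0 := by
        have := T.δ_mul U le_rfl i 1 1
        simpa using this
      simp [coord, vf, h]
    · simp [coord, vf, Grassmann.deriv]
    · simp only [coord, vf, LinearMap.comp_apply, AlgEquiv.toLinearMap_apply,
        AlgEquiv.apply_symm_apply, Sum.elim_inr, TensorProduct.map_tmul, Grassmann.odd,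
        Grassmann.deriv_ι, Sum.inr.injEq, Pi.single_apply]
      split_ifs <;> simp [← Algebra.TensorProduct.one_def]
  ext := T.toFun_eq_zero

/-- The splitting turns the matrix equations over the structure sheaf into equations over `R ⊗ Λ`;
the index of the possible domains is a neighbourhood of `y` inside `V`. -/
theorem hasPrimitives {y : M}
    (hR : ∀ (V : Opens M) (hV : V ≤ U), y ∈ V → ∀ (J : Type) [Fintype J]
      (Ω : Fin p → Matrix J J (T.R V)) (c : Fin p → J → T.R V),
      (∀ i l, (Ω l).map (T.δ V hV i) + Ω i * Ω l = (Ω i).map (T.δ V hV l) + Ω l * Ω i) →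
      (∀ i l j, T.δ V hV i (c l j) + ∑ m, Ω i j m * c l m =
        T.δ V hV l (c i j) + ∑ m, Ω l j m * c i m) →
      ∃ (W : Opens M) (hW : W ≤ V), y ∈ W ∧ ∃ b : J → T.R W, ∀ i j,
        T.δ W (hW.trans hV) i (b j) + ∑ m, T.r hW (Ω i j m) * b m = T.r hW (c i j)) :
    T.toSuperCoordinates.HasPrimitives y := by
  intro V hV hy n Γ C hΓ hC
  have hvf : ∀ (W : Opens M) (hW : W ≤ U) i z,
      T.iso W hW ((T.vf (.inl i)).toFun W hW z) = even q (T.δ W hW i) (T.iso W hW z) := by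
    intro W hW i z
    simp [vf]
  obtain ⟨⟨W, hW, hyW⟩, b, hb⟩ := SuperTensor.exists_matrix_primitive (n := n) (q := q)
    (I := {W : Opens M // W ≤ V ∧ y ∈ W}) (fun W => T.r W.2.1) (T.δ V hV)
    (fun W => T.δ W.1 (W.2.1.trans hV)) (T.δ_mul V hV) (fun W => T.δ_mul _ _)
    (fun W i a => T.δ_res V W.1 hV W.2.1 i a) (T.δ_comm V hV)
    (fun J _ Ω c h1 h2 => by
      obtain ⟨W, hW, hyW, b, hb⟩ := hR V hV hy J Ω c h1 h2
      exact ⟨⟨W, hW, hyW⟩, b, hb⟩)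
    (fun i => (Γ i).map (T.iso V hV)) (fun i => (C i).map (T.iso V hV))
    (fun i j => by
      have h := congrArg (fun m : Matrix _ _ _ => m.map (T.iso V hV)) (hΓ i j)
      simp only [Matrix.map_add _ (map_add (T.iso V hV)), Matrix.map_mul] at h
      convert h using 2 <;> (ext a b; exact (hvf V hV _ _).symm))
    (fun i j => by
      have h := congrArg (fun m : Matrix _ _ _ => m.map (T.iso V hV)) (hC i j)
      simp only [Matrix.map_add _ (map_add (T.iso V hV)), Matrix.map_mul] at h
      convert h using 3 <;> (ext a b; exact (hvf V hV _ _).symm))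
  refine ⟨W, hW, hyW, b.map (T.iso W (hW.trans hV)).symm, fun i => ?_⟩
  have h := congrArg (fun m : Matrix _ _ _ => m.map (T.iso W (hW.trans hV)).symm) (hb i)
  simp only [Matrix.map_add _ (map_add (T.iso W (hW.trans hV)).symm), Matrix.map_mul] at h
  have hm : ∀ m : Matrix (Fin n) (Fin n) (X.obj V), ((m.map (T.iso V hV)).map
      (Algebra.TensorProduct.map (T.r hW) (AlgHom.id k (Grassmann k q)))).map
        (T.iso W (hW.trans hV)).symm = m.map (X.res hW) := by
    intro m
    ext a b
    simp only [Matrix.map_apply, ← T.iso_res V W hV hW, AlgEquiv.symm_apply_apply]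
  simp only [hm] at h
  rw [← h]
  congr 1
  ext a b
  simp [toSuperCoordinates, vf]

end SplitCoordinates

/-! ## Smooth and analytic supermanifolds -/

section CoordinateAnalysis

open Metric

variable {𝕜 : Type t} [RCLike 𝕜] {p : ℕ}

theorem pi_clm_apply {G : Type*} [NormedAddCommGroup G] [NormedSpace 𝕜 G]
    (L : (Fin p → 𝕜) →L[𝕜] G) (v : Fin p → 𝕜) : L v = ∑ i, v i • L (Pi.single i 1) := by
  conv_lhs => rw [pi_eq_sum_univ' v]
  simp [map_sum]

/-- Solving `∂ᵢ b + ωᵢ b = cᵢ` for a flat connection in coordinates. -/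
theorem exists_primitive_of_flat_coord {F : Type t} [NormedAddCommGroup F] [NormedSpace 𝕜 F]
    [NormedSpace ℝ F] [IsScalarTower ℝ 𝕜 F] [CompleteSpace F] {y : Fin p → 𝕜} {r : ℝ} (hr : 0 < r)
    {ω' : Fin p → (Fin p → 𝕜) → F →L[𝕜] F} {c : Fin p → (Fin p → 𝕜) → F}
    (hω : ∀ i, ContDiffOn 𝕜 ∞ (ω' i) (ball y r)) (hc : ∀ i, ContDiffOn 𝕜 ∞ (c i) (ball y r))
    (flat : ∀ x ∈ ball y r, ∀ i l, fderiv 𝕜 (ω' l) x (Pi.single i 1) + (ω' i x).comp (ω' l x) =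
      fderiv 𝕜 (ω' i) x (Pi.single l 1) + (ω' l x).comp (ω' i x))
    (closed : ∀ x ∈ ball y r, ∀ i l, fderiv 𝕜 (c l) x (Pi.single i 1) + ω' i x (c l x) =
      fderiv 𝕜 (c i) x (Pi.single l 1) + ω' l x (c i x)) :
    ∃ ε > 0, ε ≤ r ∧ ∃ b : (Fin p → 𝕜) → F, ContDiffOn 𝕜 ∞ b (ball y ε) ∧
      ∀ x ∈ ball y ε, ∀ i, fderiv 𝕜 b x (Pi.single i 1) + ω' i x (b x) = c i x := by
  -- a one-form assembled from its coefficients, translated to the origin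
  let form : ∀ {G : Type t} [NormedAddCommGroup G] [NormedSpace 𝕜 G],
      (Fin p → (Fin p → 𝕜) → G) → (Fin p → 𝕜) → (Fin p → 𝕜) →L[𝕜] G := fun a z =>
    ∑ i, ContinuousLinearMap.smulRightL 𝕜 _ _ (ContinuousLinearMap.proj i) (a i (y + z))
  have form_apply : ∀ {G : Type t} [NormedAddCommGroup G] [NormedSpace 𝕜 G]
      (a : Fin p → (Fin p → 𝕜) → G) z v, form a z v = ∑ i, v i • a i (y + z) := by
    intro G _ _ a z v
    simp [form]
  have hmem : ∀ {z : Fin p → 𝕜} {ε : ℝ}, z ∈ ball 0 ε → y + z ∈ ball y ε := by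
    intro z ε hz
    simpa using hz
  have hform : ∀ {G : Type t} [NormedAddCommGroup G] [NormedSpace 𝕜 G]
      (a : Fin p → (Fin p → 𝕜) → G), (∀ i, ContDiffOn 𝕜 ∞ (a i) (ball y r)) →
      ContDiffOn 𝕜 ∞ (form a) (ball 0 r) := by
    intro G _ _ a ha
    refine ContDiffOn.sum fun i _ => ContDiffOn.continuousLinearMap_comp _ ?_
    exact (ha i).comp (contDiff_const.add contDiff_id).contDiffOn fun z hz => hmem hz
  have hfderiv : ∀ {G : Type t} [NormedAddCommGroup G] [NormedSpace 𝕜 G]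
      (a : Fin p → (Fin p → 𝕜) → G), (∀ i, ContDiffOn 𝕜 ∞ (a i) (ball y r)) →
      ∀ z ∈ ball (0 : Fin p → 𝕜) r, ∀ u v, fderiv 𝕜 (form a) z u v =
        ∑ i, ∑ l, (u i * v l) • fderiv 𝕜 (a l) (y + z) (Pi.single i 1) := by
    intro G _ _ a ha z hz u v
    have h1 : HasFDerivAt (form a) (∑ l, (ContinuousLinearMap.smulRightL 𝕜 (Fin p → 𝕜) G
        (ContinuousLinearMap.proj l)).comp (fderiv 𝕜 (a l) (y + z))) z := by
      refine HasFDerivAt.fun_sum fun l _ => ?_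
      refine (ContinuousLinearMap.hasFDerivAt _).comp z ?_
      have h2 := (((ha l).differentiableOn (by simp)).differentiableAt
        (isOpen_ball.mem_nhds (hmem hz))).hasFDerivAt
      exact (hasFDerivAt_comp_add_left y).2 h2
    rw [h1.fderiv, Finset.sum_comm]
    simp only [_root_.sum_apply, ContinuousLinearMap.comp_apply]
    refine Finset.sum_congr rfl fun l _ => ?_
    rw [pi_clm_apply (fderiv 𝕜 (a l) (y + z)) u]
    simp [smul_smul]
  have hswap : ∀ {G : Type t} [AddCommGroup G] [Module 𝕜 G] (a : Fin p → Fin p → G)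
      (_ : ∀ i l, a i l = a l i) (u v : Fin p → 𝕜),
      ∑ i, ∑ l, (u i * v l) • a i l = ∑ i, ∑ l, (v i * u l) • a i l := by
    intro G _ _ a ha u v
    rw [Finset.sum_comm]
    refine Finset.sum_congr rfl fun i _ => Finset.sum_congr rfl fun l _ => ?_
    rw [ha, mul_comm]
  obtain ⟨ε, hε, hεr, b, hb, hbeq⟩ := exists_primitive_of_flat (𝕜 := 𝕜) (Ω := form ω')
    (c := form c) hr (hform ω' hω) (hform c hc)
    (fun z hz u v => by
      have key : ∀ u v, fderiv 𝕜 (form ω') z u v + (form ω' z u).comp (form ω' z v) =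
          ∑ i, ∑ l, (u i * v l) • (fderiv 𝕜 (ω' l) (y + z) (Pi.single i 1) +
            (ω' i (y + z)).comp (ω' l (y + z))) := by
        intro u v
        rw [hfderiv ω' hω z hz, form_apply, form_apply]
        simp only [smul_add, Finset.sum_add_distrib]
        congr 1
        ext w
        simp only [ContinuousLinearMap.comp_apply, _root_.sum_apply,
          _root_.smul_apply, map_sum, map_smul, Finset.smul_sum, smul_smul]
        rw [Finset.sum_comm]
        simp only [mul_comm]
      rw [key, key, hswap _ (fun i l => flat _ (hmem hz) i l)])
    (fun z hz u v => by
      have key : ∀ u v, fderiv 𝕜 (form c) z u v + form ω' z u (form c z v) =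
          ∑ i, ∑ l, (u i * v l) • (fderiv 𝕜 (c l) (y + z) (Pi.single i 1) +
            ω' i (y + z) (c l (y + z))) := by
        intro u v
        rw [hfderiv c hc z hz, form_apply, form_apply]
        simp only [smul_add, Finset.sum_add_distrib]
        congr 1
        simp only [_root_.sum_apply, _root_.smul_apply, map_sum, map_smul,
          Finset.smul_sum, smul_smul]
        rw [Finset.sum_comm]
        simp only [mul_comm]
      rw [key, key, hswap _ (fun i l => closed _ (hmem hz) i l)])
  have hmem' : ∀ {x : Fin p → 𝕜}, x ∈ ball y ε → x - y ∈ ball (0 : Fin p → 𝕜) ε := by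
    intro x hx
    simpa [dist_eq_norm] using hx
  refine ⟨ε, hε, hεr, fun x => b (x - y), ?_, fun x hx i => ?_⟩
  · exact hb.comp (contDiff_id.sub contDiff_const).contDiffOn fun x hx => hmem' hx
  · have h := hbeq (x - y) (hmem' hx) (Pi.single i 1)
    rw [form_apply, form_apply] at h
    have h3 : fderiv 𝕜 (fun x => b (x - y)) x = fderiv 𝕜 b (x - y) := fderiv_comp_sub y
    rw [h3]
    simpa [Pi.single_apply] using h

/-- Solving a flat linear system in coordinates, in matrix form. -/
theorem exists_primitive_of_flat_matrix {J : Type} [Fintype J] {y : Fin p → 𝕜} {r : ℝ} (hr : 0 < r)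
    {a : Fin p → J → J → (Fin p → 𝕜) → 𝕜} {c : Fin p → J → (Fin p → 𝕜) → 𝕜}
    (ha : ∀ i j m, ContDiffOn 𝕜 ∞ (a i j m) (ball y r))
    (hc : ∀ i j, ContDiffOn 𝕜 ∞ (c i j) (ball y r))
    (flat : ∀ x ∈ ball y r, ∀ i l j m,
      fderiv 𝕜 (a l j m) x (Pi.single i 1) + ∑ n, a i j n x * a l n m x =
        fderiv 𝕜 (a i j m) x (Pi.single l 1) + ∑ n, a l j n x * a i n m x)
    (closed : ∀ x ∈ ball y r, ∀ i l j,
      fderiv 𝕜 (c l j) x (Pi.single i 1) + ∑ m, a i j m x * c l m x =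
        fderiv 𝕜 (c i j) x (Pi.single l 1) + ∑ m, a l j m x * c i m x) :
    ∃ ε > 0, ε ≤ r ∧ ∃ b : J → (Fin p → 𝕜) → 𝕜, (∀ j, ContDiffOn 𝕜 ∞ (b j) (ball y ε)) ∧
      ∀ x ∈ ball y ε, ∀ i j,
        fderiv 𝕜 (b j) x (Pi.single i 1) + ∑ m, a i j m x * b m x = c i j x := by
  classical
  let L : (J → J → 𝕜) →L[𝕜] ((J → 𝕜) →L[𝕜] (J → 𝕜)) := LinearMap.toContinuousLinearMap
    (LinearMap.toContinuousLinearMap.toLinearMap ∘ₗ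
      (Matrix.toLin' : Matrix J J 𝕜 ≃ₗ[𝕜] (J → 𝕜) →ₗ[𝕜] (J → 𝕜)).toLinearMap)
  have hL : ∀ m w j, L m w j = ∑ n, m j n * w n := fun m w j => rfl
  have hda : ∀ x ∈ ball y r, ∀ i, HasFDerivAt (fun x => L fun j m => a i j m x)
      (L.comp (ContinuousLinearMap.pi fun j => ContinuousLinearMap.pi fun m =>
        fderiv 𝕜 (a i j m) x)) x := by
    intro x hx i
    refine L.hasFDerivAt.comp x (hasFDerivAt_pi.2 fun j => hasFDerivAt_pi.2 fun m => ?_)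
    exact (((ha i j m).differentiableOn (by simp)).differentiableAt
      (isOpen_ball.mem_nhds hx)).hasFDerivAt
  have hdiff : ∀ {b : J → (Fin p → 𝕜) → 𝕜} {ε : ℝ}, (∀ j, ContDiffOn 𝕜 ∞ (b j) (ball y ε)) →
      ∀ x ∈ ball y ε, HasFDerivAt (fun x j => b j x)
        (ContinuousLinearMap.pi fun j => fderiv 𝕜 (b j) x) x := by
    intro b ε hb x hx
    exact hasFDerivAt_pi.2 fun j => (((hb j).differentiableOn (by simp)).differentiableAt
      (isOpen_ball.mem_nhds hx)).hasFDerivAt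
  obtain ⟨ε, hε, hεr, b, hb, h⟩ := exists_primitive_of_flat_coord (𝕜 := 𝕜) (F := J → 𝕜) hr
    (ω' := fun i x => L fun j m => a i j m x) (c := fun i x j => c i j x)
    (fun i => L.contDiff.comp_contDiffOn (contDiffOn_pi.2 fun j =>
      contDiffOn_pi.2 fun m => ha i j m))
    (fun i => contDiffOn_pi.2 fun j => hc i j)
    (fun x hx i l => by
      rw [(hda x hx l).fderiv, (hda x hx i).fderiv]
      have : ∀ m m' : J → J → 𝕜, (L m).comp (L m') = L fun j n => ∑ o, m j o * m' o n := by
        intro m m'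
        ext w j
        simp only [ContinuousLinearMap.comp_apply, hL, Finset.mul_sum, Finset.sum_mul, mul_assoc]
        exact Finset.sum_comm
      rw [this, this, ContinuousLinearMap.comp_apply, ContinuousLinearMap.comp_apply, ← map_add,
        ← map_add]
      congr 1
      funext j m
      exact flat x hx i l j m)
    (fun x hx i l => by
      rw [(hdiff (hc l) x hx).fderiv, (hdiff (hc i) x hx).fderiv]
      funext j
      exact closed x hx i l j)
  have hb' : ∀ j, ContDiffOn 𝕜 ∞ (fun x => b x j) (ball y ε) := contDiffOn_pi.1 hb
  refine ⟨ε, hε, hεr, fun j x => b x j, hb', fun x hx i j => ?_⟩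
  have h1 := congrFun (h x hx i) j
  rwa [(hdiff hb' x hx).fderiv] at h1

end CoordinateAnalysis

/-! ### Partial derivatives of coordinate functions -/

namespace coordFunctions

variable {𝕜 : Type t} [RCLike 𝕜] {M : Type u} [TopologicalSpace M] {p : ℕ}
  {φ : OpenPartialHomeomorph M (Fin p → 𝕜)} {W W' : Opens M}

/-- The expression of a coordinate function in coordinates. -/
noncomputable def rep (g : coordFunctions φ W) : (Fin p → 𝕜) → 𝕜 := g.2.choose

theorem contDiffOn_rep (g : coordFunctions φ W) : ContDiffOn 𝕜 ∞ (rep g) (φ '' W) :=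
  g.2.choose_spec.1

theorem apply_eq_rep (g : coordFunctions φ W) (x : W) : g.1 x = rep g (φ x) := g.2.choose_spec.2 x

theorem isOpen_image (hW : (W : Set M) ⊆ φ.source) : IsOpen (φ '' W) :=
  φ.isOpen_image_of_subset_source W.isOpen hW

/-- A coordinate function fixes its representative only on the image of `W`. As this image is open,
the derivatives at its points do not depend on the choice. -/
theorem fderiv_congr (hW : (W : Set M) ⊆ φ.source) {G H : (Fin p → 𝕜) → 𝕜}
    (h : ∀ x ∈ W, G (φ x) = H (φ x)) {x : M} (hx : x ∈ W) :
    fderiv 𝕜 G (φ x) = fderiv 𝕜 H (φ x) := by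
  refine Filter.EventuallyEq.fderiv_eq ?_
  filter_upwards [(isOpen_image hW).mem_nhds ⟨x, hx, rfl⟩]
  rintro _ ⟨z, hz, rfl⟩
  exact h z hz

theorem contDiffOn_fderiv (hW : (W : Set M) ⊆ φ.source) {G : (Fin p → 𝕜) → 𝕜}
    (hG : ContDiffOn 𝕜 ∞ G (φ '' W)) (v : Fin p → 𝕜) :
    ContDiffOn 𝕜 ∞ (fun z => fderiv 𝕜 G z v) (φ '' W) :=
  ((contDiffOn_infty_iff_fderiv_of_isOpen (isOpen_image hW)).1 hG).2.clm_apply contDiffOn_const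

theorem differentiableAt_of_contDiffOn (hW : (W : Set M) ⊆ φ.source) {G : (Fin p → 𝕜) → 𝕜}
    (hG : ContDiffOn 𝕜 ∞ G (φ '' W)) {x : M} (hx : x ∈ W) : DifferentiableAt 𝕜 G (φ x) :=
  (hG.differentiableOn (by simp)).differentiableAt ((isOpen_image hW).mem_nhds ⟨x, hx, rfl⟩)

theorem differentiableAt_rep (hW : (W : Set M) ⊆ φ.source) (g : coordFunctions φ W) {x : M}
    (hx : x ∈ W) : DifferentiableAt 𝕜 (rep g) (φ x) :=
  differentiableAt_of_contDiffOn hW (contDiffOn_rep g) hx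

/-- The partial derivatives. -/
noncomputable def partialDeriv (hW : (W : Set M) ⊆ φ.source) (i : Fin p) :
    coordFunctions φ W →ₗ[𝕜] coordFunctions φ W where
  toFun g := ⟨fun x => fderiv 𝕜 (rep g) (φ x) (Pi.single i 1),
    fun z => fderiv 𝕜 (rep g) z (Pi.single i 1), contDiffOn_fderiv hW (contDiffOn_rep g) _,
    fun _ => rfl⟩
  map_add' g h := by
    refine Subtype.ext (funext fun x => ?_)
    change fderiv 𝕜 (rep (g + h)) (φ x) (Pi.single i 1) =
      fderiv 𝕜 (rep g) (φ x) (Pi.single i 1) + fderiv 𝕜 (rep h) (φ x) (Pi.single i 1)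
    rw [fderiv_congr hW (H := rep g + rep h) (fun y hy => ?_) x.2,
      fderiv_add (differentiableAt_rep hW g x.2) (differentiableAt_rep hW h x.2)]
    · rfl
    · simp only [Pi.add_apply, ← apply_eq_rep _ (⟨y, hy⟩ : W)]
      rfl
  map_smul' c g := by
    refine Subtype.ext (funext fun x => ?_)
    change fderiv 𝕜 (rep (c • g)) (φ x) (Pi.single i 1) =
      c • fderiv 𝕜 (rep g) (φ x) (Pi.single i 1)
    rw [fderiv_congr hW (H := c • rep g) (fun y hy => ?_) x.2,
      fderiv_const_smul (differentiableAt_rep hW g x.2)]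
    · rfl
    · simp only [Pi.smul_apply, ← apply_eq_rep _ (⟨y, hy⟩ : W)]
      rfl

theorem partialDeriv_apply (hW : (W : Set M) ⊆ φ.source) (i : Fin p) (g : coordFunctions φ W)
    {G : (Fin p → 𝕜) → 𝕜} (hG : ∀ x : W, g.1 x = G (φ x)) (x : W) :
    (partialDeriv hW i g).1 x = fderiv 𝕜 G (φ x) (Pi.single i 1) := by
  change fderiv 𝕜 (rep g) (φ x) (Pi.single i 1) = _
  rw [fderiv_congr hW (fun y hy => ?_) x.2]
  rw [← apply_eq_rep _ (⟨y, hy⟩ : W), hG]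

theorem partialDeriv_mul (hW : (W : Set M) ⊆ φ.source) (i : Fin p) (g h : coordFunctions φ W) :
    partialDeriv hW i (g * h) = partialDeriv hW i g * h + g * partialDeriv hW i h := by
  refine Subtype.ext (funext fun x => ?_)
  rw [partialDeriv_apply hW i (g * h) (G := rep g * rep h) fun y => by
    simp only [Pi.mul_apply, ← apply_eq_rep _ y]
    rfl]
  change _ = (partialDeriv hW i g).1 x * h.1 x + g.1 x * (partialDeriv hW i h).1 x
  rw [partialDeriv_apply hW i g (apply_eq_rep g), partialDeriv_apply hW i h (apply_eq_rep h),
    fderiv_mul (differentiableAt_rep hW g x.2) (differentiableAt_rep hW h x.2), apply_eq_rep g,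
    apply_eq_rep h]
  simp
  ring

theorem res_partialDeriv (hW : (W : Set M) ⊆ φ.source) (hW' : W' ≤ W) (i : Fin p)
    (g : coordFunctions φ W) : coordFunctionsRes φ hW' (partialDeriv hW i g) =
      partialDeriv (Set.Subset.trans hW' hW) i (coordFunctionsRes φ hW' g) := by
  refine Subtype.ext (funext fun x => ?_)
  rw [partialDeriv_apply _ i (coordFunctionsRes φ hW' g) (G := rep g) fun y =>
    apply_eq_rep g ⟨y, hW' y.2⟩]
  exact partialDeriv_apply hW i g (apply_eq_rep g) ⟨x, hW' x.2⟩

theorem partialDeriv_comm (hW : (W : Set M) ⊆ φ.source) (i j : Fin p) (g : coordFunctions φ W) :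
    partialDeriv hW i (partialDeriv hW j g) = partialDeriv hW j (partialDeriv hW i g) := by
  have key : ∀ i j (x : W), (partialDeriv hW i (partialDeriv hW j g)).1 x =
      fderiv 𝕜 (fderiv 𝕜 (rep g)) (φ x) (Pi.single i 1) (Pi.single j 1) := by
    intro i j x
    rw [partialDeriv_apply hW i _ (G := fun z => fderiv 𝕜 (rep g) z (Pi.single j 1))
      (partialDeriv_apply hW j g (apply_eq_rep g)), fderiv_clm_apply]
    · simp
    · exact (((contDiffOn_infty_iff_fderiv_of_isOpen (isOpen_image hW)).1
        (contDiffOn_rep g)).2.differentiableOn (by simp)).differentiableAt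
          ((isOpen_image hW).mem_nhds ⟨x, x.2, rfl⟩)
    · exact differentiableAt_const _
  refine Subtype.ext (funext fun x => ?_)
  rw [key, key]
  have h : ContDiffAt 𝕜 ∞ (rep g) (φ x) :=
    (contDiffOn_rep g).contDiffAt ((isOpen_image hW).mem_nhds ⟨x, x.2, rfl⟩)
  exact (h.isSymmSndFDerivAt (by simpa using WithTop.coe_le_coe.2 (le_top : (2 : ℕ∞) ≤ ⊤))) _ _

variable (φ W) in
/-- The coordinates. -/
def coordinate (i : Fin p) : coordFunctions φ W :=
  ⟨fun x => φ x i, fun z => z i, (contDiff_apply 𝕜 𝕜 i).contDiffOn, fun _ => rfl⟩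

theorem partialDeriv_coordinate (hW : (W : Set M) ⊆ φ.source) (i j : Fin p) :
    partialDeriv hW i (coordinate φ W j) = if i = j then 1 else 0 := by
  refine Subtype.ext (funext fun x => ?_)
  rw [partialDeriv_apply hW i _ (G := fun z => z j) fun y => rfl]
  rw [(hasFDerivAt_apply j (φ x)).fderiv, ContinuousLinearMap.proj_apply, Pi.single_apply]
  split_ifs with h1 h2 h2
  · rfl
  · exact absurd h1.symm h2
  · exact absurd h2.symm h1
  · rfl

/-- Points of an open set in coordinates have coordinate balls as neighbourhoods. -/
theorem exists_ball (hW : (W : Set M) ⊆ φ.source) {x : M} (hx : x ∈ W) :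
    ∃ r > 0, Metric.ball (φ x) r ⊆ φ '' W :=
  Metric.isOpen_iff.1 (isOpen_image hW) _ ⟨x, hx, rfl⟩

theorem exists_opens_ball (hW : (W : Set M) ⊆ φ.source) {x : M} (hx : x ∈ W) {r : ℝ} (hr : 0 < r)
    (h : Metric.ball (φ x) r ⊆ φ '' W) :
    ∃ W' ≤ W, x ∈ W' ∧ φ '' W' ⊆ Metric.ball (φ x) r := by
  refine ⟨⟨φ.source ∩ φ ⁻¹' Metric.ball (φ x) r, φ.isOpen_inter_preimage Metric.isOpen_ball⟩, ?_,
    ⟨hW hx, Metric.mem_ball_self hr⟩, ?_⟩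
  · rintro y ⟨hy, hy'⟩
    obtain ⟨z, hz, hzy⟩ := h hy'
    rwa [← φ.injOn (hW hz) hy hzy]
  · rintro _ ⟨y, ⟨_, hy⟩, rfl⟩
    exact hy

/-- A derivation of the sheaf of coordinate functions which kills the coordinates is zero. -/
theorem derivation_eq_zero (hW : (W : Set M) ⊆ φ.source)
    (d : ∀ W' : Opens M, W' ≤ W → coordFunctions φ W' →ₗ[𝕜] coordFunctions φ W')
    (hd : ∀ W' hW' a b, d W' hW' (a * b) = d W' hW' a * b + a * d W' hW' b)
    (hres : ∀ (W' W'' : Opens M) (h : W' ≤ W) (h' : W'' ≤ W') (a : coordFunctions φ W'),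
      coordFunctionsRes φ h' (d W' h a) = d W'' (h'.trans h) (coordFunctionsRes φ h' a))
    (hx : ∀ i, d W le_rfl (coordinate φ W i) = 0) (a : coordFunctions φ W) : d W le_rfl a = 0 := by
  refine Subtype.ext (funext fun y => ?_)
  obtain ⟨r, hr, hball⟩ := exists_ball hW y.2
  obtain ⟨W', hW', hyW', hW'r⟩ := exists_opens_ball hW y.2 hr hball
  have hmem : ∀ x ∈ W', φ x - φ y ∈ Metric.ball (0 : Fin p → 𝕜) r := fun x hx => by
    simpa [dist_eq_norm] using hW'r ⟨x, hx, rfl⟩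
  -- Hadamard's lemma at `y` gives `a = a(y) + ∑ (xᵢ - yᵢ) bᵢ`, but only near `y`; this is why `d`
  -- is assumed compatible with restriction.
  obtain ⟨h, hh, hah⟩ := exists_sub_eq_apply (𝕜 := 𝕜) (g := fun z => rep a (φ y + z)) (r := r)
    (((contDiffOn_rep a).mono hball).comp (contDiff_const.add contDiff_id).contDiffOn
      fun z hz => by simpa using hz)
  let b : Fin p → coordFunctions φ W' := fun i => ⟨fun x => h (φ x - φ y) (Pi.single i 1),
    fun z => h (z - φ y) (Pi.single i 1), (hh.clm_apply contDiffOn_const).comp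
      (contDiff_id.sub contDiff_const).contDiffOn fun z hz => by
        obtain ⟨x, hx, rfl⟩ := hz
        exact hmem x hx, fun _ => rfl⟩
  have hconst : ∀ c : 𝕜, d W' hW' (algebraMap 𝕜 _ c) = 0 := by
    intro c
    have h1 := hd W' hW' 1 1
    rw [one_mul, one_mul, mul_one] at h1
    rw [Algebra.algebraMap_eq_smul_one, map_smul, left_eq_add.1 h1, smul_zero]
  have hcoord : ∀ i, d W' hW' (coordinate φ W' i) = 0 := by
    intro i
    have := hres W W' le_rfl hW' (coordinate φ W i)
    rw [hx, map_zero] at this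
    exact this.symm
  have ha : coordFunctionsRes φ hW' a = algebraMap 𝕜 _ (a.1 y) +
      ∑ i, (coordinate φ W' i - algebraMap 𝕜 _ (φ y i)) * b i := by
    refine Subtype.ext (funext fun x => ?_)
    have h1 := hah _ (hmem x x.2)
    rw [pi_clm_apply (h _)] at h1
    simp only [add_sub_cancel, add_zero, ← apply_eq_rep a y,
      ← apply_eq_rep a ⟨x.1, hW' x.2⟩] at h1
    have h2 : (coordFunctionsRes φ hW' a).1 x = a.1 ⟨x.1, hW' x.2⟩ := rfl
    rw [h2, eq_add_of_sub_eq' h1]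
    simp [Finset.sum_apply, b, coordinate, Algebra.algebraMap_eq_smul_one]
  have h1 := congrArg (fun g => g.1 ⟨y.1, hyW'⟩) (hres W W' le_rfl hW' a)
  have h2 : (coordFunctionsRes φ hW' (d W le_rfl a)).1 ⟨y.1, hyW'⟩ = (d W le_rfl a).1 y := rfl
  simp only [h2, ha, map_add, hconst, map_sum, hd, map_sub, hcoord] at h1
  -- After the Leibniz rule each remaining term has a factor `xᵢ - yᵢ`, which vanishes at `y`.
  rw [h1]
  simp [Finset.sum_apply, coordinate, Algebra.algebraMap_eq_smul_one]

/-- Flat linear systems for coordinate functions can be solved locally. -/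
theorem exists_primitive (hW : (W : Set M) ⊆ φ.source) {y : M} (hy : y ∈ W) {J : Type} [Fintype J]
    (Ω : Fin p → Matrix J J (coordFunctions φ W)) (c : Fin p → J → coordFunctions φ W)
    (flat : ∀ i l, (Ω l).map (partialDeriv hW i) + Ω i * Ω l =
      (Ω i).map (partialDeriv hW l) + Ω l * Ω i)
    (closed : ∀ i l j, partialDeriv hW i (c l j) + ∑ m, Ω i j m * c l m =
      partialDeriv hW l (c i j) + ∑ m, Ω l j m * c i m) :
    ∃ (W' : Opens M) (hW' : W' ≤ W), y ∈ W' ∧ ∃ b : J → coordFunctions φ W', ∀ i j,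
      partialDeriv (Set.Subset.trans hW' hW) i (b j) +
        ∑ m, coordFunctionsRes φ hW' (Ω i j m) * b m = coordFunctionsRes φ hW' (c i j) := by
  obtain ⟨r, hr, hball⟩ := exists_ball hW hy
  obtain ⟨ε, hε, hεr, b, hb, h⟩ := exists_primitive_of_flat_matrix hr
    (a := fun i j m => rep (Ω i j m)) (c := fun i j => rep (c i j))
    (fun i j m => (contDiffOn_rep _).mono hball) (fun i j => (contDiffOn_rep _).mono hball)
    (fun z hz i l j m => by
      obtain ⟨x, hx, rfl⟩ := hball hz
      have h1 := congrArg (fun g : coordFunctions φ W => g.1 ⟨x, hx⟩)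
        (congrFun (congrFun (flat i l) j) m)
      simp only [Matrix.add_apply, Matrix.map_apply, Matrix.mul_apply] at h1
      simp only [← apply_eq_rep _ (⟨x, hx⟩ : W)]
      simpa [Finset.sum_apply, partialDeriv_apply hW _ _ (apply_eq_rep _)] using h1)
    (fun z hz i l j => by
      obtain ⟨x, hx, rfl⟩ := hball hz
      have h1 := congrArg (fun g : coordFunctions φ W => g.1 ⟨x, hx⟩) (closed i l j)
      simp only [← apply_eq_rep _ (⟨x, hx⟩ : W)]
      simpa [Finset.sum_apply, partialDeriv_apply hW _ _ (apply_eq_rep _)] using h1)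
  obtain ⟨W', hW', hyW', hW'ε⟩ := exists_opens_ball hW hy hε
    ((Metric.ball_subset_ball hεr).trans hball)
  refine ⟨W', hW', hyW', fun j => ⟨fun x => b j (φ x), b j, (hb j).mono hW'ε, fun _ => rfl⟩,
    fun i j => Subtype.ext (funext fun x => ?_)⟩
  have h1 := h (φ x) (hW'ε ⟨x, x.2, rfl⟩) i j
  have hr : ∀ g : coordFunctions φ W, (coordFunctionsRes φ hW' g).1 x = rep g (φ x) := fun g =>
    apply_eq_rep g ⟨x, hW' x.2⟩
  rw [hr, ← h1]
  have h2 := partialDeriv_apply (Set.Subset.trans hW' hW) i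
    (⟨fun x => b j (φ x), b j, (hb j).mono hW'ε, fun _ => rfl⟩ : coordFunctions φ W')
    (G := b j) (fun _ => rfl) x
  simp [Finset.sum_apply, hr, h2]

end coordFunctions

/-- The splitting given by a chart. -/
noncomputable def SuperChart.toSplitCoordinates {𝕜 : Type t} [RCLike 𝕜] {M : Type u}
    [TopologicalSpace M] {X : SuperSpace.{t, u, v} 𝕜 M} {U : Opens M} {p q : ℕ}
    (C : SuperChart X U p q) : SplitCoordinates X U p q where
  R W := coordFunctions C.coord W
  r h := coordFunctionsRes C.coord h
  r_r _ _ _ := rfl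
  iso := C.iso
  iso_res := C.iso_res
  iso_σ := C.iso_σ
  x := coordFunctions.coordinate C.coord U
  δ _ hW := coordFunctions.partialDeriv (C.source_eq ▸ hW)
  δ_mul _ _ := coordFunctions.partialDeriv_mul _
  δ_res _ _ _ hW' := coordFunctions.res_partialDeriv _ hW'
  δ_comm _ _ := coordFunctions.partialDeriv_comm _
  δ_x := coordFunctions.partialDeriv_coordinate _
  ext _ hW d h1 h2 h3 := coordFunctions.derivation_eq_zero (C.source_eq ▸ hW) d h1 h2 h3

theorem SuperChart.hasPrimitives {𝕜 : Type t} [RCLike 𝕜] {M : Type u}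
    [TopologicalSpace M] {X : SuperSpace.{t, u, v} 𝕜 M} {U : Opens M} {p q : ℕ}
    (C : SuperChart X U p q) (y : M) :
    C.toSplitCoordinates.toSuperCoordinates.HasPrimitives y :=
  SplitCoordinates.hasPrimitives _ fun _ hV hy _ _ Ω c =>
    coordFunctions.exists_primitive (C.source_eq ▸ hV) hy Ω c

/-! ## Formal supermanifolds -/

namespace MvPowerSeries

variable {k : Type t} [Field k] {p : ℕ}

theorem le_order_sum {ι : Type*} (s : Finset ι) {f : ι → MvPowerSeries (Fin p) k} {n : ℕ∞}
    (h : ∀ i ∈ s, n ≤ (f i).order) : n ≤ (∑ i ∈ s, f i).order := by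
  classical
  induction s using Finset.induction_on with
  | empty => simp
  | insert i s hi ih =>
    rw [Finset.sum_insert hi]
    exact (le_min (h _ (Finset.mem_insert_self _ _))
      (ih fun j hj => h j (Finset.mem_insert_of_mem hj))).trans min_order_le_add

theorem add_one_le_order_X_mul {f : MvPowerSeries (Fin p) k} {n : ℕ∞} (h : n ≤ f.order)
    (i : Fin p) : n + 1 ≤ (X i * f).order := by
  refine le_trans ?_ le_order_mul
  rw [add_comm]
  exact add_le_add (one_le_order_iff_constCoeff_eq_zero.2 (constantCoeff_X i)) h

theorem le_order_mul_of_right {f : MvPowerSeries (Fin p) k} {n : ℕ∞} (h : n ≤ f.order)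
    (g : MvPowerSeries (Fin p) k) : n ≤ (g * f).order :=
  (h.trans le_add_self).trans le_order_mul

theorem coeff_X_mul_pderiv (i : Fin p) (f : MvPowerSeries (Fin p) k) (α : Fin p →₀ ℕ) :
    coeff α (X i * pderiv k i f) = (α i : k) * coeff α f := by
  rw [X, coeff_monomial_mul]
  split_ifs with h
  · obtain ⟨β, rfl⟩ := exists_add_of_le h
    rw [add_tsub_cancel_left, coeff_pderiv, one_mul, mul_comm, add_comm β]
    simp [add_comm]
  · have : α i = 0 := by
      by_contra h0
      exact h (Finsupp.single_le_iff.2 (Nat.one_le_iff_ne_zero.2 h0))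
    simp [this]

/-- The Euler operator multiplies homogeneous components by their degree. -/
theorem coeff_sum_X_mul_pderiv (f : MvPowerSeries (Fin p) k) (α : Fin p →₀ ℕ) :
    coeff α (∑ i, X i * pderiv k i f) = (α.degree : k) * coeff α f := by
  rw [map_sum, Finsupp.degree_eq_sum, Nat.cast_sum, Finset.sum_mul]
  exact Finset.sum_congr rfl fun i _ => coeff_X_mul_pderiv i f α

/-- The inverse of the Euler operator on power series without constant term. -/
noncomputable def eulerInv (f : MvPowerSeries (Fin p) k) : MvPowerSeries (Fin p) k :=
  -- In degree 0 the convention `0⁻¹ = 0` removes the constant term.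
  fun α => (α.degree : k)⁻¹ * coeff α f

theorem coeff_eulerInv (f : MvPowerSeries (Fin p) k) (α : Fin p →₀ ℕ) :
    coeff α (eulerInv f) = (α.degree : k)⁻¹ * coeff α f := rfl

theorem eulerInv_sub (f g : MvPowerSeries (Fin p) k) :
    eulerInv (f - g) = eulerInv f - eulerInv g := by
  ext α
  simp only [coeff_eulerInv, map_sub, mul_sub]

theorem le_order_eulerInv {f : MvPowerSeries (Fin p) k} {n : ℕ∞} (h : n ≤ f.order) :
    n ≤ (eulerInv f).order :=
  le_order fun α hα => by rw [coeff_eulerInv, coeff_of_lt_order (hα.trans_le h), mul_zero]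

theorem pderiv_comm (i j : Fin p) (f : MvPowerSeries (Fin p) k) :
    pderiv k i (pderiv k j f) = pderiv k j (pderiv k i f) := by
  ext α
  by_cases h : i = j
  · rw [h]
  · simp only [coeff_pderiv, Finsupp.add_apply, Finsupp.single_apply, if_neg h, if_neg (Ne.symm h),
      add_right_comm α (Finsupp.single i 1)]
    push_cast
    ring

variable [CharZero k]

/-- In characteristic zero every positive degree is invertible, so only the constant term is lost.
This is the formal counterpart of Hadamard's lemma. -/
theorem sum_X_mul_pderiv_eulerInv (f : MvPowerSeries (Fin p) k) :
    ∑ i, X i * pderiv k i (eulerInv f) = f - C (constantCoeff f) := by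
  ext α
  rw [coeff_sum_X_mul_pderiv, coeff_eulerInv, map_sub, coeff_C]
  split_ifs with h
  · subst h
    simp
  · have : (α.degree : k) ≠ 0 := by
      rw [Nat.cast_ne_zero]
      simpa [Finsupp.degree_eq_zero_iff] using h
    field_simp
    simp

/-- A derivation which kills the coordinates is zero, without any continuity assumption. -/
theorem derivation_eq_zero (d : MvPowerSeries (Fin p) k →ₗ[k] MvPowerSeries (Fin p) k)
    (hd : ∀ f g, d (f * g) = d f * g + f * d g) (hX : ∀ i, d (X i) = 0)
    (f : MvPowerSeries (Fin p) k) : d f = 0 := by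
  have hC : ∀ c : k, d (C c) = 0 := by
    intro c
    have h1 := hd 1 1
    rw [one_mul, one_mul, mul_one] at h1
    have : (C c : MvPowerSeries (Fin p) k) = c • 1 := by rw [smul_eq_C_mul, mul_one]
    rw [this, map_smul, left_eq_add.1 h1, smul_zero]
  -- Writing `f = f(0) + ∑ Xᵢ gᵢ` gives `d f = ∑ Xᵢ d gᵢ`. A bound on the order of all values of `d`
  -- therefore improves by one, again and again.
  have key : ∀ n : ℕ, ∀ f, (n : ℕ∞) ≤ (d f).order := by
    intro n
    induction n with
    | zero => simp
    | succ n ih =>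
      intro f
      have h : d f = ∑ i, X i * d (pderiv k i (eulerInv f)) := by
        have h1 := sum_X_mul_pderiv_eulerInv f
        rw [eq_sub_iff_add_eq] at h1
        conv_lhs => rw [← h1]
        simp [hC, hd, hX]
      rw [h, Nat.cast_add, Nat.cast_one]
      exact le_order_sum _ fun i _ => add_one_le_order_X_mul (ih _) i
  exact order_eq_top_iff.1 (ENat.eq_top_iff_forall_ge.2 fun n => key n f)

omit [CharZero k] in
/-- Operators which increase the order have fixed points. -/
theorem exists_fixedPoint {J : Type*}
    (T : (J → MvPowerSeries (Fin p) k) → J → MvPowerSeries (Fin p) k)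
    (hT : ∀ (n : ℕ) f g, (∀ j, (n : ℕ∞) ≤ (f j - g j).order) →
      ∀ j, (n : ℕ∞) + 1 ≤ (T f j - T g j).order) : ∃ f, T f = f := by
  let a : ℕ → J → MvPowerSeries (Fin p) k := fun n => T^[n] 0
  have ha : ∀ n, a (n + 1) = T (a n) := fun n => Function.iterate_succ_apply' T n 0
  have h1 : ∀ n m : ℕ, ∀ j, (n : ℕ∞) ≤ (a (n + m) j - a n j).order := by
    intro n m
    induction n with
    | zero => simp
    | succ n ih =>
      intro j
      rw [add_right_comm, ha, ha, Nat.cast_add, Nat.cast_one]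
      exact hT n _ _ ih j
  -- The iterates from step `n` on agree in degrees below `n`, so a coefficient of degree `m` is
  -- final from step `m + 1` on.
  let b : J → MvPowerSeries (Fin p) k := fun j α => coeff α (a (α.degree + 1) j)
  have hb : ∀ j α, coeff α (b j) = coeff α (a (α.degree + 1) j) := fun j α => rfl
  have h2 : ∀ (n : ℕ) j, (n : ℕ∞) ≤ (b j - a n j).order := by
    intro n j
    refine le_order fun α hα => ?_
    rw [Nat.cast_lt] at hα
    have h3 := coeff_of_lt_order (lt_of_lt_of_le (Nat.cast_lt.2 (Nat.lt_succ_self α.degree))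
      (h1 (α.degree + 1) (n - (α.degree + 1)) j))
    rw [Nat.add_sub_cancel' hα, map_sub] at h3
    rw [map_sub, hb, ← neg_sub, h3, neg_zero]
  refine ⟨b, funext fun j => sub_eq_zero.1 (order_eq_top_iff.1
    (ENat.eq_top_iff_forall_ge.2 fun n => ?_))⟩
  have h4 : T b j - b j = (T b j - T (a n) j) + (a (n + 1) j - b j) := by
    rw [ha]
    ring
  rw [h4]
  refine (le_min ?_ ?_).trans min_order_le_add
  · exact le_self_add.trans (hT n b (a n) (h2 n) j)
  · rw [← neg_sub, order_neg]
    exact (Nat.cast_le.2 n.le_succ).trans (h2 (n + 1) j)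

/-- Flat linear systems have formal solutions. -/
theorem exists_primitive {J : Type} [Fintype J]
    (Ω : Fin p → Matrix J J (MvPowerSeries (Fin p) k)) (c : Fin p → J → MvPowerSeries (Fin p) k)
    (flat : ∀ i l, (Ω l).map (pderiv k i) + Ω i * Ω l = (Ω i).map (pderiv k l) + Ω l * Ω i)
    (closed : ∀ i l j, pderiv k i (c l j) + ∑ m, Ω i j m * c l m =
      pderiv k l (c i j) + ∑ m, Ω l j m * c i m) :
    ∃ b : J → MvPowerSeries (Fin p) k, ∀ i j, pderiv k i (b j) + ∑ m, Ω i j m * b m = c i j := by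
  -- The fixed point equation is the radial part `∑ Xᵢ ∂ᵢ b = ∑ Xᵢ (cᵢ - Ωᵢ b)` of the system,
  -- solved for `b` with the inverse Euler operator. The factors `Xᵢ` raise the order of
  -- differences.
  obtain ⟨b, hb⟩ := exists_fixedPoint
    (fun (b : J → MvPowerSeries (Fin p) k) j =>
      eulerInv (∑ i, X i * (c i j - ∑ m, Ω i j m * b m))) (fun n f g h j => by
    rw [← eulerInv_sub, ← Finset.sum_sub_distrib]
    refine le_order_eulerInv (le_order_sum _ fun i _ => ?_)
    rw [← mul_sub, sub_sub_sub_cancel_left, ← Finset.sum_sub_distrib]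
    refine add_one_le_order_X_mul (le_order_sum _ fun m _ => ?_) i
    rw [← mul_sub, ← neg_sub, mul_neg, order_neg]
    exact le_order_mul_of_right (h m) _)
  -- the covariant derivatives
  let D : Fin p → (J → MvPowerSeries (Fin p) k) → J → MvPowerSeries (Fin p) k := fun i s j =>
    pderiv k i (s j) + ∑ m, Ω i j m * s m
  have hDsub : ∀ i s s' j, D i (fun j => s j - s' j) j = D i s j - D i s' j := by
    intro i s s' j
    simp only [D, map_sub, mul_sub, Finset.sum_sub_distrib]
    ring
  have hDcomm : ∀ i l s j, D i (D l s) j = D l (D i s) j := by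
    intro i l s j
    have hexp : ∀ i l, D i (D l s) j = pderiv k i (pderiv k l (s j)) +
        ∑ m, ((Ω l).map (pderiv k i) + Ω i * Ω l) j m * s m +
          ∑ m, (Ω l j m * pderiv k i (s m) + Ω i j m * pderiv k l (s m)) := by
      intro i l
      simp only [D, map_add, map_sum, Derivation.leibniz, smul_eq_mul, Matrix.add_apply,
        Matrix.map_apply, Matrix.mul_apply, mul_add, add_mul, Finset.sum_add_distrib,
        Finset.mul_sum, Finset.sum_mul]
      rw [Finset.sum_comm (f := fun x i_1 => Ω i j x * (Ω l x i_1 * s i_1))]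
      simp only [mul_comm, mul_left_comm]
      ring
    rw [hexp, hexp, flat i l, pderiv_comm i l]
    congr 1
    exact Finset.sum_congr rfl fun m _ => add_comm _ _
  -- The error `r` is closed for the flat connection, and its contraction with the Euler field
  -- vanishes by the choice of `b`.
  let r : Fin p → J → MvPowerSeries (Fin p) k := fun i j => c i j - D i b j
  have hr : ∀ i l j, D i (r l) j = D l (r i) j := by
    intro i l j
    have h1 : ∀ i l, D i (r l) j = D i (c l) j - D i (D l b) j := fun i l => hDsub i (c l) (D l b) j
    rw [h1, h1, hDcomm i l]
    congr 1
    exact closed i l j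
  have hrad : ∀ j, ∑ i, X i * r i j = 0 := by
    intro j
    have h1 : ∑ i, X i * pderiv k i (b j) = ∑ i, X i * (c i j - ∑ m, Ω i j m * b m) := by
      have h2 := sum_X_mul_pderiv_eulerInv (∑ i, X i * (c i j - ∑ m, Ω i j m * b m))
      have h3 := congrFun hb j
      beta_reduce at h3
      rw [h3] at h2
      rw [h2]
      simp
    have h2 : ∀ i, X i * r i j = X i * (c i j - ∑ m, Ω i j m * b m) - X i * pderiv k i (b j) := by
      intro i
      simp only [r, D]
      ring
    rw [Finset.sum_congr rfl fun i _ => h2 i, Finset.sum_sub_distrib, h1, sub_self]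
  -- Contract `D_l r_i = D_i r_l` with `X_l`. Moving `∂ᵢ` past `X_l` produces the additional `r_i`,
  -- and the remaining terms contain the zero radial part of `r`.
  have heuler : ∀ i j, ∑ l, X l * pderiv k l (r i j) + r i j =
      -∑ l, X l * ∑ m, Ω l j m * r i m := by
    intro i j
    have h1 : ∑ l, X l * D l (r i) j = ∑ l, X l * D i (r l) j :=
      Finset.sum_congr rfl fun l _ => by rw [hr]
    have h2 : ∑ l, X l * D i (r l) j = pderiv k i (∑ l, X l * r l j) - r i j +
        ∑ m, Ω i j m * ∑ l, X l * r l m := by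
      simp only [D, mul_add, Finset.sum_add_distrib, map_sum, Derivation.leibniz, smul_eq_mul,
        Finset.mul_sum]
      congr 1
      · rw [Finset.sum_eq_single (a := i) (f := fun x => r x j * pderiv k i (X x))
          (fun l _ hl => by rw [pderiv_X_of_ne hl, mul_zero]) (by simp), pderiv_X_self]
        ring
      · rw [Finset.sum_comm]
        exact Finset.sum_congr rfl fun m _ => Finset.sum_congr rfl fun l _ => by ring
    rw [h2] at h1
    simp only [hrad, map_zero, mul_zero, Finset.sum_const_zero, D, mul_add,
      Finset.sum_add_distrib] at h1
    linear_combination h1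
  -- The right hand side of `heuler` has larger order than `r`, while the left hand side multiplies
  -- a coefficient of degree `m` by `m + 1 ≠ 0`. So the order of `r` exceeds every bound.
  have key : ∀ n : ℕ, ∀ i j, (n : ℕ∞) ≤ (r i j).order := by
    intro n
    induction n with
    | zero => simp
    | succ n ih =>
      intro i j
      refine le_order fun α hα => ?_
      have h1 := congrArg (coeff α) (heuler i j)
      have h2 : ((n : ℕ∞) + 1) ≤ (-∑ l, X l * ∑ m, Ω l j m * r i m).order := by
        rw [order_neg]
        exact le_order_sum _ fun l _ => add_one_le_order_X_mul
          (le_order_sum _ fun m _ => le_order_mul_of_right (ih i m) _) l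
      have h3 : coeff α (-∑ l, X l * ∑ m, Ω l j m * r i m) = 0 :=
        coeff_of_lt_order (lt_of_lt_of_le hα (by exact_mod_cast h2))
      rw [map_add, coeff_sum_X_mul_pderiv, h3, ← add_one_mul] at h1
      exact (mul_eq_zero.1 h1).resolve_left (Nat.cast_add_one_ne_zero _)
  refine ⟨b, fun i j => ?_⟩
  have h1 : r i j = 0 := order_eq_top_iff.1 (ENat.eq_top_iff_forall_ge.2 fun n => key n i j)
  exact (sub_eq_zero.1 h1).symm

end MvPowerSeries

/-! ### Formal functions over an open point -/

section FormalPoint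

variable {k : Type t} [Field k] {M : Type u} [TopologicalSpace M] {X : SuperSpace.{t, u, v} k M}

/-- Sections over the empty set. -/
theorem SuperSpace.subsingleton_bot (X : SuperSpace.{t, u, v} k M) : Subsingleton (X.obj ⊥) := by
  have h : (⨆ i : PEmpty.{u + 1}, (i.elim : Opens M)) = ⊥ := iSup_of_empty _
  rw [← h]
  obtain ⟨a, _, ha⟩ := X.glue (fun i : PEmpty.{u + 1} => (i.elim : Opens M)) (fun i => i.elim)
    fun i => i.elim
  exact ⟨fun b c => (ha b fun i => i.elim).trans (ha c fun i => i.elim).symm⟩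

/-- An isomorphism between trivial algebras. -/
def AlgEquiv.ofSubsingletons (R A B : Type*) [CommRing R] [Ring A] [Ring B] [Algebra R A]
    [Algebra R B] [Subsingleton A] [Subsingleton B] : A ≃ₐ[R] B where
  toFun _ := 0
  invFun _ := 0
  left_inv _ := Subsingleton.elim _ _
  right_inv _ := Subsingleton.elim _ _
  map_mul' _ _ := Subsingleton.elim _ _
  map_add' _ _ := Subsingleton.elim _ _
  commutes' _ := Subsingleton.elim _ _

/-- Restriction of functions. -/
def Opens.restrictFun (k : Type t) [Field k] (A : Type v) [CommRing A] [Algebra k A]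
    {W W' : Opens M} (h : W' ≤ W) : (W → A) →ₐ[k] (W' → A) where
  toFun f x := f ⟨x.1, h x.2⟩
  map_one' := rfl
  map_mul' _ _ := rfl
  map_zero' := rfl
  map_add' _ _ := rfl
  commutes' _ := rfl

theorem Opens.eq_or_eq_bot {U W : Opens M} {x : M} (hU : (U : Set M) = {x}) (hW : W ≤ U) :
    W = U ∨ W = ⊥ := by
  have h : (W : Set M) ⊆ {x} := hU ▸ hW
  obtain h | h := Set.subset_singleton_iff_eq.1 h
  · exact Or.inr (Opens.ext h)
  · exact Or.inl (Opens.ext (h.trans hU.symm))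

/-- Functions on an open point with values in an algebra, as a splitting of the structure sheaf. -/
theorem exists_splitting_of_point {U : Opens M} {x : M} (hU : (U : Set M) = {x}) {q : ℕ}
    {A : Type w} [CommRing A] [Algebra k A] (e : X.obj U ≃ₐ[k] A ⊗[k] Grassmann k q)
    (he : ∀ a, e (X.σ a) = SuperTensor.σ k q A (e a)) :
    ∃ iso : ∀ W : Opens M, W ≤ U → X.obj W ≃ₐ[k] (W → A) ⊗[k] Grassmann k q,
      (∀ (W W' : Opens M) (hW : W ≤ U) (hW' : W' ≤ W) (a : X.obj W),
        iso W' (hW'.trans hW) (X.res hW' a) =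
          Algebra.TensorProduct.map (Opens.restrictFun k A hW') (AlgHom.id k _) (iso W hW a)) ∧
      ∀ (W : Opens M) (hW : W ≤ U) (a : X.obj W),
        iso W hW (X.σ a) = SuperTensor.σ k q (W → A) (iso W hW a) := by
  have := X.subsingleton_bot
  -- Below an open point there are only the point and the empty set. The algebra `W → A` handles
  -- both: it is `A` over the point and zero over the empty set, like the structure sheaf.
  have hsub : ∀ W : Opens M, W = ⊥ → Subsingleton ((W → A) ⊗[k] Grassmann k q) := by
    rintro W rfl
    have : IsEmpty ((⊥ : Opens M) : Type u) := ⟨fun x => x.2⟩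
    exact ⟨fun a b => by
      have h : (1 : ((⊥ : Opens M) → A) ⊗[k] Grassmann k q) = 0 := by
        rw [Algebra.TensorProduct.one_def, Subsingleton.elim (1 : ((⊥ : Opens M) → A)) 0,
          TensorProduct.zero_tmul]
      rw [← one_mul a, ← one_mul b, h, zero_mul, zero_mul]⟩
  have hx : x ∈ U := by
    change x ∈ (U : Set M)
    rw [hU]
    rfl
  let uU : Unique U :=
    { default := ⟨x, hx⟩
      uniq := fun y => Subtype.ext (by
        have : y.1 ∈ (U : Set M) := y.2
        rwa [hU] at this) }
  let e' : X.obj U ≃ₐ[k] (U → A) ⊗[k] Grassmann k q :=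
    e.trans (Algebra.TensorProduct.congr (AlgEquiv.funUnique k U A).symm AlgEquiv.refl)
  have he' : ∀ a, e' (X.σ a) = SuperTensor.σ k q (U → A) (e' a) := by
    intro a
    have key : ∀ z : A ⊗[k] Grassmann k q,
        Algebra.TensorProduct.congr (AlgEquiv.funUnique k U A).symm AlgEquiv.refl
          (SuperTensor.σ k q A z) = SuperTensor.σ k q (U → A)
        (Algebra.TensorProduct.congr (AlgEquiv.funUnique k U A).symm AlgEquiv.refl z) := by
      intro z
      induction z using TensorProduct.induction_on with
      | zero => simp
      | add x y hx hy => simp only [map_add, hx, hy]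
      | tmul b c => simp
    simp only [e', AlgEquiv.trans_apply, he, key]
  have hid : ∀ z, Algebra.TensorProduct.map (Opens.restrictFun k A (le_refl U)) (AlgHom.id k
      (Grassmann k q)) z = z := by
    intro z
    have : Opens.restrictFun k A (le_refl U) = AlgHom.id k _ := rfl
    rw [this, Algebra.TensorProduct.map_id, AlgHom.id_apply]
  have hex : ∀ W : Opens M, W ≤ U → ∃ f : X.obj W ≃ₐ[k] (W → A) ⊗[k] Grassmann k q,
      ∀ h : W = U, ∀ a, f (X.res h.le a) =
        Algebra.TensorProduct.map (Opens.restrictFun k A h.le) (AlgHom.id k _) (e' a) := by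
    intro W hW
    obtain rfl | rfl := Opens.eq_or_eq_bot hU hW
    · exact ⟨e', fun _ a => by rw [hid, X.res_self]⟩
    · have := hsub ⊥ rfl
      exact ⟨AlgEquiv.ofSubsingletons _ _ _, fun _ _ => Subsingleton.elim _ _⟩
  choose iso hiso using hex
  have hisoU : ∀ a, iso U le_rfl a = e' a := by
    intro a
    have := hiso U le_rfl rfl a
    rwa [hid, X.res_self] at this
  refine ⟨iso, fun W W' hW hW' a => ?_, fun W hW a => ?_⟩
  · obtain h | h := Opens.eq_or_eq_bot hU (hW'.trans hW)
    · subst h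
      obtain rfl := le_antisymm hW hW'
      rw [X.res_self, hid]
    · have := hsub W' h
      exact Subsingleton.elim _ _
  · obtain h | h := Opens.eq_or_eq_bot hU hW
    · subst h
      rw [hisoU, hisoU, he']
    · have := hsub W h
      exact Subsingleton.elim _ _

/-- The splitting of the structure sheaf at a point of a formal supermanifold. -/
theorem exists_splitCoordinates_of_formal [CharZero k] {U : Opens M} {x : M}
    (hU : (U : Set M) = {x}) {p q : ℕ}
    (e : X.obj U ≃ₐ[k] MvPowerSeries (Fin p) k ⊗[k] Grassmann k q)
    (he : ∀ a, e (X.σ a) = SuperTensor.σ k q _ (e a)) :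
    ∃ S : SuperCoordinates X U p q, S.HasPrimitives x := by
  obtain ⟨iso, hres, hσ⟩ := exists_splitting_of_point hU e he
  let T : SplitCoordinates X U p q :=
    { R := fun W => W → MvPowerSeries (Fin p) k
      r := Opens.restrictFun k _
      r_r := fun _ _ _ => rfl
      iso := iso
      iso_res := hres
      iso_σ := hσ
      x := fun i _ => MvPowerSeries.X i
      δ := fun W _ i => (MvPowerSeries.pderiv k i).toLinearMap.compLeft W
      δ_mul := fun W _ i a b => funext fun y => by
        simp [mul_comm, add_comm]
      δ_res := fun _ _ _ _ _ _ => rfl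
      δ_comm := fun _ _ i j a => funext fun y => MvPowerSeries.pderiv_comm i j (a y)
      δ_x := fun i j => funext fun y => by
        change MvPowerSeries.pderiv k i (MvPowerSeries.X j) = _
        split_ifs with h
        · rw [h, MvPowerSeries.pderiv_X_self]
          rfl
        · rw [MvPowerSeries.pderiv_X_of_ne (Ne.symm h)]
          rfl
      ext := fun W hW d hd _ hx a => funext fun y => by
        -- `W` lies in a single point, so each function on it is constant and the derivation may be
        -- read as one of power series.
        have hsub : ∀ f : W → MvPowerSeries (Fin p) k, f = fun _ => f y := by
          intro f
          funext z
          congr 1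
          have hz : z.1 ∈ (U : Set M) := hW z.2
          have hy : y.1 ∈ (U : Set M) := hW y.2
          rw [hU] at hz hy
          exact Subtype.ext (hz.trans hy.symm)
        rw [hsub a]
        exact MvPowerSeries.derivation_eq_zero
          (LinearMap.proj y ∘ₗ d W le_rfl ∘ₗ LinearMap.pi fun _ => LinearMap.id)
          (fun f g => congrFun (hd W le_rfl (fun _ => f) fun _ => g) y)
          (fun i => congrFun (hx i) y) (a y) }
  refine ⟨T.toSuperCoordinates, T.hasPrimitives fun V hV hxV J _ Ω c flat closed => ?_⟩
  let y : V := ⟨x, hxV⟩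
  have hy : ∀ z : V, z = y := fun z => Subtype.ext (by
    have hz : z.1 ∈ (U : Set M) := hV z.2
    rwa [hU] at hz)
  let ev : T.R V →ₐ[k] MvPowerSeries (Fin p) k :=
    Pi.evalAlgHom k (fun _ : V => MvPowerSeries (Fin p) k) y
  have hev : ∀ i a, ev (T.δ V hV i a) = MvPowerSeries.pderiv k i (ev a) := fun _ _ => rfl
  obtain ⟨b, hb⟩ := MvPowerSeries.exists_primitive (fun i => (Ω i).map ev)
    (fun i j => ev (c i j))
    (fun i l => by
      refine Matrix.ext fun j m => ?_
      have h := congrArg ev (congrFun (congrFun (flat i l) j) m)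
      simpa only [Matrix.add_apply, Matrix.map_apply, Matrix.mul_apply, map_add, map_sum, map_mul,
        hev] using h)
    (fun i l j => by
      have h := congrArg ev (closed i l j)
      simpa only [Matrix.map_apply, map_add, map_sum, map_mul, hev] using h)
  have hinj : ∀ f g : T.R V, ev f = ev g → f = g := fun f g h => funext fun z => by
    rw [hy z]
    exact h
  let b' : J → T.R V := fun j _ => b j
  have hb' : ∀ j, ev (b' j) = b j := fun _ => rfl
  -- The formal solution exists over all of `V`; no shrinking is needed.
  refine ⟨V, le_rfl, hxV, b', fun i j => hinj _ _ ?_⟩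
  have hr : ∀ f, ev (T.r le_rfl f) = ev f := fun _ => rfl
  simpa only [map_add, map_sum, map_mul, hev, hb', hr, Matrix.map_apply] using hb i j

end FormalPoint

/-! ### The smooth, complex analytic and formal cases -/

theorem proposition3p2 :
    -- smooth supermanifolds
    (∀ {M : Type u} [TopologicalSpace M] (X : SuperSpace.{0, u, v} ℝ M)
      (F : SuperModule.{0, u, v, w} X)
      (nabla : SuperConnection F) (A : SuperOneFormOperator F),
      X.IsSupermanifold → F.IsLocallyFree → nabla.IsFlat →
      (nabla.IsFlatPencil A ↔
        (∀ x : M, ∃ U : Opens M, x ∈ U ∧ ∃ B : SuperEnd F U, nabla.IsPotential A B) ∧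
        ∀ (U : Opens M) (B : SuperEnd F U), nabla.IsPotential A B → nabla.IsWedgeSquareZero B)) ∧
    -- complex analytic supermanifolds
    (∀ {M : Type u} [TopologicalSpace M] (X : SuperSpace.{0, u, v} ℂ M)
      (F : SuperModule.{0, u, v, w} X)
      (nabla : SuperConnection F) (A : SuperOneFormOperator F),
      X.IsSupermanifold → F.IsLocallyFree → nabla.IsFlat →
      (nabla.IsFlatPencil A ↔
        (∀ x : M, ∃ U : Opens M, x ∈ U ∧ ∃ B : SuperEnd F U, nabla.IsPotential A B) ∧
        ∀ (U : Opens M) (B : SuperEnd F U), nabla.IsPotential A B → nabla.IsWedgeSquareZero B)) ∧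
    -- formal supermanifolds over a field of characteristic zero
    (∀ {k : Type t} [Field k] [CharZero k] {M : Type u} [TopologicalSpace M]
      (X : SuperSpace.{t, u, v} k M) (F : SuperModule.{t, u, v, w} X)
      (nabla : SuperConnection F) (A : SuperOneFormOperator F),
      X.IsFormalSupermanifold → F.IsLocallyFree → nabla.IsFlat →
      (nabla.IsFlatPencil A ↔
        (∀ x : M, ∃ U : Opens M, x ∈ U ∧ ∃ B : SuperEnd F U, nabla.IsPotential A B) ∧
        ∀ (U : Opens M) (B : SuperEnd F U), nabla.IsPotential A B → nabla.IsWedgeSquareZero B)) := by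
  refine ⟨fun X F nabla A hX hF hflat => isFlatPencil_iff_of_coordinates (fun x => ?_) hF hflat,
    fun X F nabla A hX hF hflat => isFlatPencil_iff_of_coordinates (fun x => ?_) hF hflat,
    fun X F nabla A hX hF hflat => isFlatPencil_iff_of_coordinates (fun x => ?_) hF hflat⟩
  · obtain ⟨U, hx, p, q, ⟨C⟩⟩ := hX x
    exact ⟨U, p, q, C.toSplitCoordinates.toSuperCoordinates, hx, C.hasPrimitives x⟩
  · obtain ⟨U, hx, p, q, ⟨C⟩⟩ := hX x
    exact ⟨U, p, q, C.toSplitCoordinates.toSuperCoordinates, hx, C.hasPrimitives x⟩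
  · obtain ⟨U, hU, p, q, e, he⟩ := hX x
    obtain ⟨S, hS⟩ := exists_splitCoordinates_of_formal hU e he
    refine ⟨U, p, q, S, ?_, hS⟩
    change x ∈ (U : Set _)
    rw [hU]
    rfl
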